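/- **Setting.** Let $k,\ell\ge 1$ and $q_1,\dots,q_k\ge 1$ be integers, $\Sigma=\{1,\dots,\ell\}^{\mathbb N}$ the one-sided full shift with left shift $\sigma$, and $\mathcal P=\{[i]:1\le i\le \ell\}$ with $[i]=\{x\in\Sigma: x_1=i\}$. A *$C^1$ IFS* on a nonempty compact set $X\subset\mathbb R^d$ is a family $\{S_i\}_{i=1}^{\ell}$ of maps $S_i:X\to X$ that extend, on some open set $U\supset X$, to $C^1$ diffeomorphisms $S_i:U\to S_i(U)\subset U$ which are contracting (Lipschitz with constant $<1$). Its attractor $K$ is the unique nonempty compact set $K\subset X$ with $K=\bigcup_i S_i(K)$. Its canonical projection $\pi:\Sigma\to K$ is given by $\{\pi(x)\}=\bigcap_{n\ge1}S_{x_1}\circ\cdots\circ S_{x_n}(K)$. With $S_{x_1\ldots x_n}=S_{x_1}\circ\cdots\circ S_{x_n}$, and with $\|M\|$ and $\lfloor M\rfloor$ the largest and smallest singular values of a matrix $M$, the upper and lower Lyapunov exponents at $x\in\Sigma$ are $$\overline\lambda(x)=-\liminf_{n\to\infty}\tfrac1n\log\lfloor S'_{x_1\ldots x_n}(\pi\sigma^nx)\rfloor,\qquad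 \underline\lambda(x)=-\limsup_{n\to\infty}\tfrac1n\log\|S'_{x_1\ldots x_n}(\pi\sigma^nx)\| .$$ If they are equal, their common value is the Lyapunov exponent $\lambda(x)$. For a $\sigma$-invariant Borel probability measure $m$ on $\Sigma$, the IFS is *$m$-conformal* if $\lambda(x)$ exists for $m$-a.e. $x$. For a map $\pi$ from $\Sigma$ to a Euclidean space with Borel $\sigma$-algebra $\gamma$, the *projection entropy* is $$h_\pi(\sigma,m)=H_m(\mathcal P\mid\sigma^{-1}\pi^{-1}\gamma)-H_m(\mathcal P\mid\pi^{-1}\gamma),\qquad H_m(\mathcal P\mid\mathcal A)=-\int\sum_{A\in\mathcal P}\chi_A\log \mathbf E_m(\chi_A\mid\mathcal A)\,dm .$$ For a probability measure $\mu$, the local dimension is $d(\mu,z)=\lim_{r\to0}\frac{\log\mu(B(z,r))}{\log r}$ ($B(z,r)$ is the closed Euclidean ball), when the upper and lower limits agree. The measure $\mu$ is *exactly dimensional* if there is a constant $C$ such that $d(\mu,z)$ exists and equals $C$ for $\mu$-a.e. $z$. **Theorem.** For $j=1,\dots,k$ let $\Phi_j=\{S_{i,j}\}_{i=1}^\ell$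 be a $C^1$ IFS on a compact set $X_j\subset\mathbb R^{q_j}$. Let $\Phi=\Phi_1\times\cdots\times\Phi_k$ be the direct product, that is, the IFS on $X_1\times\cdots\times X_k$ with maps $S_i(z_1,\dots,z_k)=(S_{i,1}(z_1),\dots,S_{i,k}(z_k))$, and let $\pi$ be its canonical projection. Let $m$ be a $\sigma$-invariant Borel probability measure on $\Sigma$ such that $\Phi_1,\dots,\Phi_k$ are all $m$-conformal, and put $\mu=m\circ\pi^{-1}$. Then: (i) $d(\mu,z)$ exists (and is finite) for $\mu$-a.e. $z$. (ii) Assume furthermore that $m$ is ergodic. Then $\mu$ is exactly dimensional. Moreover, let $\lambda_j=\int\lambda_j(x)\,dm(x)$, where $\lambda_j(x)$ is the Lyapunov exponent of $\Phi_j$ at $x$, and let $\tau$ be any permutation of $\{1,\dots,k\}$ with $\lambda_{\tau(1)}\le\cdots\le\lambda_{\tau(k)}$. Then $$d(\mu,z)=\frac{h_{\pi_1}(\sigma,m)}{\lambda_{\tau(1)}}+\sum_{j=2}^k\frac{h_{\pi_j}(\sigma,m)-h_{\pi_{j-1}}(\sigma,m)}{\lambda_{\tau(j)}}\qquad\text{for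 }\mu\text{-a.e. }z,$$ where $\pi_j$ is the canonical projection of the IFS $\Phi_{\tau(1)}\times\cdots\times\Phi_{\tau(j)}$. -/

import Mathlib

open MeasureTheory ProbabilityTheory Filter Topology
open scoped ENNReal NNReal

noncomputable section

/-! ### The one-sided full shift -/

/-- The full shift space over `ℓ` symbols (positions are numbered from `0`). -/
abbrev ShiftSpace (ℓ : ℕ) : Type := ℕ → Fin ℓ

/-- The left shift `σ`. -/
def shift (ℓ : ℕ) (x : ShiftSpace ℓ) : ShiftSpace ℓ := fun n => x (n + 1)

/-- The cylinder `[j] = {x : x₁ = j}`; the family of all `[j]` is the partition `𝒫`. -/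
def cyl (ℓ : ℕ) (j : Fin ℓ) : Set (ShiftSpace ℓ) := {x | x 0 = j}

/-! ### Iterated function systems, attractors, coding maps -/

section IFS

variable {ℓ : ℕ} {E : Type*} [NormedAddCommGroup E] [NormedSpace ℝ E]

/-- `K` is an attractor on `X` of the system `S`: a nonempty compact subset of `X` with
`K = ⋃ᵢ Sᵢ(K)`. -/
def IsAttractor (X : Set E) (S : Fin ℓ → E → E) (K : Set E) : Prop :=
  K ⊆ X ∧ IsCompact K ∧ K.Nonempty ∧ K = ⋃ i, S i '' K

/-- The attractor on `X` of the system `S` (for contractive maps of a nonempty compact set `X`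
into itself it exists and is unique, see `existsUnique_isAttractor`). -/
def attractor (X : Set E) (S : Fin ℓ → E → E) : Set E :=
  Classical.epsilon (IsAttractor X S)

/-- `S_{x₁ … xₙ} = S_{x₁} ∘ ⋯ ∘ S_{xₙ}`. -/
def wordMap (S : Fin ℓ → E → E) (x : ShiftSpace ℓ) : ℕ → E → E
  | 0 => id
  | n + 1 => wordMap S x n ∘ S (x n)

/-- The canonical projection `π`, given by `{π x} = ⋂ₙ S_{x₁ … xₙ}(K)` with `K` the attractor
(see `iInter_wordMap_image_attractor`). -/
def codingMap (X : Set E) (S : Fin ℓ → E → E) (x : ShiftSpace ℓ) : E :=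
  Classical.epsilon fun z => (⋂ n : ℕ, wordMap S x (n + 1) '' attractor X S) = {z}

/-- `S` is a `C¹` IFS on the nonempty compact set `X`: the maps send `X` into itself and are, on
some open set `U ⊇ X`, contracting `C¹` diffeomorphisms `Sᵢ : U → Sᵢ(U) ⊆ U`. (The maps are total
functions; only their values on `U` matter.) -/
def IsC1IFS (X : Set E) (S : Fin ℓ → E → E) : Prop :=
  IsCompact X ∧ X.Nonempty ∧ (∀ i, Set.MapsTo (S i) X X) ∧
    ∃ U : Set E, IsOpen U ∧ X ⊆ U ∧ ∀ i,
      Set.MapsTo (S i) U U ∧ Set.InjOn (S i) U ∧ ContDiffOn ℝ 1 (S i) U ∧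
      (∀ z ∈ U, (fderiv ℝ (S i) z).IsInvertible) ∧
      ∃ c : ℝ≥0, c < 1 ∧ LipschitzOnWith c (S i) U

/-! ### Lyapunov exponents -/

/-- The smallest singular value `min {|Mv| : |v| = 1}`. -/
def smallestSingularValue (M : E →L[ℝ] E) : ℝ :=
  ⨅ v : Metric.sphere (0 : E) 1, ‖M v‖

/-- The differential `S'_{x₁ … xₙ}(π σⁿ x)`. -/
def wordDeriv (X : Set E) (S : Fin ℓ → E → E) (x : ShiftSpace ℓ) (n : ℕ) : E →L[ℝ] E :=
  fderiv ℝ (wordMap S x n) (codingMap X S ((shift ℓ)^[n] x))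

/-- The upper Lyapunov exponent at `x`. -/
def upperLyapunov (X : Set E) (S : Fin ℓ → E → E) (x : ShiftSpace ℓ) : ℝ :=
  -liminf (fun n : ℕ => (1 / (n : ℝ)) * Real.log (smallestSingularValue (wordDeriv X S x n))) atTop

/-- The lower Lyapunov exponent at `x`. -/
def lowerLyapunov (X : Set E) (S : Fin ℓ → E → E) (x : ShiftSpace ℓ) : ℝ :=
  -limsup (fun n : ℕ => (1 / (n : ℝ)) * Real.log ‖wordDeriv X S x n‖) atTop

/-- `S` is `m`-conformal: the Lyapunov exponent exists at `m`-almost every point. -/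
def IsConformalFor (m : Measure (ShiftSpace ℓ)) (X : Set E) (S : Fin ℓ → E → E) : Prop :=
  ∀ᵐ x ∂m, upperLyapunov X S x = lowerLyapunov X S x

/-- The integrated Lyapunov exponent `∫ λ(x) dm(x)`; where the exponent `λ(x)` exists it is the
common value of the upper and the lower one. -/
def lyapunovIntegral (m : Measure (ShiftSpace ℓ)) (X : Set E) (S : Fin ℓ → E → E) : ℝ :=
  ∫ x, upperLyapunov X S x ∂m

end IFS

/-! ### Direct products -/

section Product

variable {ℓ : ℕ} {ι : Type*} [Fintype ι] {E : ι → Type*}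

/-- The product `∏ⱼ Xⱼ`, inside the product space with its Euclidean norm. -/
def prodSet (X : ∀ a, Set (E a)) : Set (PiLp 2 E) := {z | ∀ a, z a ∈ X a}

/-- The maps `Sᵢ(z₁, …, z_k) = (S_{i,1}(z₁), …, S_{i,k}(z_k))` of the direct product. -/
def prodMaps (S : ∀ a, Fin ℓ → E a → E a) (i : Fin ℓ) (z : PiLp 2 E) : PiLp 2 E :=
  WithLp.toLp 2 fun a => S a i (z a)

end Product

/-! ### Conditional information and projection entropy -/

section Entropy

/-- The conditional information `-∑_A χ_A log E(χ_A | 𝒜)` of a finite partition `ξ`. -/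
def condInformation {Ω ι : Type*} [Fintype ι] (𝒜 : MeasurableSpace Ω) [MeasurableSpace Ω]
    (ν : Measure Ω) (ξ : ι → Set Ω) (x : Ω) : ℝ :=
  -∑ a, (ξ a).indicator (fun _ => (1 : ℝ)) x *
    Real.log ((ν[(ξ a).indicator (fun _ => (1 : ℝ)) | 𝒜]) x)

/-- The conditional entropy of a finite partition `ξ` given `𝒜`. -/
def condEntropy {Ω ι : Type*} [Fintype ι] (𝒜 : MeasurableSpace Ω) [MeasurableSpace Ω]
    (ν : Measure Ω) (ξ : ι → Set Ω) : ℝ :=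
  ∫ x, condInformation 𝒜 ν ξ x ∂ν

/-- The projection entropy `H_m(𝒫 | σ⁻¹ π⁻¹ γ) - H_m(𝒫 | π⁻¹ γ)`, with `γ` the Borel
`σ`-algebra of the target of `π`. -/
def projEntropy {ℓ : ℕ} {F : Type*} [γ : MeasurableSpace F] (m : Measure (ShiftSpace ℓ))
    (π : ShiftSpace ℓ → F) : ℝ :=
  condEntropy ((γ.comap π).comap (shift ℓ)) m (cyl ℓ) - condEntropy (γ.comap π) m (cyl ℓ)

end Entropy

/-! ### Local dimensions -/

section LocalDim

variable {F : Type*} [PseudoMetricSpace F] [MeasurableSpace F]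

/-- The upper local dimension of `μ` at `z`, in `[-∞, ∞]`. -/
def upperLocalDim (μ : Measure F) (z : F) : EReal :=
  limsup (fun r : ℝ => ENNReal.log (μ (Metric.closedBall z r)) / (Real.log r : EReal)) (𝓝[>] 0)

/-- The lower local dimension of `μ` at `z`, in `[-∞, ∞]`. -/
def lowerLocalDim (μ : Measure F) (z : F) : EReal :=
  liminf (fun r : ℝ => ENNReal.log (μ (Metric.closedBall z r)) / (Real.log r : EReal)) (𝓝[>] 0)

/-- The local dimension `d(μ, z)` exists and equals the real number `d`. -/
def HasLocalDim (μ : Measure F) (z : F) (d : ℝ) : Prop :=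
  upperLocalDim μ z = (d : EReal) ∧ lowerLocalDim μ z = (d : EReal)

/-- `μ` is exactly dimensional: the local dimension exists and is constant almost everywhere. -/
def IsExactDimensional (μ : Measure F) : Prop :=
  ∃ C : ℝ, ∀ᵐ z ∂μ, HasLocalDim μ z C

end LocalDim

/-! ### The attractor and the coding map are well defined -/

section WellDefined

variable {ℓ : ℕ} {E : Type*} [NormedAddCommGroup E]

theorem wordMap_lipschitzOn {X : Set E} {S : Fin ℓ → E → E} {c : ℝ≥0}
    (hmaps : ∀ i, Set.MapsTo (S i) X X) (hc : ∀ i, LipschitzOnWith c (S i) X)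
    (x : ShiftSpace ℓ) (n : ℕ) :
    LipschitzOnWith (c ^ n) (wordMap S x n) X ∧ Set.MapsTo (wordMap S x n) X X := by
  induction n with
  | zero => exact ⟨by simpa [wordMap] using LipschitzWith.id.lipschitzOnWith, fun z hz => hz⟩
  | succ n ih =>
    refine ⟨?_, ih.2.comp (hmaps _)⟩
    rw [pow_succ]
    exact ih.1.comp (hc _) (hmaps _)

theorem exists_isAttractor [NeZero ℓ] {X : Set E} {S : Fin ℓ → E → E} {c : ℝ≥0}
    (hX : IsCompact X) (hne : X.Nonempty) (hmaps : ∀ i, Set.MapsTo (S i) X X)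
    (hc : ∀ i, LipschitzOnWith c (S i) X) : ∃ K, IsAttractor X S K := by
  let H : Set E → Set E := fun A => ⋃ i, S i '' A
  have Hmono : ∀ {A B : Set E}, A ⊆ B → H A ⊆ H B := fun h =>
    Set.iUnion_mono fun i => Set.image_mono h
  let A : ℕ → Set E := fun n => H^[n] X
  have Asucc : ∀ n, A (n + 1) = H (A n) := fun n => Function.iterate_succ_apply' H n X
  have Adec : ∀ n, A (n + 1) ⊆ A n := by
    intro n
    induction n with
    | zero => exact Set.iUnion_subset fun i => (hmaps i).image_subset
    | succ n ih => rw [Asucc (n + 1)]; nth_rw 2 [Asucc n]; exact Hmono ih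
  have Aanti : Antitone A := antitone_nat_of_succ_le Adec
  have AX : ∀ n, A n ⊆ X := fun n => Aanti (Nat.zero_le n)
  have Acpt : ∀ n, IsCompact (A n) ∧ (A n).Nonempty := by
    intro n
    induction n with
    | zero => exact ⟨hX, hne⟩
    | succ n ih =>
      rw [Asucc]
      refine ⟨isCompact_iUnion fun i => ih.1.image_of_continuousOn
        ((hc i).continuousOn.mono (AX n)), ?_⟩
      obtain ⟨z, hz⟩ := ih.2
      exact ⟨S 0 z, Set.mem_iUnion.2 ⟨0, z, hz, rfl⟩⟩
  refine ⟨⋂ n, A n, Set.iInter_subset_of_subset 0 le_rfl,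
    hX.of_isClosed_subset (isClosed_iInter fun n => (Acpt n).1.isClosed)
      (Set.iInter_subset_of_subset 0 le_rfl), ?_, Set.Subset.antisymm ?_ ?_⟩
  · exact IsCompact.nonempty_iInter_of_sequence_nonempty_isCompact_isClosed A Adec
      (fun n => (Acpt n).2) hX (fun n => (Acpt n).1.isClosed)
  · intro z hz
    have hz' : ∀ n, ∃ i, z ∈ S i '' A n := fun n => by
      have := Set.mem_iInter.1 hz (n + 1)
      rw [Asucc] at this
      exact Set.mem_iUnion.1 this
    choose i hi using hz'
    obtain ⟨j, hj⟩ := Finite.exists_infinite_fiber i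
    have hjn : ∀ n, z ∈ S j '' A n := by
      intro n
      obtain ⟨p, hp, hnp⟩ := (Set.infinite_coe_iff.1 hj).exists_gt n
      have := hi p
      rw [show i p = j from hp] at this
      exact Set.image_mono (Aanti hnp.le) this
    have hcl : ∀ n, IsCompact (A n ∩ S j ⁻¹' {z}) := fun n => (Acpt n).1.of_isClosed_subset
      (((hc j).continuousOn.mono (AX n)).preimage_isClosed_of_isClosed (Acpt n).1.isClosed
        isClosed_singleton) Set.inter_subset_left
    obtain ⟨w, hw⟩ := IsCompact.nonempty_iInter_of_sequence_nonempty_isCompact_isClosed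
      (fun n => A n ∩ S j ⁻¹' {z}) (fun n => Set.inter_subset_inter_left _ (Adec n))
      (fun n => let ⟨w, hw, e⟩ := hjn n; ⟨w, hw, e⟩) (hcl 0) (fun n => (hcl n).isClosed)
    rw [Set.mem_iInter] at hw
    exact Set.mem_iUnion.2 ⟨j, w, Set.mem_iInter.2 fun n => (hw n).1, (hw 0).2⟩
  · intro z hz
    obtain ⟨i, w, hw, rfl⟩ := Set.mem_iUnion.1 hz
    refine Set.mem_iInter.2 fun n => Adec n ?_
    rw [Asucc]
    exact Set.mem_iUnion.2 ⟨i, w, Set.mem_iInter.1 hw n, rfl⟩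

theorem isAttractor_subset {X K K' : Set E} {S : Fin ℓ → E → E} {c : ℝ≥0} (hX : IsCompact X)
    (hc1 : c < 1) (hc : ∀ i, LipschitzOnWith c (S i) X)
    (hK : IsAttractor X S K) (hK' : IsAttractor X S K') : K ⊆ K' := by
  obtain ⟨p, hp⟩ := hK'.2.2.1
  have key : ∀ n : ℕ, ∀ z ∈ K, ∃ w ∈ K', dist z w ≤ c ^ n * Metric.diam X := by
    intro n
    induction n with
    | zero => intro z hz; exact ⟨p, hp, by
        simpa using Metric.dist_le_diam_of_mem hX.isBounded (hK.1 hz) (hK'.1 hp)⟩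
    | succ n ih =>
      intro z hz
      rw [hK.2.2.2] at hz
      obtain ⟨i, y, hy, rfl⟩ := Set.mem_iUnion.1 hz
      obtain ⟨w, hw, hd⟩ := ih y hy
      refine ⟨S i w, ?_, ?_⟩
      · rw [hK'.2.2.2]; exact Set.mem_iUnion.2 ⟨i, w, hw, rfl⟩
      · refine ((hc i).dist_le_mul y (hK.1 hy) w (hK'.1 hw)).trans ?_
        rw [pow_succ', mul_assoc]
        gcongr
  intro z hz
  rw [← hK'.2.1.isClosed.closure_eq, Metric.mem_closure_iff]
  intro ε hε
  have ht : Tendsto (fun n : ℕ => (c : ℝ) ^ n * Metric.diam X) atTop (𝓝 0) := by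
    simpa using (tendsto_pow_atTop_nhds_zero_of_lt_one c.2
      (by exact_mod_cast hc1)).mul_const (Metric.diam X)
  obtain ⟨n, hn⟩ := (ht.eventually_lt_const hε).exists
  obtain ⟨w, hw, hd⟩ := key n z hz
  exact ⟨w, hw, hd.trans_lt hn⟩

theorem existsUnique_isAttractor [NeZero ℓ] {X : Set E} {S : Fin ℓ → E → E} {c : ℝ≥0}
    (hX : IsCompact X) (hne : X.Nonempty) (hmaps : ∀ i, Set.MapsTo (S i) X X) (hc1 : c < 1)
    (hc : ∀ i, LipschitzOnWith c (S i) X) : ∃! K, IsAttractor X S K := by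
  obtain ⟨K, hK⟩ := exists_isAttractor hX hne hmaps hc
  exact ⟨K, hK, fun K' hK' => Set.Subset.antisymm
    (isAttractor_subset hX hc1 hc hK' hK) (isAttractor_subset hX hc1 hc hK hK')⟩

theorem iInter_wordMap_image_attractor {X : Set E} {S : Fin ℓ → E → E} {c : ℝ≥0}
    (hX : IsCompact X) (hne : X.Nonempty) (hmaps : ∀ i, Set.MapsTo (S i) X X) (hc1 : c < 1)
    (hc : ∀ i, LipschitzOnWith c (S i) X) (x : ShiftSpace ℓ) :
    (⋂ n : ℕ, wordMap S x (n + 1) '' attractor X S) = {codingMap X S x} := by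
  have : NeZero ℓ := ⟨fun h => (h ▸ x 0 : Fin 0).elim0⟩
  have hK : IsAttractor X S (attractor X S) :=
    Classical.epsilon_spec (exists_isAttractor hX hne hmaps hc)
  refine Classical.epsilon_spec
    (p := fun z => (⋂ n : ℕ, wordMap S x (n + 1) '' attractor X S) = {z}) ?_
  set K := attractor X S
  have hl := wordMap_lipschitzOn hmaps hc x
  have hcpt : ∀ n, IsCompact (wordMap S x n '' K) := fun n =>
    hK.2.1.image_of_continuousOn ((hl n).1.continuousOn.mono hK.1)
  have hdec : ∀ n, wordMap S x (n + 1) '' K ⊆ wordMap S x n '' K := by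
    rintro n _ ⟨z, hz, rfl⟩
    refine ⟨S (x n) z, ?_, rfl⟩
    rw [hK.2.2.2]
    exact Set.mem_iUnion.2 ⟨x n, z, hz, rfl⟩
  obtain ⟨z, hz⟩ := IsCompact.nonempty_iInter_of_sequence_nonempty_isCompact_isClosed
    (fun n => wordMap S x (n + 1) '' K) (fun n => hdec (n + 1)) (fun n => hK.2.2.1.image _)
    (hcpt 1) (fun n => (hcpt _).isClosed)
  refine ⟨z, Set.eq_singleton_iff_unique_mem.2 ⟨hz, fun w hw => ?_⟩⟩
  have ht : Tendsto (fun n : ℕ => (c : ℝ) ^ (n + 1) * Metric.diam X) atTop (𝓝 0) := by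
    have h0 : Tendsto (fun n : ℕ => (c : ℝ) ^ n * Metric.diam X) atTop (𝓝 0) := by
      simpa using (tendsto_pow_atTop_nhds_zero_of_lt_one c.2
        (by exact_mod_cast hc1)).mul_const (Metric.diam X)
    exact h0.comp (tendsto_add_atTop_nat 1)
  refine dist_le_zero.1 (ge_of_tendsto' ht fun n => ?_)
  obtain ⟨a, ha, rfl⟩ := Set.mem_iInter.1 hw n
  obtain ⟨b, hb, hb'⟩ := Set.mem_iInter.1 hz n
  rw [← hb']
  refine ((hl (n + 1)).1.dist_le_mul a (hK.1 ha) b (hK.1 hb)).trans ?_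
  push_cast
  gcongr
  exact Metric.dist_le_diam_of_mem hX.isBounded (hK.1 ha) (hK.1 hb)

end WellDefined

end

set_option linter.unusedSectionVars false

noncomputable section

/-! ### The pointwise ergodic theorem -/

section Birkhoff

variable {Ω : Type*} [mΩ : MeasurableSpace Ω] {m : Measure Ω} {T : Ω → Ω}

/-! For a set `J` of factors let `G_J` be the conditional expectation, given the invariant sets, of
the information `projInfo` of the joint coding map of these factors (`infoRate`); its integral is a
projection entropy. List the factors as `b_0, b_1, …`, let `J_j` consist of the first `j` of them,
and let `λ_b` be the exponents at `x`. Boxes and Euclidean balls are comparable, so the task is to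
show that the box of radius `e^{-L}` about the image of `x` has measure `exp(-L (D + o(1)))` with `D
= ∑ (G_{J_{j+1}} - G_{J_j}) / λ_{b_j}`.

Upper bound for the measure (`ae_boxMeasure_le`), valid for every order of the factors. A count of
grid cells and Borel–Cantelli show that adding a factor `b` to `J` multiplies the measure of the box
by at most `e^{o(L)}` times the mass of a ball under the conditional law of `π_b` given the
coordinates in `J`. Bayes' formula describes how this law changes along the orbit
(`ae_atomDensity_mul_fibreKernel`). It involves averages of conditional probabilities over small
balls; these converge to their values by Besicovitch differentiation, and a weak type inequality
makes the error small in mean. Hence a step of the shift costs a factor of about `exp(projInfo J -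
projInfo (J ∪ b))`, while the radius grows at most by the inverse of the smallest singular value of
the differential. Conformality makes that growth `e^{λ_b}` per step on average, so about `L / λ_b`
steps exhaust the radius and the conditional mass is at most `exp(-L ((G_{J ∪ b} - G_J) / λ_b -
o(1)))`.

Lower bound for the measure (`ae_exp_le_boxMeasure`), for increasing exponents. Put `d_j = 1 /
λ_{b_j}`, which decreases in `j`, and let the time run backwards from `d_0 L` to `0`, with boxes
whose radii at time `t` are about `e^{-L + t λ_a}`. At time `d_j L` the coordinate `b_j` has radius
of order one and imposes no condition. So on the time interval from `d_{j+1} L` to `d_j L`, a point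
with the right symbols that ends in the box for `J_j` starts in the box for `J_{j+1}`. Comparison of
the two boxes costs `exp` of the sum of `projInfo` for `J_{j+1}` along the interval
(`ae_eventually_measure_le_exp_mul`). It rests on two integral bounds:
`lintegral_prod_markovProb_le` compares a word followed by a box with the product of the conditional
probabilities of its symbols given the next `N` symbols, and `lintegral_word_mul_prod_le` compares a
word inside a box with the box. Replacing the whole future by `N` symbols costs little in mean, by
martingale convergence and Scheffé's lemma. The exponents add up to `∑ G_{J_{j+1}} (d_j - d_{j+1})`,
which is `D` by Abel summation.

Both bounds hold pointwise without ergodicity, with conditional expectations as rates; a permutation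
that sorts the exponents may depend on the point, since there are finitely many. Ergodicity only
makes the rates and exponents constant. -/

theorem measurable_birkhoffSum (hT : Measurable T) {f : Ω → ℝ} (hf : Measurable f) (n : ℕ) :
    Measurable (birkhoffSum T f n) := by
  unfold birkhoffSum
  exact Finset.measurable_sum _ fun i _ => hf.comp (hT.iterate i)

theorem integrable_birkhoffSum (hT : MeasurePreserving T m m) {f : Ω → ℝ} (hf : Integrable f m)
    (n : ℕ) : Integrable (birkhoffSum T f n) m := by
  unfold birkhoffSum
  exact integrable_finsetSum _ fun i _ => (hT.iterate i).integrable_comp_of_integrable hf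

/-- The running maximum `max(0, S₁ f, …, S_n f)` of the Birkhoff sums. -/
def birkhoffMax (T : Ω → Ω) (f : Ω → ℝ) : ℕ → Ω → ℝ
  | 0 => fun _ => 0
  | n + 1 => fun x => max (birkhoffMax T f n x) (birkhoffSum T f (n + 1) x)

theorem measurable_birkhoffMax (hT : Measurable T) {f : Ω → ℝ} (hf : Measurable f) (n : ℕ) :
    Measurable (birkhoffMax T f n) := by
  induction n with
  | zero => exact measurable_const
  | succ n ih => exact ih.max (measurable_birkhoffSum hT hf (n + 1))

theorem integrable_birkhoffMax (hT : MeasurePreserving T m m) {f : Ω → ℝ} (hf : Integrable f m)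
    (n : ℕ) : Integrable (birkhoffMax T f n) m := by
  induction n with
  | zero => exact integrable_zero _ _ _
  | succ n ih => exact ih.sup (integrable_birkhoffSum hT hf (n + 1))

theorem birkhoffMax_nonneg (f : Ω → ℝ) (n : ℕ) (x : Ω) : 0 ≤ birkhoffMax T f n x := by
  induction n with
  | zero => exact le_rfl
  | succ n ih => exact ih.trans (le_max_left _ _)

theorem birkhoffSum_le_birkhoffMax (f : Ω → ℝ) {k n : ℕ} (h : k ≤ n) (x : Ω) :
    birkhoffSum T f k x ≤ birkhoffMax T f n x := by
  induction n with
  | zero => obtain rfl : k = 0 := by omega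
            simp [birkhoffMax]
  | succ n ih =>
    rcases Nat.lt_or_ge k (n + 1) with h' | h'
    · exact (ih (by omega)).trans (le_max_left _ _)
    · obtain rfl : k = n + 1 := by omega
      exact le_max_right _ _

/-- The recursion `S_{k+1} f = f + (S_k f) ∘ T` passes to the running maximum `M`. Where `M > 0` it
gives `M - M ∘ T ≤ f`, the input of Garsia's proof of the maximal inequality. -/
theorem birkhoffMax_le (f : Ω → ℝ) (n : ℕ) (x : Ω) :
    birkhoffMax T f n x ≤ max 0 (f x + birkhoffMax T f n (T x)) := by
  have key : ∀ k ≤ n, birkhoffMax T f k x ≤ max 0 (f x + birkhoffMax T f n (T x)) := by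
    intro k
    induction k with
    | zero => intro _; exact le_max_left _ _
    | succ k ih =>
      intro hk
      refine max_le (ih (by omega)) ((?_ : _ ≤ _).trans (le_max_right _ _))
      rw [birkhoffSum_succ']
      gcongr
      exact birkhoffSum_le_birkhoffMax f (by omega) _
  exact key n le_rfl

theorem birkhoffMax_mono (f : Ω → ℝ) (x : Ω) : Monotone fun n => birkhoffMax T f n x :=
  monotone_nat_of_le_succ fun _ => le_max_left _ _

/-- The **maximal ergodic theorem**. -/
theorem setIntegral_birkhoffMax_nonneg (hT : MeasurePreserving T m m) {f : Ω → ℝ}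
    (hfm : Measurable f) (hf : Integrable f m) (n : ℕ) :
    0 ≤ ∫ x in {x | 0 < birkhoffMax T f n x}, f x ∂m := by
  set M := birkhoffMax T f n
  have hMm : Measurable M := measurable_birkhoffMax hT.measurable hfm n
  have hM : Integrable M m := integrable_birkhoffMax hT hf n
  have hMT : Integrable (M ∘ T) m := hT.integrable_comp_of_integrable hM
  have hs : MeasurableSet {x | 0 < M x} := measurableSet_lt measurable_const hMm
  have h1 : ∫ x in {x | 0 < M x}, (M x - M (T x)) ∂m ≤ ∫ x in {x | 0 < M x}, f x ∂m := by
    refine setIntegral_mono_on (hM.sub hMT).integrableOn hf.integrableOn hs fun x hx => ?_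
    have := birkhoffMax_le (T := T) f n x
    rcases le_max_iff.1 this with h | h
    · exact absurd h (not_le.2 hx)
    · linarith
  -- `M` vanishes off the set and `M ∘ T` is nonnegative there, so the integral of `M - M ∘ T` over
  -- the set is at least `∫ M - ∫ M ∘ T = 0`.
  refine le_trans ?_ h1
  have e1 : ∫ x in {x | 0 < M x}, M x ∂m = ∫ x, M x ∂m := by
    refine setIntegral_eq_integral_of_forall_compl_eq_zero fun x hx => ?_
    exact le_antisymm (not_lt.1 hx) (birkhoffMax_nonneg f n x)
  have e2 : ∫ x in {x | 0 < M x}, M (T x) ∂m ≤ ∫ x, M (T x) ∂m :=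
    setIntegral_le_integral hMT (Eventually.of_forall fun x => birkhoffMax_nonneg f n (T x))
  have e3 : ∫ x, M (T x) ∂m = ∫ x, M x ∂m := by
    have := integral_map (μ := m) hT.measurable.aemeasurable (f := M)
      (by rw [hT.map_eq]; exact hM.aestronglyMeasurable)
    rw [hT.map_eq] at this
    exact this.symm
  have e4 := integral_sub hM.integrableOn (hMT.integrableOn (s := {x | 0 < M x}))
  simp only [Function.comp_apply] at e4
  rw [e4]
  linarith

theorem setIntegral_nonneg_of_birkhoffSum_pos (hT : MeasurePreserving T m m) {f : Ω → ℝ}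
    (hfm : Measurable f) (hf : Integrable f m) :
    0 ≤ ∫ x in {x | ∃ n, 0 < birkhoffSum T f n x}, f x ∂m := by
  have hU : {x | ∃ n, 0 < birkhoffSum T f n x} = ⋃ n, {x | 0 < birkhoffMax T f n x} := by
    ext x
    simp only [Set.mem_ofPred_eq, Set.mem_iUnion]
    constructor
    · rintro ⟨n, hn⟩
      exact ⟨n, hn.trans_le (birkhoffSum_le_birkhoffMax f le_rfl x)⟩
    · rintro ⟨n, hn⟩
      by_contra! hcon
      refine absurd hn (not_lt.2 ?_)
      clear hn
      induction n with
      | zero => exact le_rfl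
      | succ n ih => exact max_le ih (hcon _)
  rw [hU]
  have hlim := tendsto_setIntegral_of_monotone (μ := m) (f := f)
    (s := fun n => {x | 0 < birkhoffMax T f n x})
    (fun n => measurableSet_lt measurable_const (measurable_birkhoffMax hT.measurable hfm n))
    (fun a b hab x hx => lt_of_lt_of_le hx (birkhoffMax_mono f x hab)) hf.integrableOn
  exact ge_of_tendsto' hlim fun n => setIntegral_birkhoffMax_nonneg hT hfm hf n

/-- The invariant conditional expectation is invariant. -/
theorem condExp_invariants_comp (f : Ω → ℝ) (x : Ω) :
    (m[f | MeasurableSpace.invariants T]) (T x) = (m[f | MeasurableSpace.invariants T]) x := by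
  have h : Measurable[MeasurableSpace.invariants T] (m[f | MeasurableSpace.invariants T]) :=
    stronglyMeasurable_condExp.measurable
  exact congrFun (MeasurableSpace.comp_eq_of_measurable_invariants h) x

theorem condExp_invariants_iterate (f : Ω → ℝ) (n : ℕ) (x : Ω) :
    (m[f | MeasurableSpace.invariants T]) (T^[n] x) = (m[f | MeasurableSpace.invariants T]) x := by
  induction n with
  | zero => rfl
  | succ n ih => rw [Function.iterate_succ_apply', condExp_invariants_comp, ih]

/-- The set `A` where the sums are unbounded above is invariant. The maximal inequality for the
function cut down to `A` says that its integral over `A` is nonnegative, but this integral is `-ε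
m(A)`. -/
theorem ae_bddAbove_birkhoffSum [IsProbabilityMeasure m] (hT : MeasurePreserving T m m)
    {f : Ω → ℝ} (hfm : Measurable f) (hf : Integrable f m) {ε : ℝ} (hε : 0 < ε) :
    ∀ᵐ x ∂m, ∃ K : ℕ, ∀ n,
      birkhoffSum T (fun x => f x - (m[f | MeasurableSpace.invariants T]) x - ε) n x ≤ K := by
  have hI : MeasurableSpace.invariants T ≤ mΩ := MeasurableSpace.invariants_le T
  set F : Ω → ℝ := fun x => f x - (m[f | MeasurableSpace.invariants T]) x - ε with hF
  have hcm : Measurable (m[f | MeasurableSpace.invariants T]) := (stronglyMeasurable_condExp.mono hI).measurable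
  have hFm : Measurable F := (hfm.sub hcm).sub measurable_const
  have hFi : Integrable F m := (hf.sub integrable_condExp).sub (integrable_const ε)
  set A : Set Ω := {x | ∀ K : ℕ, ∃ n, (K : ℝ) < birkhoffSum T F n x} with hA
  have hAm : MeasurableSet A := by
    have : A = ⋂ K : ℕ, ⋃ n, {x | (K : ℝ) < birkhoffSum T F n x} := by ext; simp [hA]
    rw [this]
    exact MeasurableSet.iInter fun K => MeasurableSet.iUnion fun n =>
      measurableSet_lt measurable_const (measurable_birkhoffSum hT.measurable hFm n)
  have hTA : T ⁻¹' A = A := by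
    ext x
    simp only [hA, Set.mem_preimage, Set.mem_ofPred_eq]
    constructor
    · intro h K
      obtain ⟨k, hk⟩ := exists_nat_gt ((K : ℝ) - F x)
      obtain ⟨n, hn⟩ := h k
      refine ⟨n + 1, ?_⟩
      rw [birkhoffSum_succ']
      linarith
    · intro h K
      obtain ⟨k, hk⟩ := exists_nat_gt ((K : ℝ) + F x)
      obtain ⟨n, hn⟩ := h k
      rcases n with _ | n
      · simp only [birkhoffSum_zero'] at hn
        exact absurd hn (not_lt.2 (Nat.cast_nonneg k))
      · refine ⟨n, ?_⟩
        rw [birkhoffSum_succ'] at hn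
        linarith
  have hAI : MeasurableSet[MeasurableSpace.invariants T] A := MeasurableSpace.measurableSet_invariants.2 ⟨hAm, hTA⟩
  have hTAn : ∀ (n : ℕ) x, T^[n] x ∈ A ↔ x ∈ A := by
    intro n x
    induction n with
    | zero => rfl
    | succ n ih =>
      rw [Function.iterate_succ_apply', ← ih]
      exact Set.ext_iff.1 hTA _
  have hind : ∀ n x, birkhoffSum T (A.indicator F) n x = A.indicator (birkhoffSum T F n) x := by
    intro n x
    by_cases hx : x ∈ A
    · rw [Set.indicator_of_mem hx]
      exact Finset.sum_congr rfl fun i _ => Set.indicator_of_mem ((hTAn i x).2 hx) _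
    · rw [Set.indicator_of_notMem hx]
      exact Finset.sum_eq_zero fun i _ => Set.indicator_of_notMem (fun h => hx ((hTAn i x).1 h)) _
  have hset : {x | ∃ n, 0 < birkhoffSum T (A.indicator F) n x} = A := by
    ext x
    simp only [hind, Set.mem_ofPred_eq]
    constructor
    · rintro ⟨n, hn⟩
      by_contra hx
      simp [Set.indicator_of_notMem hx] at hn
    · intro hx
      obtain ⟨n, hn⟩ := hx 0
      exact ⟨n, by rw [Set.indicator_of_mem hx]; simpa using hn⟩
  have h0 := setIntegral_nonneg_of_birkhoffSum_pos hT (hFm.indicator hAm) (hFi.indicator hAm)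
  rw [hset, setIntegral_indicator hAm, Set.inter_self] at h0
  have h1 : ∫ x in A, F x ∂m = -ε * m.real A := by
    have e1 : ∫ x in A, F x ∂m = (∫ x in A, f x ∂m - ∫ x in A, (m[f | MeasurableSpace.invariants T]) x ∂m) -
        ∫ x in A, ε ∂m := by
      rw [← integral_sub hf.integrableOn integrable_condExp.integrableOn, ← integral_sub]
      · exact (hf.sub integrable_condExp).integrableOn
      · exact (integrable_const ε).integrableOn
    rw [e1, setIntegral_condExp hI hf hAI]
    simp [mul_comm]
  have h2 : m.real A = 0 := by
    have := measureReal_nonneg (μ := m) (s := A)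
    nlinarith
  have h3 : m A = 0 := by rwa [measureReal_eq_zero_iff] at h2
  have : ∀ᵐ x ∂m, x ∉ A := measure_eq_zero_iff_ae_notMem.1 h3
  filter_upwards [this] with x hx
  simpa [hA] using hx

/-- Half of the error `2 / (k + 1)` is the constant subtracted to make the sums bounded above; the
other half absorbs the bound divided by `n`. -/
theorem ae_eventually_birkhoffAverage_le [IsProbabilityMeasure m] (hT : MeasurePreserving T m m)
    {f : Ω → ℝ} (hfm : Measurable f) (hf : Integrable f m) :
    ∀ᵐ x ∂m, ∀ k : ℕ, ∀ᶠ n in atTop, birkhoffAverage ℝ T f n x ≤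
      (m[f | MeasurableSpace.invariants T]) x + 2 / ((k : ℝ) + 1) := by
  rw [ae_all_iff]
  intro k
  have hε : (0 : ℝ) < 1 / ((k : ℝ) + 1) := by positivity
  filter_upwards [ae_bddAbove_birkhoffSum hT hfm hf hε] with x hx
  obtain ⟨K, hK⟩ := hx
  have hlim : Tendsto (fun n : ℕ => (K : ℝ) / n) atTop (𝓝 0) := tendsto_const_div_atTop_nhds_zero_nat _
  filter_upwards [hlim.eventually_lt_const hε, eventually_gt_atTop 0] with n hn hn0
  have hn0' : (0 : ℝ) < n := by exact_mod_cast hn0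
  have hs : birkhoffSum T (fun x => f x - (m[f | MeasurableSpace.invariants T]) x -
      1 / ((k : ℝ) + 1)) n x = birkhoffSum T f n x - n * ((m[f | MeasurableSpace.invariants T]) x +
      1 / ((k : ℝ) + 1)) := by
    simp only [birkhoffSum, condExp_invariants_iterate, Finset.sum_sub_distrib, Finset.sum_const,
      Finset.card_range, nsmul_eq_mul]
    ring
  have h1 := hK n
  rw [hs] at h1
  have h2 : birkhoffSum T f n x ≤ n * ((m[f | MeasurableSpace.invariants T]) x +
      1 / ((k : ℝ) + 1)) + K := by linarith
  rw [birkhoffAverage, smul_eq_mul, inv_mul_le_iff₀ hn0']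
  refine h2.trans ?_
  rw [div_lt_iff₀ hn0'] at hn
  have : (2 : ℝ) / (k + 1) = 1 / (k + 1) + 1 / (k + 1) := by ring
  rw [this]
  nlinarith

/-- The **pointwise ergodic theorem**. -/
theorem ae_tendsto_birkhoffAverage [IsProbabilityMeasure m] (hT : MeasurePreserving T m m)
    {f : Ω → ℝ} (hfm : Measurable f) (hf : Integrable f m) :
    ∀ᵐ x ∂m, Tendsto (fun n => birkhoffAverage ℝ T f n x) atTop
      (𝓝 ((m[f | MeasurableSpace.invariants T]) x)) := by
  have hneg := condExp_neg (μ := m) f (MeasurableSpace.invariants T)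
  filter_upwards [ae_eventually_birkhoffAverage_le hT hfm hf,
    ae_eventually_birkhoffAverage_le hT hfm.neg hf.neg, hneg] with x h1 h2 h3
  rw [Metric.tendsto_atTop']
  intro ε hε
  obtain ⟨k, hk⟩ := exists_nat_gt (2 / ε)
  have hk' : 2 / ((k : ℝ) + 1) < ε := by
    rw [div_lt_iff₀ (by positivity)]
    rw [div_lt_iff₀ hε] at hk
    nlinarith
  obtain ⟨N, hN⟩ := eventually_atTop.1 ((h1 k).and (h2 k))
  refine ⟨N, fun n hn => ?_⟩
  obtain ⟨a, b⟩ := hN n hn.le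
  have e : birkhoffAverage ℝ T (-f) n x = - birkhoffAverage ℝ T f n x := by
    simp [birkhoffAverage, birkhoffSum]
  have h3' : (m[(-f) | MeasurableSpace.invariants T]) x =
    - (m[f | MeasurableSpace.invariants T]) x := h3
  rw [e, h3'] at b
  rw [Real.dist_eq, abs_lt]
  constructor <;> linarith

end Birkhoff

/-! ### Conditional probabilities of the atoms of a finite partition given a map -/

section AtomDensity

variable {Ω F A : Type*} [mΩ : MeasurableSpace Ω] [mF : MeasurableSpace F]

/-- The conditional probability of `{P = a}` given `p = z`. -/
def atomDensity (m : Measure Ω) (p : Ω → F) (P : Ω → A) (a : A) (z : F) : ℝ≥0∞ :=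
  min 1 (((m.restrict (P ⁻¹' {a})).map p).rnDeriv (m.map p) z)

/-- The conditional probability given `p` of the atom of `P` that contains `x`. -/
def atomProb (m : Measure Ω) (p : Ω → F) (P : Ω → A) (x : Ω) : ℝ≥0∞ :=
  atomDensity m p P (P x) (p x)

/-- The conditional information of the partition `P` given `p`. -/
def atomInfo (m : Measure Ω) (p : Ω → F) (P : Ω → A) (x : Ω) : ℝ :=
  -Real.log (atomProb m p P x).toReal

variable {m : Measure Ω} {p : Ω → F} {P : Ω → A}

theorem measurable_atomDensity (a : A) : Measurable (atomDensity m p P a) :=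
  measurable_const.min (Measure.measurable_rnDeriv _ _)

theorem atomDensity_le_one (a : A) (z : F) : atomDensity m p P a z ≤ 1 := min_le_left _ _

theorem atomProb_le_one (x : Ω) : atomProb m p P x ≤ 1 := atomDensity_le_one _ _

theorem atomDensity_ne_top (a : A) (z : F) : atomDensity m p P a z ≠ ∞ :=
  ((atomDensity_le_one a z).trans_lt ENNReal.one_lt_top).ne

theorem atomProb_ne_top (x : Ω) : atomProb m p P x ≠ ∞ := atomDensity_ne_top _ _

theorem atomInfo_nonneg (x : Ω) : 0 ≤ atomInfo m p P x := by
  have : (atomProb m p P x).toReal ≤ 1 := by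
    simpa using ENNReal.toReal_mono ENNReal.one_ne_top (atomProb_le_one (m := m) (p := p) (P := P) x)
  exact neg_nonneg.2 (Real.log_nonpos ENNReal.toReal_nonneg this)

/-- The restricted measure is dominated by the full one, so the truncation at `1` changes the
derivative only on a null set; it makes the bound by `1` hold at every point. -/
theorem withDensity_atomDensity [IsFiniteMeasure m] (hp : Measurable p) (a : A) :
    (m.map p).withDensity (atomDensity m p P a) = (m.restrict (P ⁻¹' {a})).map p := by
  have hle : (m.restrict (P ⁻¹' {a})).map p ≤ m.map p :=
    Measure.map_mono Measure.restrict_le_self hp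
  have h1 := Measure.rnDeriv_le_one_of_le hle
  have h2 : atomDensity m p P a =ᵐ[m.map p]
      ((m.restrict (P ⁻¹' {a})).map p).rnDeriv (m.map p) := by
    filter_upwards [h1] with z hz
    exact min_eq_right hz
  rw [withDensity_congr_ae h2, Measure.withDensity_rnDeriv_eq _ _ hle.absolutelyContinuous]

theorem setLIntegral_comp_atom [IsFiniteMeasure m] (hp : Measurable p) (a : A)
    {k : F → ℝ≥0∞} (hk : Measurable k) :
    ∫⁻ x in P ⁻¹' {a}, k (p x) ∂m = ∫⁻ x, k (p x) * atomDensity m p P a (p x) ∂m := by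
  rw [← lintegral_map hk hp, ← withDensity_atomDensity hp,
    lintegral_withDensity_eq_lintegral_mul _ (measurable_atomDensity a) hk,
    lintegral_map ((measurable_atomDensity a).mul hk) hp]
  simp only [Pi.mul_apply, mul_comm]

variable [Fintype A] [MeasurableSpace A] [MeasurableSingletonClass A]

theorem measurable_comp_atom {β : Type*} [MeasurableSpace β] (hp : Measurable p)
    (hP : Measurable P) {k : A → F → β} (hk : ∀ a, Measurable (k a)) :
    Measurable fun x => k (P x) (p x) := by
  have : Measurable (fun q : A × F => k q.1 q.2) := measurable_from_prod_countable_right hk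
  exact this.comp (hP.prodMk hp)

theorem measurable_atomProb (hp : Measurable p) (hP : Measurable P) :
    Measurable (atomProb m p P) :=
  measurable_comp_atom hp hP fun a => measurable_atomDensity a

theorem measurable_atomInfo (hp : Measurable p) (hP : Measurable P) :
    Measurable (atomInfo m p P) :=
  (Real.measurable_log.comp (measurable_atomProb hp hP).ennreal_toReal).neg

/-- Disintegration of an integral along the atoms of `P`. -/
theorem lintegral_comp_atom [IsFiniteMeasure m] (hp : Measurable p) (hP : Measurable P)
    {k : A → F → ℝ≥0∞} (hk : ∀ a, Measurable (k a)) :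
    ∫⁻ x, k (P x) (p x) ∂m = ∫⁻ x, ∑ a, k a (p x) * atomDensity m p P a (p x) ∂m := by
  have h1 : ∀ x, k (P x) (p x) = ∑ a, (P ⁻¹' {a}).indicator (fun x => k a (p x)) x := by
    intro x
    rw [Finset.sum_eq_single (P x)]
    · simp
    · intro b _ hb
      exact Set.indicator_of_notMem (by simpa using hb.symm) _
    · simp
  simp_rw [h1]
  have hm1 : ∀ a ∈ Finset.univ, Measurable ((P ⁻¹' {a}).indicator fun x => k a (p x)) :=
    fun a _ => ((hk a).comp hp).indicator (hP (measurableSet_singleton a))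
  have hm2 : ∀ a ∈ Finset.univ, Measurable fun x => k a (p x) * atomDensity m p P a (p x) :=
    fun a _ => ((hk a).comp hp).mul ((measurable_atomDensity a).comp hp)
  rw [lintegral_finsetSum _ hm1, lintegral_finsetSum _ hm2]
  refine Finset.sum_congr rfl fun a _ => ?_
  rw [lintegral_indicator (hP (measurableSet_singleton a)), setLIntegral_comp_atom hp a (hk a)]

/-- The inverse probability cancels the weight with which the atom of `x` is chosen, leaving an
unweighted sum over all atoms. Atoms of conditional probability zero are lost, so there is only an
inequality. -/
theorem lintegral_comp_atom_mul_inv_le [IsFiniteMeasure m] (hp : Measurable p) (hP : Measurable P)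
    {k : A → F → ℝ≥0∞} (hk : ∀ a, Measurable (k a)) :
    ∫⁻ x, k (P x) (p x) * (atomProb m p P x)⁻¹ ∂m ≤ ∫⁻ x, ∑ a, k a (p x) ∂m := by
  have h := lintegral_comp_atom (m := m) hp hP
    (k := fun a z => k a z * (atomDensity m p P a z)⁻¹)
    fun a => (hk a).mul (measurable_atomDensity a).inv
  have h' : ∫⁻ x, k (P x) (p x) * (atomProb m p P x)⁻¹ ∂m = _ := h
  rw [h']
  refine lintegral_mono fun x => Finset.sum_le_sum fun a _ => ?_
  rw [mul_assoc]
  exact mul_le_of_le_one_right' (ENNReal.inv_mul_le_one _)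

theorem ae_atomProb_pos [IsFiniteMeasure m] (hp : Measurable p) (hP : Measurable P) :
    ∀ᵐ x ∂m, 0 < atomProb m p P x := by
  have hs : ∀ a, MeasurableSet {z | atomDensity m p P a z = 0} := fun a =>
    measurable_atomDensity a (measurableSet_singleton 0)
  have h := lintegral_comp_atom (m := m) hp hP
    (k := fun a => {z | atomDensity m p P a z = 0}.indicator 1)
    fun a => measurable_one.indicator (hs a)
  have h0 : ∀ x, ∑ a, ({z | atomDensity m p P a z = 0}.indicator 1 : F → ℝ≥0∞) (p x) *
      atomDensity m p P a (p x) = 0 := by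
    intro x
    refine Finset.sum_eq_zero fun a _ => ?_
    by_cases ha : atomDensity m p P a (p x) = 0
    · simp [ha]
    · simp [Set.indicator_of_notMem (show p x ∉ {z | atomDensity m p P a z = 0} from ha)]
  simp only [h0, lintegral_zero] at h
  rw [lintegral_eq_zero_iff (measurable_comp_atom hp hP
    fun a => measurable_one.indicator (hs a))] at h
  filter_upwards [h] with x hx
  rw [pos_iff_ne_zero]
  intro h1
  have : p x ∈ {z | atomDensity m p P (P x) z = 0} := h1
  simp [Set.indicator_of_mem this] at hx

/-- This follows from `-log t ≤ 1 / t`. It bounds the mean information of a finite partition by the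
number of its atoms. -/
theorem ofReal_neg_log_mul_le {t : ℝ≥0∞} (ht : t ≤ 1) :
    ENNReal.ofReal (-Real.log t.toReal) * t ≤ 1 := by
  have hne : t ≠ ∞ := (ht.trans_lt ENNReal.one_lt_top).ne
  lift t to ℝ≥0 using hne
  rw [ENNReal.coe_toReal]
  rcases eq_or_ne t 0 with rfl | h0
  · simp
  have hpos : (0 : ℝ) < t := by positivity
  have h1 : -Real.log t ≤ (t : ℝ)⁻¹ := by
    rw [← Real.log_inv]
    exact (Real.log_le_sub_one_of_pos (by positivity)).trans (by linarith)
  calc ENNReal.ofReal (-Real.log t) * t ≤ ENNReal.ofReal ((t : ℝ)⁻¹) * t := by gcongr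
    _ = ENNReal.ofReal ((t : ℝ)⁻¹) * ENNReal.ofReal (t : ℝ) := by simp
    _ = ENNReal.ofReal ((t : ℝ)⁻¹ * t) := (ENNReal.ofReal_mul (by positivity)).symm
    _ ≤ 1 := by rw [inv_mul_cancel₀ hpos.ne']; simp

theorem integrable_atomInfo [IsFiniteMeasure m] (hp : Measurable p) (hP : Measurable P) :
    Integrable (atomInfo m p P) m := by
  refine ⟨(measurable_atomInfo hp hP).aestronglyMeasurable, ?_⟩
  rw [hasFiniteIntegral_iff_ofReal (Eventually.of_forall fun x => atomInfo_nonneg x)]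
  have h := lintegral_comp_atom (m := m) hp hP
    (k := fun a z => ENNReal.ofReal (-Real.log (atomDensity m p P a z).toReal))
    fun a => (Real.measurable_log.comp (measurable_atomDensity a).ennreal_toReal).neg.ennreal_ofReal
  have h' : ∫⁻ x, ENNReal.ofReal (atomInfo m p P x) ∂m = _ := h
  rw [h']
  calc _ ≤ ∫⁻ x, ∑ a : A, (1 : ℝ≥0∞) ∂m := lintegral_mono fun x =>
        Finset.sum_le_sum fun a _ => ofReal_neg_log_mul_le (atomDensity_le_one _ _)
    _ < ∞ := by simp [ENNReal.mul_lt_top_iff, measure_lt_top]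

theorem condExp_indicator_atom [IsProbabilityMeasure m] (hp : Measurable p) (hP : Measurable P)
    (a : A) :
    m[(P ⁻¹' {a}).indicator (fun _ => (1 : ℝ)) | mF.comap p] =ᵐ[m]
      fun x => (atomDensity m p P a (p x)).toReal := by
  have hPa : MeasurableSet (P ⁻¹' {a}) := hP (measurableSet_singleton a)
  symm
  have hle : mF.comap p ≤ mΩ := hp.comap_le
  have hint : Integrable (fun x => (atomDensity m p P a (p x)).toReal) m := by
    refine Integrable.of_bound
      ((measurable_atomDensity a).comp hp).ennreal_toReal.aestronglyMeasurable 1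
      (Eventually.of_forall fun x => ?_)
    rw [Real.norm_of_nonneg ENNReal.toReal_nonneg]
    simpa using ENNReal.toReal_mono ENNReal.one_ne_top (atomDensity_le_one a (p x))
  refine ae_eq_condExp_of_forall_setIntegral_eq hle ?_ (fun s _ _ => hint.integrableOn) ?_ ?_
  · exact (integrable_const (1 : ℝ)).indicator hPa
  · rintro s ⟨t, ht, rfl⟩ -
    rw [setIntegral_indicator hPa, integral_toReal]
    · have h := setLIntegral_comp_atom (m := m) (P := P) hp a
        (k := t.indicator 1) (measurable_one.indicator ht)
      have e1 : ∀ x, t.indicator (1 : F → ℝ≥0∞) (p x) * atomDensity m p P a (p x) =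
          (p ⁻¹' t).indicator (fun x => atomDensity m p P a (p x)) x := by
        intro x
        by_cases hx : p x ∈ t
        · simp [hx]
        · simp [hx]
      have e2 : ∀ x, t.indicator (1 : F → ℝ≥0∞) (p x) = (p ⁻¹' t).indicator 1 x := by
        intro x; rfl
      simp_rw [e1, e2] at h
      rw [lintegral_indicator (hp ht), lintegral_indicator (hp ht)] at h
      rw [← h]
      simp [Measure.real, Measure.restrict_apply (hp ht)]
    · exact ((measurable_atomDensity a).comp hp).aemeasurable
    · exact Eventually.of_forall fun x => (atomDensity_ne_top a _).lt_top
  · have : Measurable[mF.comap p] fun x => (atomDensity m p P a (p x)).toReal :=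
      (measurable_atomDensity a).ennreal_toReal.comp (comap_measurable p)
    exact this.stronglyMeasurable.aestronglyMeasurable

theorem condEntropy_eq_integral_atomInfo [IsProbabilityMeasure m] (hp : Measurable p)
    (hP : Measurable P) :
    condEntropy (mF.comap p) m (fun a => P ⁻¹' {a}) = ∫ x, atomInfo m p P x ∂m := by
  unfold condEntropy
  refine integral_congr_ae ?_
  have h : ∀ᵐ x ∂m, ∀ a, (m[(P ⁻¹' {a}).indicator (fun _ => (1 : ℝ)) | mF.comap p]) x =
      (atomDensity m p P a (p x)).toReal := ae_all_iff.2 fun a => condExp_indicator_atom hp hP a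
  filter_upwards [h] with x hx
  unfold condInformation atomInfo atomProb
  simp only [hx]
  rw [Finset.sum_eq_single (P x)]
  · simp
  · intro b _ hb
    rw [Set.indicator_of_notMem (by simpa using hb.symm), zero_mul]
  · simp

end AtomDensity

/-! ### Words -/

section Word

variable {Ω A : Type*}

/-- The first `n` symbols of the `P`-itinerary. -/
def itinerary (T : Ω → Ω) (P : Ω → A) (n : ℕ) (x : Ω) : Fin n → A := fun i => P (T^[i] x)

theorem itinerary_succ (T : Ω → Ω) (P : Ω → A) (n : ℕ) (x : Ω) :
    itinerary T P (n + 1) x = Fin.cons (P x) (itinerary T P n (T x)) := by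
  ext i
  refine Fin.cases ?_ (fun j => ?_) i
  · simp [itinerary]
  · simp [itinerary]

theorem itinerary_succ' (T : Ω → Ω) (P : Ω → A) (n : ℕ) (x : Ω) :
    itinerary T P (n + 1) x = Fin.snoc (itinerary T P n x) (P (T^[n] x)) := by
  ext i
  refine Fin.lastCases ?_ (fun j => ?_) i
  · simp [itinerary]
  · simp [itinerary]

theorem measurable_itinerary [MeasurableSpace Ω] [MeasurableSpace A] {T : Ω → Ω} {P : Ω → A}
    (hT : Measurable T) (hP : Measurable P) (n : ℕ) : Measurable (itinerary T P n) :=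
  measurable_pi_lambda _ fun i => hP.comp (hT.iterate i)

end Word

/-! ### Integral bounds along words -/

section WordBound

variable {Ω F A : Type*} [mΩ : MeasurableSpace Ω] [mF : MeasurableSpace F]
variable {m : Measure Ω} {T : Ω → Ω} {p : Ω → F} {P : Ω → A}
variable [Fintype A] [MeasurableSpace A] [MeasurableSingletonClass A]

/-- The ratio of conditional probabilities `m(P | p ∘ T) / (m(P | p) m(P | T))`. -/
def stepWeight (m : Measure Ω) (T : Ω → Ω) (p : Ω → F) (P : Ω → A) (x : Ω) : ℝ≥0∞ :=
  atomProb m (p ∘ T) P x * (atomProb m p P x)⁻¹ * (atomProb m T P x)⁻¹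

theorem measurable_stepWeight (hT : Measurable T) (hp : Measurable p) (hP : Measurable P) :
    Measurable (stepWeight m T p P) :=
  ((measurable_atomProb (hp.comp hT) hP).mul (measurable_atomProb hp hP).inv).mul
    (measurable_atomProb hT hP).inv

theorem measurable_prod_iterate {f : Ω → ℝ≥0∞} (hT : Measurable T) (hf : Measurable f) (n : ℕ) :
    Measurable fun x => ∏ i ∈ Finset.range n, f (T^[i] x) :=
  Finset.measurable_prod _ fun i _ => hf.comp (hT.iterate i)

theorem prod_iterate_succ {M : Type*} [CommMonoid M] (f : Ω → M) (n : ℕ) (x : Ω) :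
    ∏ i ∈ Finset.range (n + 1), f (T^[i] x) =
      f x * ∏ i ∈ Finset.range n, f (T^[i] (T x)) := by
  rw [Finset.prod_range_succ', mul_comm]
  rfl

theorem sum_cons_word {M : Type*} [AddCommMonoid M] {n : ℕ} (f : (Fin (n + 1) → A) → M) :
    ∑ w, f w = ∑ a : A, ∑ w : Fin n → A, f (Fin.cons a w) := by
  rw [← Fintype.sum_prod_type']
  exact (Fintype.sum_equiv (Fin.consEquiv fun _ => A) _ _ fun _ => rfl).symm

theorem sum_snoc_word {M : Type*} [AddCommMonoid M] {n : ℕ} (f : (Fin (n + 1) → A) → M) :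
    ∑ w, f w = ∑ a : A, ∑ w : Fin n → A, f (Fin.snoc w a) := by
  rw [← Fintype.sum_prod_type']
  exact (Fintype.sum_equiv (Fin.snocEquiv fun _ => A) _ _ fun _ => rfl).symm

/-- Each factor of `stepWeight` has one role. The inverse of `m(P | T)` replaces the first symbol by
a free sum over symbols, after which invariance shifts the point and the induction hypothesis treats
the rest of the word. The factor `m(P | p ∘ T)` then turns the free sum back into the actual first
symbol, and the inverse of `m(P | p)` makes it free again, now with `p x` in place of `p (T x)`. The
inductive test function `k'` carries the last two factors. -/
theorem lintegral_word_mul_prod_le [IsFiniteMeasure m] (hT : MeasurePreserving T m m)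
    (hp : Measurable p) (hP : Measurable P) {φ : A → F → F} (hφ : ∀ a, Measurable (φ a))
    (hpφ : ∀ x, p x = φ (P x) (p (T x))) (n : ℕ) :
    ∀ {k : (Fin n → A) → F → ℝ≥0∞}, (∀ w, Measurable (k w)) →
    ∫⁻ x, k (itinerary T P n x) (p x) *
      ∏ i ∈ Finset.range n, stepWeight m T p P (T^[i] x) ∂m ≤ ∫⁻ x, ∑ w, k w (p x) ∂m := by
  induction n with
  | zero =>
    intro k hk
    refine lintegral_mono fun x => ?_
    simp only [Finset.range_zero, Finset.prod_empty, mul_one]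
    exact Finset.single_le_sum (f := fun w => k w (p x)) (fun _ _ => zero_le)
      (Finset.mem_univ _)
  | succ n ih =>
    intro k hk
    have hitin := measurable_itinerary hT.measurable hP n
    have hw := measurable_stepWeight (m := m) hT.measurable hp hP
    let u : A → F → ℝ≥0∞ := atomDensity m p P
    let v : A → F → ℝ≥0∞ := atomDensity m (p ∘ T) P
    let k' : (Fin n → A) → F → ℝ≥0∞ := fun w z =>
      ∑ a, k (Fin.cons a w) (φ a z) * (v a z * (u a (φ a z))⁻¹)
    have hu : ∀ a, Measurable (u a) := fun a => measurable_atomDensity a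
    have hv : ∀ a, Measurable (v a) := fun a => measurable_atomDensity a
    have hterm : ∀ a (w : Fin n → A),
        Measurable fun z => k (Fin.cons a w) (φ a z) * (v a z * (u a (φ a z))⁻¹) := fun a w =>
      ((hk _).comp (hφ a)).mul ((hv a).mul ((hu a).comp (hφ a)).inv)
    have hk' : ∀ w, Measurable (k' w) := fun w => Finset.measurable_sum _ fun a _ => hterm a w
    let K : A → Ω → ℝ≥0∞ := fun a y =>
      (k (Fin.cons a (itinerary T P n y)) (φ a (p y)) * (v a (p y) * (u a (φ a (p y)))⁻¹)) *
        ∏ i ∈ Finset.range n, stepWeight m T p P (T^[i] y)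
    have hK : ∀ a, Measurable (K a) := fun a =>
      (measurable_comp_atom (k := fun w z => k (Fin.cons a w) (φ a z) *
        (v a z * (u a (φ a z))⁻¹)) hp hitin (hterm a)).mul
        (measurable_prod_iterate hT.measurable hw n)
    calc ∫⁻ x, k (itinerary T P (n + 1) x) (p x) *
          ∏ i ∈ Finset.range (n + 1), stepWeight m T p P (T^[i] x) ∂m
        = ∫⁻ x, K (P x) (T x) * (atomProb m T P x)⁻¹ ∂m := by
          refine lintegral_congr fun x => ?_
          rw [prod_iterate_succ, itinerary_succ]
          simp only [K, stepWeight, atomProb, u, v, Function.comp_apply, ← hpφ x]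
          ring
      _ ≤ ∫⁻ x, ∑ a, K a (T x) ∂m := lintegral_comp_atom_mul_inv_le hT.measurable hP hK
      _ = ∫⁻ x, ∑ a, K a x ∂m :=
          hT.lintegral_comp (f := fun x => ∑ a, K a x) (Finset.measurable_sum _ fun a _ => hK a)
      _ = ∫⁻ x, k' (itinerary T P n x) (p x) *
            ∏ i ∈ Finset.range n, stepWeight m T p P (T^[i] x) ∂m := by
          refine lintegral_congr fun x => ?_
          simp only [K, k', Finset.sum_mul]
      _ ≤ ∫⁻ x, ∑ w, k' w (p x) ∂m := ih hk'
      _ = ∫⁻ x, ∑ w, k' w (p (T x)) ∂m :=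
          (hT.lintegral_comp (f := fun x => ∑ w, k' w (p x))
            (Finset.measurable_sum _ fun w _ => (hk' w).comp hp)).symm
      -- The sum over `a` is now weighted with the conditional probabilities given `p ∘ T`, as the
      -- disintegration along atoms requires.
      _ = ∫⁻ x, ∑ a, (∑ w, k (Fin.cons a w) (φ a ((p ∘ T) x)) * (u a (φ a ((p ∘ T) x)))⁻¹) *
            atomDensity m (p ∘ T) P a ((p ∘ T) x) ∂m := by
          refine lintegral_congr fun x => ?_
          simp only [k']
          rw [Finset.sum_comm]
          refine Finset.sum_congr rfl fun a _ => ?_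
          rw [Finset.sum_mul]
          refine Finset.sum_congr rfl fun w _ => ?_
          simp only [v, Function.comp_apply]
          ring
      _ = ∫⁻ x, ∑ w, k (Fin.cons (P x) w) (φ (P x) ((p ∘ T) x)) *
            (u (P x) (φ (P x) ((p ∘ T) x)))⁻¹ ∂m :=
          (lintegral_comp_atom (m := m) (p := p ∘ T) (hp.comp hT.measurable) hP
            (k := fun a z => ∑ w, k (Fin.cons a w) (φ a z) * (u a (φ a z))⁻¹)
            fun a => Finset.measurable_sum _ fun w _ =>
              ((hk _).comp (hφ a)).mul ((hu a).comp (hφ a)).inv).symm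
      _ = ∫⁻ x, (∑ w, k (Fin.cons (P x) w) (p x)) * (atomProb m p P x)⁻¹ ∂m := by
          refine lintegral_congr fun x => ?_
          simp only [Function.comp_apply, ← hpφ x, Finset.sum_mul, atomProb, u]
      _ ≤ ∫⁻ x, ∑ a, ∑ w, k (Fin.cons a w) (p x) ∂m :=
          lintegral_comp_atom_mul_inv_le (k := fun a z => ∑ w, k (Fin.cons a w) z) hp hP
            fun a => Finset.measurable_sum _ fun w _ => hk _
      _ = ∫⁻ x, ∑ w, k w (p x) ∂m := by
          refine lintegral_congr fun x => ?_
          rw [sum_cons_word]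

/-- The conditional probability of the symbol `a` given that the word `u` follows. -/
def markovKernel (m : Measure Ω) (T : Ω → Ω) (P : Ω → A) (N : ℕ) (a : A) (u : Fin N → A) : ℝ≥0∞ :=
  m (P ⁻¹' {a} ∩ (itinerary T P N ∘ T) ⁻¹' {u}) / m ((itinerary T P N ∘ T) ⁻¹' {u})

/-- The conditional probability of the first symbol of `x` given the `N` following ones. -/
def markovProb (m : Measure Ω) (T : Ω → Ω) (P : Ω → A) (N : ℕ) (x : Ω) : ℝ≥0∞ :=
  markovKernel m T P N (P x) (itinerary T P N (T x))

/-- The conditional probability of a word in the `N`-step Markov approximation, given that the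
word `u` follows. -/
def markovWord (m : Measure Ω) (T : Ω → Ω) (P : Ω → A) (N : ℕ) :
    (n : ℕ) → (Fin n → A) → (Fin N → A) → ℝ≥0∞
  | 0 => fun _ _ => 1
  | n + 1 => fun w u => markovKernel m T P N (w (Fin.last n)) u *
      markovWord m T P N n (Fin.init w)
        (Fin.init (Fin.cons (w (Fin.last n)) u : Fin (N + 1) → A))

theorem sum_measure_inter_atom [IsFiniteMeasure m] (hP : Measurable P) {s : Set Ω}
    (hs : MeasurableSet s) : ∑ a, m (P ⁻¹' {a} ∩ s) = m s := by
  have h := lintegral_fintype (μ := (m.restrict s).map P) (f := 1)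
  simp only [Pi.one_apply, lintegral_one, one_mul] at h
  rw [Measure.map_apply hP MeasurableSet.univ] at h
  simp only [Set.preimage_univ, Measure.restrict_apply MeasurableSet.univ, Set.univ_inter] at h
  rw [h]
  refine Finset.sum_congr rfl fun a _ => ?_
  rw [Measure.map_apply hP (measurableSet_singleton a), Measure.restrict_apply' hs]

theorem sum_markovKernel_le_one [IsFiniteMeasure m] (hT : Measurable T) (hP : Measurable P)
    (N : ℕ) (u : Fin N → A) : ∑ a, markovKernel m T P N a u ≤ 1 := by
  have hs : MeasurableSet ((itinerary T P N ∘ T) ⁻¹' {u}) :=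
    ((measurable_itinerary hT hP N).comp hT) (measurableSet_singleton u)
  simp only [markovKernel, ENNReal.div_eq_inv_mul]
  rw [← Finset.mul_sum, sum_measure_inter_atom hP hs]
  exact ENNReal.inv_mul_le_one _

/-- The recursion generates a word from its last symbol backwards, so the sum over the earlier
symbols is at most `1` by induction and the sum over the last one is at most `1` by
`sum_markovKernel_le_one`. -/
theorem sum_markovWord_le_one [IsFiniteMeasure m] (hT : Measurable T) (hP : Measurable P)
    (N n : ℕ) (u : Fin N → A) : ∑ w, markovWord m T P N n w u ≤ 1 := by
  induction n generalizing u with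
  | zero => simp [markovWord]
  | succ n ih =>
    rw [sum_snoc_word]
    simp only [markovWord, Fin.snoc_last, Fin.init_snoc]
    refine le_trans (Finset.sum_le_sum fun a _ => ?_) (sum_markovKernel_le_one (m := m) hT hP N u)
    rw [← Finset.mul_sum]
    exact mul_le_of_le_one_right' (ih _)

/-- The product depends on `x` only through the word and the `N` symbols after it. This turns the
integral in `lintegral_prod_markovProb_le` into a countable sum. -/
theorem prod_markovProb (N n : ℕ) (x : Ω) :
    ∏ i ∈ Finset.range n, markovProb m T P N (T^[i] x) =
      markovWord m T P N n (itinerary T P n x) (itinerary T P N (T^[n] x)) := by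
  induction n with
  | zero => simp [markovWord]
  | succ n ih =>
    rw [Finset.prod_range_succ, ih]
    simp only [markovWord, markovProb, itinerary_succ' T P n, Fin.snoc_last, Fin.init_snoc]
    rw [Function.iterate_succ_apply' T n x, ← itinerary_succ, itinerary_succ', Fin.init_snoc,
      mul_comm]

variable {ι : Type*} [Countable ι] [MeasurableSpace ι] [MeasurableSingletonClass ι]

/-- Double counting: each cell `j` contributes once for every `i` adjacent to it, hence at most `C`
times. -/
theorem tsum_measure_adj_le {κ : Ω → ι} (hκ : Measurable κ) {adj : ι → ι → Prop} {C : ℕ}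
    (hadj : ∀ j, {i | adj i j}.encard ≤ C) :
    ∑' i, m (κ ⁻¹' {j | adj i j}) ≤ C * m Set.univ := by
  classical
  have h1 : ∀ i, m (κ ⁻¹' {j | adj i j}) = ∑' j, if adj i j then m (κ ⁻¹' {j}) else 0 := by
    intro i
    have := lintegral_countable' (μ := m.map κ) ({j | adj i j}.indicator (1 : ι → ℝ≥0∞))
    rw [lintegral_indicator_one (Set.to_countable _).measurableSet,
      Measure.map_apply hκ (Set.to_countable _).measurableSet] at this
    rw [this]
    refine tsum_congr fun j => ?_
    rw [Measure.map_apply hκ (measurableSet_singleton j)]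
    by_cases h : adj i j <;> simp [h]
  have h2 : ∀ j, (∑' i, if adj i j then m (κ ⁻¹' {j}) else 0) ≤ C * m (κ ⁻¹' {j}) := by
    intro j
    have hfin : {i | adj i j}.Finite := Set.finite_of_encard_le_coe (hadj j)
    have : (∑' i, if adj i j then m (κ ⁻¹' {j}) else 0) =
        ∑ i ∈ hfin.toFinset, m (κ ⁻¹' {j}) := by
      rw [tsum_eq_sum (s := hfin.toFinset)]
      · refine Finset.sum_congr rfl fun i hi => ?_
        simp only [Set.Finite.mem_toFinset, Set.mem_ofPred_eq] at hi
        simp [hi]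
      · intro i hi
        simp only [Set.Finite.mem_toFinset, Set.mem_ofPred_eq] at hi
        simp [hi]
    rw [this, Finset.sum_const, nsmul_eq_mul]
    gcongr
    have := hadj j
    rw [hfin.encard_eq_coe_toFinset_card] at this
    exact_mod_cast this
  calc ∑' i, m (κ ⁻¹' {j | adj i j})
      = ∑' j, ∑' i, if adj i j then m (κ ⁻¹' {j}) else 0 := by
        simp_rw [h1]; exact ENNReal.tsum_comm
    _ ≤ ∑' j, C * m (κ ⁻¹' {j}) := ENNReal.tsum_le_tsum h2
    _ = C * m Set.univ := by
        rw [ENNReal.tsum_mul_left]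
        congr 1
        have := lintegral_countable' (μ := m.map κ) (1 : ι → ℝ≥0∞)
        simp only [Pi.one_apply, lintegral_one, one_mul] at this
        rw [Measure.map_apply hκ MeasurableSet.univ, Set.preimage_univ] at this
        rw [this]
        exact tsum_congr fun j => (Measure.map_apply hκ (measurableSet_singleton j)).symm

/-- Comparison of the Markov approximation with the conditional measure of a word given that the
point after the word lies in the neighbourhood `R`. -/
theorem lintegral_prod_markovProb_le [IsProbabilityMeasure m] (hT : MeasurePreserving T m m)
    (hP : Measurable P) {κ : Ω → ι} (hκ : Measurable κ) {adj : ι → ι → Prop} {C : ℕ}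
    (hadj : ∀ j, {i | adj i j}.encard ≤ C) {R : Ω → Set Ω}
    (hcell : ∀ y y', κ y = κ y' → y' ∈ R y) (hR : ∀ y y', y' ∈ R y → adj (κ y) (κ y'))
    (N n : ℕ) :
    ∫⁻ x, (∏ i ∈ Finset.range n, markovProb m T P N (T^[i] x)) * m (R (T^[n] x)) *
      (m (itinerary T P n ⁻¹' {itinerary T P n x} ∩ T^[n] ⁻¹' R (T^[n] x)))⁻¹ ∂m ≤
      (Fintype.card A : ℝ≥0∞) ^ N * C := by
  have hTn : Measurable T^[n] := hT.measurable.iterate n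
  have hin := measurable_itinerary hT.measurable hP n
  have hiN := measurable_itinerary hT.measurable hP N
  let Z : Ω → (Fin n → A) × (Fin N → A) × ι := fun x =>
    (itinerary T P n x, itinerary T P N (T^[n] x), κ (T^[n] x))
  have hZ : Measurable Z := hin.prodMk ((hiN.comp hTn).prodMk (hκ.comp hTn))
  let h : (Fin n → A) × (Fin N → A) × ι → ℝ≥0∞ := fun z =>
    markovWord m T P N n z.1 z.2.1 * m (κ ⁻¹' {j | adj z.2.2 j}) *
      (m (itinerary T P n ⁻¹' {z.1} ∩ T^[n] ⁻¹' (κ ⁻¹' {z.2.2})))⁻¹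
  -- The neighbourhood `R` is enlarged to the adjacent cells in the factor and shrunk to one cell
  -- inside the inverse; the integrand then depends only on the word, the window of `N` symbols
  -- after it and the cell.
  calc _ ≤ ∫⁻ x, h (Z x) ∂m := by
        refine lintegral_mono fun x => ?_
        simp only [h, Z]
        rw [prod_markovProb]
        refine mul_le_mul' (mul_le_mul' le_rfl (measure_mono fun y hy => hR _ _ hy))
          (ENNReal.inv_le_inv.2 (measure_mono ?_))
        rintro y ⟨hy1, hy2⟩
        exact ⟨hy1, hcell _ _ (Eq.symm hy2)⟩
    _ = ∑' z, h z * m (Z ⁻¹' {z}) := by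
        rw [← lintegral_map (Measurable.of_discrete (f := h)) hZ, lintegral_countable']
        exact tsum_congr fun z => by rw [Measure.map_apply hZ (measurableSet_singleton z)]
    _ ≤ ∑' z : (Fin n → A) × (Fin N → A) × ι,
          markovWord m T P N n z.1 z.2.1 * m (κ ⁻¹' {j | adj z.2.2 j}) := by
        refine ENNReal.tsum_le_tsum fun z => ?_
        simp only [h]
        rw [mul_assoc (markovWord m T P N n z.1 z.2.1 * m (κ ⁻¹' {j | adj z.2.2 j}))]
        refine mul_le_of_le_one_right' ?_
        refine le_trans (mul_le_mul' le_rfl (measure_mono ?_)) (ENNReal.inv_mul_le_one _)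
        rintro x rfl
        exact ⟨rfl, rfl⟩
    -- The windows `u` are summed without weight, which produces the factor `card A ^ N`; it does
    -- not grow with `n`.
    _ = ∑' u : Fin N → A, (∑ w, markovWord m T P N n w u) * ∑' i, m (κ ⁻¹' {j | adj i j}) := by
        simp_rw [ENNReal.tsum_prod', ENNReal.tsum_mul_left]
        rw [ENNReal.tsum_comm]
        simp_rw [ENNReal.tsum_mul_right, ← tsum_fintype (L := .unconditional _)]
    _ ≤ ∑' u : Fin N → A, 1 * (C * m Set.univ) := ENNReal.tsum_le_tsum fun u =>
        mul_le_mul' (sum_markovWord_le_one hT.measurable hP N n u) (tsum_measure_adj_le hκ hadj)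
    _ = (Fintype.card A : ℝ≥0∞) ^ N * C := by
        rw [tsum_fintype]; simp

end WordBound

/-! ### Convergence in mean of the conditional information -/

section InfoLimit

/-- **Scheffé's lemma** for nonnegative functions. -/
theorem tendsto_integral_abs_sub {Ω : Type*} [MeasurableSpace Ω] {m : Measure Ω}
    {f : ℕ → Ω → ℝ} {g : Ω → ℝ} (hf : ∀ n, Integrable (f n) m) (hg : Integrable g m)
    (hf0 : ∀ n x, 0 ≤ f n x) (hg0 : ∀ x, 0 ≤ g x)
    (hlim : ∀ᵐ x ∂m, Tendsto (fun n => f n x) atTop (𝓝 (g x)))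
    (hint : Tendsto (fun n => ∫ x, f n x ∂m) atTop (𝓝 (∫ x, g x ∂m))) :
    Tendsto (fun n => ∫ x, |f n x - g x| ∂m) atTop (𝓝 0) := by
  -- The positive part of `g - f n` is dominated by `g`, because `f n ≥ 0`.
  have h1 : Tendsto (fun n => ∫ x, max (g x - f n x) 0 ∂m) atTop (𝓝 (∫ x, (0 : ℝ) ∂m)) := by
    refine tendsto_integral_of_dominated_convergence g
      (fun n => ((hg.sub (hf n)).sup (integrable_zero _ _ _)).aestronglyMeasurable) hg ?_ ?_
    · intro n
      refine Eventually.of_forall fun x => ?_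
      rw [Real.norm_of_nonneg (le_max_right _ _)]
      exact max_le (by linarith [hf0 n x]) (hg0 x)
    · filter_upwards [hlim] with x hx
      have := ((tendsto_const_nhds (x := g x)).sub hx).max (tendsto_const_nhds (x := (0 : ℝ)))
      simpa using this
  have h2 : ∀ n, ∫ x, |f n x - g x| ∂m =
      ∫ x, f n x ∂m - ∫ x, g x ∂m + 2 * ∫ x, max (g x - f n x) 0 ∂m := by
    intro n
    have i1 : Integrable (fun x => f n x - g x) m := (hf n).sub hg
    have i2 : Integrable (fun x => 2 * max (g x - f n x) 0) m :=
      ((hg.sub (hf n)).sup (integrable_zero _ _ _)).const_mul 2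
    rw [← integral_sub (hf n) hg, ← integral_const_mul, ← integral_add i1 i2]
    refine integral_congr_ae (Eventually.of_forall fun x => ?_)
    simp only
    rcases le_total (f n x) (g x) with h | h
    · rw [abs_of_nonpos (by linarith), max_eq_left (by linarith)]; ring
    · rw [abs_of_nonneg (by linarith), max_eq_right (by linarith)]; ring
  simp_rw [h2]
  have := (hint.sub_const (∫ x, g x ∂m)).add (h1.const_mul 2)
  simpa using this

/-- Conditional expectation contracts the `L¹` norm, so for large `n` the set where it exceeds a
fixed bound has small measure, and the set where it does so for all large `n` is null. The
`σ`-algebra may vary with `n`; this is needed for the invariant sets of iterates of `T`. -/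
theorem ae_frequently_abs_condExp_lt {Ω : Type*} [mΩ : MeasurableSpace Ω] {m : Measure Ω}
    [IsFiniteMeasure m] {f : ℕ → Ω → ℝ} {I : ℕ → MeasurableSpace Ω}
    (hlim : Tendsto (fun n => ∫ x, |f n x| ∂m) atTop (𝓝 0)) :
    ∀ᵐ x ∂m, ∀ η : ℝ, 0 < η → ∃ᶠ n in atTop, |(m[f n | I n]) x| < η := by
  have key : ∀ k n₀ : ℕ, ∀ᵐ x ∂m, ∃ n ≥ n₀, |(m[f n | I n]) x| < 1 / ((k : ℝ) + 1) := by
    intro k n₀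
    have hk : (0 : ℝ) < 1 / ((k : ℝ) + 1) := by positivity
    have hmeas : m {x | ¬ ∃ n ≥ n₀, |(m[f n | I n]) x| < 1 / ((k : ℝ) + 1)} = 0 := by
      by_contra h0
      set B := {x | ¬ ∃ n ≥ n₀, |(m[f n | I n]) x| < 1 / ((k : ℝ) + 1)}
      have hpos : 0 < m.real B := by
        rw [measureReal_def]
        exact ENNReal.toReal_pos h0 (measure_ne_top _ _)
      obtain ⟨n, hn, hnn⟩ := ((hlim.eventually_lt_const (mul_pos hk hpos)).and
        (eventually_ge_atTop n₀)).exists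
      have h1 := mul_meas_ge_le_integral_of_nonneg (μ := m) (f := fun x => |(m[f n | I n]) x|)
        (Eventually.of_forall fun x => abs_nonneg _) integrable_condExp.abs (1 / ((k : ℝ) + 1))
      have h2 : m.real B ≤ m.real {x | 1 / ((k : ℝ) + 1) ≤ |(m[f n | I n]) x|} := by
        refine measureReal_mono fun x hx => ?_
        have hx' : ¬ ∃ n ≥ n₀, |(m[f n | I n]) x| < 1 / ((k : ℝ) + 1) := hx
        push Not at hx'
        exact hx' n hnn
      have h3 := integral_abs_condExp_le (μ := m) (m := I n) (f n)
      have := mul_le_mul_of_nonneg_left h2 hk.le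
      linarith
    exact measure_eq_zero_iff_ae_notMem.1 hmeas |>.mono fun x hx => by simpa using hx
  filter_upwards [ae_all_iff.2 fun k => ae_all_iff.2 (key k)] with x hx η hη
  obtain ⟨k, hk⟩ := exists_nat_one_div_lt hη
  rw [frequently_atTop]
  intro n₀
  obtain ⟨n, hn, h⟩ := hx k n₀
  exact ⟨n, hn, h.trans hk⟩

variable {Ω A : Type*} [mΩ : MeasurableSpace Ω] {m : Measure Ω} {T : Ω → Ω} {P : Ω → A}
variable [Fintype A] [MeasurableSpace A] [MeasurableSingletonClass A]

theorem ae_markovProb_eq [IsFiniteMeasure m] (hT : Measurable T) (hP : Measurable P) (N : ℕ) :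
    ∀ᵐ x ∂m, markovProb m T P N x = atomProb m (itinerary T P N ∘ T) P x := by
  have hq : Measurable (itinerary T P N ∘ T) := (measurable_itinerary hT hP N).comp hT
  have h : ∀ u : Fin N → A, ∀ᵐ x ∂m, (itinerary T P N ∘ T) x = u →
      m ((itinerary T P N ∘ T) ⁻¹' {u}) ≠ 0 := by
    intro u
    by_cases h0 : m ((itinerary T P N ∘ T) ⁻¹' {u}) = 0
    · filter_upwards [measure_eq_zero_iff_ae_notMem.1 h0] with x hx hxu
      exact absurd hxu hx
    · exact Eventually.of_forall fun x _ => h0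
  filter_upwards [ae_all_iff.2 h] with x hx
  have hx0 := hx _ rfl
  unfold markovProb markovKernel atomProb
  have h1 : (m.map (itinerary T P N ∘ T)).withDensity
      (atomDensity m (itinerary T P N ∘ T) P (P x)) {(itinerary T P N ∘ T) x} =
      m (P ⁻¹' {P x} ∩ (itinerary T P N ∘ T) ⁻¹' {(itinerary T P N ∘ T) x}) := by
    rw [withDensity_atomDensity hq, Measure.map_apply hq (measurableSet_singleton _),
      Measure.restrict_apply (hq (measurableSet_singleton _)), Set.inter_comm]
  rw [withDensity_apply _ (measurableSet_singleton _), lintegral_singleton,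
    Measure.map_apply hq (measurableSet_singleton _)] at h1
  exact ((ENNReal.eq_div_iff hx0 (measure_ne_top _ _)).2 ((mul_comm _ _).trans h1)).symm

/-- In this form the integrand is bounded, so integrals of informations converge by dominated
convergence although the informations themselves are unbounded. -/
theorem lintegral_atomInfo_eq {F : Type*} [MeasurableSpace F] {p : Ω → F} [IsFiniteMeasure m]
    (hp : Measurable p) (hP : Measurable P) :
    ∫⁻ x, ENNReal.ofReal (atomInfo m p P x) ∂m =
      ∫⁻ x, ∑ a, ENNReal.ofReal (Real.negMulLog (atomDensity m p P a (p x)).toReal) ∂m := by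
  have h := lintegral_comp_atom (m := m) hp hP
    (k := fun a z => ENNReal.ofReal (-Real.log (atomDensity m p P a z).toReal))
    fun a => (Real.measurable_log.comp (measurable_atomDensity a).ennreal_toReal).neg.ennreal_ofReal
  refine Eq.trans h (lintegral_congr fun x => Finset.sum_congr rfl fun a _ => ?_)
  nth_rw 2 [← ENNReal.ofReal_toReal (atomDensity_ne_top (m := m) (p := p) (P := P) a (p x))]
  rw [← ENNReal.ofReal_mul' ENNReal.toReal_nonneg, Real.negMulLog]
  congr 1
  ring

/-- Conditioning on longer and longer futures converges in mean to conditioning on the whole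
future. -/
theorem tendsto_integral_abs_atomInfo_sub [IsProbabilityMeasure m] (hT : Measurable T)
    (hP : Measurable P)
    (hgen : ⨆ N, MeasurableSpace.comap (itinerary T P N) inferInstance = mΩ) :
    Tendsto (fun N => ∫ x, |atomInfo m (itinerary T P N ∘ T) P x - atomInfo m T P x| ∂m)
      atTop (𝓝 0) := by
  have hq : ∀ N, Measurable (itinerary T P N ∘ T) := fun N => (measurable_itinerary hT hP N).comp hT
  let ℱ : Filtration ℕ mΩ :=
    { seq := fun N => MeasurableSpace.comap (itinerary T P N ∘ T) inferInstance
      mono' := by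
        refine monotone_nat_of_le_succ fun N => ?_
        have h : itinerary T P N ∘ T = Fin.init ∘ (itinerary T P (N + 1) ∘ T) := by
          funext x
          simp [itinerary_succ', Fin.init_snoc]
        rw [h]
        have hm : Measurable (Fin.init : (Fin (N + 1) → A) → (Fin N → A)) := Measurable.of_discrete
        rw [← MeasurableSpace.comap_comp]
        exact MeasurableSpace.comap_mono hm.comap_le
      le' := fun N => (hq N).comap_le }
  have hsup : ⨆ N, ℱ N = MeasurableSpace.comap T mΩ := by
    have : ∀ N, ℱ N = MeasurableSpace.comap T
        (MeasurableSpace.comap (itinerary T P N) inferInstance) := fun N =>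
      (MeasurableSpace.comap_comp).symm
    simp_rw [this]
    rw [← MeasurableSpace.comap_iSup, hgen]
  -- Lévy's upward theorem. Together with the convergence of the mean informations and Scheffé's
  -- lemma it gives convergence in mean, without a bound for the supremum over `N`.
  have hconv : ∀ᵐ x ∂m, ∀ a, Tendsto
      (fun N => (atomDensity m (itinerary T P N ∘ T) P a ((itinerary T P N ∘ T) x)).toReal) atTop
      (𝓝 (atomDensity m T P a (T x)).toReal) := by
    rw [ae_all_iff]
    intro a
    have h1 := tendsto_ae_condExp (μ := m) (ℱ := ℱ) ((P ⁻¹' {a}).indicator (fun _ => (1 : ℝ)))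
    have h2 : ∀ᵐ x ∂m, ∀ N, (m[(P ⁻¹' {a}).indicator (fun _ => (1 : ℝ)) | ℱ N]) x =
        (atomDensity m (itinerary T P N ∘ T) P a ((itinerary T P N ∘ T) x)).toReal :=
      ae_all_iff.2 fun N => condExp_indicator_atom (hq N) hP a
    rw [hsup] at h1
    filter_upwards [h1, h2, condExp_indicator_atom (m := m) hT hP a] with x h1 h2 h3
    rw [h3] at h1
    simpa only [h2] using h1
  refine tendsto_integral_abs_sub (fun N => integrable_atomInfo (hq N) hP)
    (integrable_atomInfo hT hP) (fun _ _ => atomInfo_nonneg _) (fun _ => atomInfo_nonneg _) ?_ ?_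
  · filter_upwards [hconv, ae_atomProb_pos (m := m) hT hP] with x hx hpos
    have hne : (atomProb m T P x).toReal ≠ 0 :=
      (ENNReal.toReal_pos hpos.ne' (atomProb_ne_top _)).ne'
    exact ((Real.continuousAt_log hne).tendsto.comp (hx (P x))).neg
  · have e : ∀ N, ∫ x, atomInfo m (itinerary T P N ∘ T) P x ∂m =
        (∫⁻ x, ENNReal.ofReal (atomInfo m (itinerary T P N ∘ T) P x) ∂m).toReal := fun N => integral_eq_lintegral_of_nonneg_ae
        (Eventually.of_forall fun _ => atomInfo_nonneg _) (measurable_atomInfo (hq N) hP).aestronglyMeasurable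
    have e' : ∫ x, atomInfo m T P x ∂m = (∫⁻ x, ENNReal.ofReal (atomInfo m T P x) ∂m).toReal :=
      integral_eq_lintegral_of_nonneg_ae
        (Eventually.of_forall fun _ => atomInfo_nonneg _) (measurable_atomInfo hT hP).aestronglyMeasurable
    have hbd : ∀ t : ℝ≥0∞, t ≤ 1 → ENNReal.ofReal (Real.negMulLog t.toReal) ≤ 1 := by
      intro t ht
      have h0 : (0 : ℝ) ≤ t.toReal := ENNReal.toReal_nonneg
      have := ofReal_neg_log_mul_le ht
      have hne : t ≠ ∞ := (ht.trans_lt ENNReal.one_lt_top).ne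
      nth_rw 2 [← ENNReal.ofReal_toReal hne] at this
      rw [← ENNReal.ofReal_mul' h0] at this
      rw [Real.negMulLog]
      convert this using 2
      ring
    simp_rw [e, e']
    have hfin : ∫⁻ x, ENNReal.ofReal (atomInfo m T P x) ∂m ≠ ∞ := by
      have := (integrable_atomInfo (m := m) hT hP).2
      rw [hasFiniteIntegral_iff_ofReal (Eventually.of_forall fun x => atomInfo_nonneg x)] at this
      exact this.ne
    refine (ENNReal.tendsto_toReal hfin).comp ?_
    simp_rw [lintegral_atomInfo_eq (hq _) hP, lintegral_atomInfo_eq hT hP]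
    refine tendsto_lintegral_of_dominated_convergence (fun _ => (Fintype.card A : ℝ≥0∞)) ?_ ?_ ?_ ?_
    · intro N
      exact Finset.measurable_sum _ fun a _ => (Real.continuous_negMulLog.measurable.comp
        ((measurable_atomDensity a).comp (hq N)).ennreal_toReal).ennreal_ofReal
    · intro N
      refine Eventually.of_forall fun x => ?_
      calc _ ≤ ∑ a : A, (1 : ℝ≥0∞) :=
            Finset.sum_le_sum fun a _ => hbd _ (atomDensity_le_one _ _)
        _ = _ := by simp
    · simp
    · filter_upwards [hconv] with x hx
      refine tendsto_finsetSum _ fun a _ => ?_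
      exact (ENNReal.continuous_ofReal.tendsto _).comp
        ((Real.continuous_negMulLog.tendsto _).comp (hx a))

end InfoLimit

/-! ### Averages over balls on the fibres of a kernel -/

section BallAverage

variable {E : Type*} [MetricSpace E] [MeasurableSpace E] [BorelSpace E]
  [SecondCountableTopology E] [HasBesicovitchCovering E]

/-- A weak type inequality for the ratio of two measures of balls. -/
theorem exists_measure_ball_ratio_le (E : Type*) [MetricSpace E] [MeasurableSpace E]
    [BorelSpace E] [SecondCountableTopology E] [HasBesicovitchCovering E] :
    ∃ C : ℕ, ∀ (ν μ : Measure E) (ρ : ℕ → ℝ), (∀ s, 0 < ρ s) → (∀ s, ρ s ≤ 1) → ∀ t : ℝ≥0∞,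
      ν {y | ∃ s, ν (Metric.closedBall y (ρ s)) ≤ t * μ (Metric.closedBall y (ρ s))} ≤
        C * (t * μ Set.univ) := by
  obtain ⟨N, τ, hτ, hN⟩ := HasBesicovitchCovering.no_satelliteConfig (α := E)
  refine ⟨N, fun ν μ ρ hρ0 hρ1 t => ?_⟩
  set B := {y | ∃ s, ν (Metric.closedBall y (ρ s)) ≤ t * μ (Metric.closedBall y (ρ s))}
  choose! s hs using fun y (hy : y ∈ B) => (hy : ∃ s, _)
  let q : Besicovitch.BallPackage B E :=
    { c := fun y => y
      r := fun y => ρ (s y)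
      rpos := fun y => hρ0 _
      r_bound := 1
      r_le := fun y => hρ1 _ }
  -- The Besicovitch theorem covers the bad centres by boundedly many families of disjoint bad
  -- balls; along each family the inequality between the two measures can be summed.
  obtain ⟨S, hdisj, hcov⟩ := Besicovitch.exist_disjoint_covering_families hτ hN q
  have hcount : ∀ i, (S i).Countable := fun i =>
    (hdisj i).countable_of_nonempty_interior fun j _ =>
      ⟨q.c j, Metric.ball_subset_interior_closedBall (Metric.mem_ball_self (q.rpos j))⟩
  have hsub : B ⊆ ⋃ i : Fin N, ⋃ j ∈ S i, Metric.closedBall (q.c j) (q.r j) := by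
    intro y hy
    have : y ∈ Set.range q.c := ⟨⟨y, hy⟩, rfl⟩
    refine Set.iUnion_mono (fun i => Set.iUnion₂_mono fun j _ => Metric.ball_subset_closedBall)
      (hcov this)
  calc ν B ≤ ∑ i : Fin N, ν (⋃ j ∈ S i, Metric.closedBall (q.c j) (q.r j)) :=
        (measure_mono hsub).trans (measure_iUnion_fintype_le _ _)
    _ ≤ ∑ _i : Fin N, t * μ Set.univ := by
        refine Finset.sum_le_sum fun i _ => ?_
        have := (hcount i).to_subtype
        calc ν (⋃ j ∈ S i, Metric.closedBall (q.c j) (q.r j))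
            ≤ ∑' j : S i, ν (Metric.closedBall (q.c j) (q.r j)) := measure_biUnion_le ν (hcount i) _
          _ ≤ ∑' j : S i, t * μ (Metric.closedBall (q.c j) (q.r j)) :=
              ENNReal.tsum_le_tsum fun j => hs _ j.1.2
          _ = t * μ (⋃ j ∈ S i, Metric.closedBall (q.c j) (q.r j)) := by
              rw [ENNReal.tsum_mul_left, measure_biUnion (hcount i) (hdisj i)
                fun j _ => Metric.isClosed_closedBall.measurableSet]
          _ ≤ t * μ Set.univ := by gcongr; exact Set.subset_univ _
    _ = N * (t * μ Set.univ) := by simp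

variable {F : Type*} [MeasurableSpace F]

/-- The average of `W z` over the ball `B(y, r)` with respect to `η z`. -/
def ballAvg (η : Kernel F E) (W : F × E → ℝ≥0∞) (r : ℝ) (q : F × E) : ℝ≥0∞ :=
  (∫⁻ y in Metric.closedBall q.2 r, W (q.1, y) ∂η q.1) / η q.1 (Metric.closedBall q.2 r)

theorem measurable_setLIntegral_closedBall (η : Kernel F E) [IsSFiniteKernel η]
    {W : F × E → ℝ≥0∞} (hW : Measurable W) (r : ℝ) :
    Measurable fun q : F × E => ∫⁻ y in Metric.closedBall q.2 r, W (q.1, y) ∂η q.1 := by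
  have hs : MeasurableSet {a : (F × E) × E | dist a.2 a.1.2 ≤ r} :=
    measurableSet_le (measurable_snd.dist measurable_fst.snd) measurable_const
  have h := Measurable.lintegral_kernel_prod_right' (κ := η.comap (Prod.fst : F × E → F)
    measurable_fst) (f := {a : (F × E) × E | dist a.2 a.1.2 ≤ r}.indicator
    fun a => W (a.1.1, a.2)) ((hW.comp (measurable_fst.fst.prodMk measurable_snd)).indicator hs)
  convert h using 2 with q
  rw [← lintegral_indicator Metric.isClosed_closedBall.measurableSet]
  rfl

theorem measurable_kernel_closedBall (η : Kernel F E) [IsSFiniteKernel η] (r : ℝ) :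
    Measurable fun q : F × E => η q.1 (Metric.closedBall q.2 r) := by
  have := measurable_setLIntegral_closedBall η (measurable_const (a := (1 : ℝ≥0∞))) r
  simpa using this

theorem measurable_ballAvg (η : Kernel F E) [IsSFiniteKernel η] {W : F × E → ℝ≥0∞}
    (hW : Measurable W) (r : ℝ) : Measurable (ballAvg η W r) :=
  (measurable_setLIntegral_closedBall η hW r).div (measurable_kernel_closedBall η r)

theorem ballAvg_le_one (η : Kernel F E) {W : F × E → ℝ≥0∞} (hW : ∀ q, W q ≤ 1) (r : ℝ)
    (q : F × E) : ballAvg η W r q ≤ 1 := by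
  refine ENNReal.div_le_of_le_mul ?_
  rw [one_mul]
  calc _ ≤ ∫⁻ y in Metric.closedBall q.2 r, 1 ∂η q.1 := lintegral_mono fun y => hW _
    _ = _ := by simp

theorem setLIntegral_eq_ballAvg_mul (η : Kernel F E) [IsFiniteKernel η] (W : F × E → ℝ≥0∞)
    (r : ℝ) (q : F × E) :
    ∫⁻ y in Metric.closedBall q.2 r, W (q.1, y) ∂η q.1 =
      ballAvg η W r q * η q.1 (Metric.closedBall q.2 r) := by
  by_cases h0 : η q.1 (Metric.closedBall q.2 r) = 0
  · rw [h0, mul_zero, Measure.restrict_eq_zero.2 h0, lintegral_zero_measure]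
  · exact (ENNReal.div_mul_cancel h0 (measure_ne_top _ _)).symm

theorem ae_tendsto_ballAvg {μ : Measure F} [IsFiniteMeasure μ] {η : Kernel F E} [IsMarkovKernel η]
    {W : F × E → ℝ≥0∞} (hW : Measurable W) (hW1 : ∀ q, W q ≤ 1) {ρ : ℕ → ℝ} (hρ0 : ∀ s, 0 < ρ s)
    (hρ : Tendsto ρ atTop (𝓝 0)) :
    ∀ᵐ q ∂(μ ⊗ₘ η), Tendsto (fun s => ballAvg η W (ρ s) q) atTop (𝓝 (W q)) := by
  rw [Measure.ae_compProd_iff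
    (measurableSet_tendsto_fun (fun s => measurable_ballAvg η hW (ρ s)) hW)]
  refine Eventually.of_forall fun z => ?_
  have hWz : Measurable fun y => W (z, y) := hW.comp measurable_prodMk_left
  have hfin : IsFiniteMeasure ((η z).withDensity fun y => W (z, y)) := by
    refine isFiniteMeasure_withDensity ?_
    refine ((lintegral_mono fun y => hW1 (z, y)).trans_lt ?_).ne
    simp
  filter_upwards [Besicovitch.ae_tendsto_rnDeriv ((η z).withDensity fun y => W (z, y)) (η z),
    Measure.rnDeriv_withDensity (η z) hWz] with y h1 h2
  rw [h2] at h1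
  have hρ' : Tendsto ρ atTop (𝓝[>] 0) :=
    tendsto_nhdsWithin_iff.2 ⟨hρ, Eventually.of_forall hρ0⟩
  refine (h1.comp hρ').congr fun s => ?_
  simp only [Function.comp_apply, ballAvg]
  rw [withDensity_apply _ Metric.isClosed_closedBall.measurableSet]

/-- The weak type inequality is applied to the fibre measure with density `W` and the fibre measure
itself: the average is the ratio of their masses of the ball. -/
theorem measure_exists_ballAvg_le {η : Kernel F E} [IsMarkovKernel η] {W : F × E → ℝ≥0∞}
    (hW : Measurable W) {C : ℕ} {ρ : ℕ → ℝ}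
    (hC : ∀ (ν μ : Measure E) (t : ℝ≥0∞),
      ν {y | ∃ s, ν (Metric.closedBall y (ρ s)) ≤ t * μ (Metric.closedBall y (ρ s))} ≤
        C * (t * μ Set.univ)) (t : ℝ≥0∞) (z : F) :
    ∫⁻ y, {q | ∃ s, ballAvg η W (ρ s) q ≤ t}.indicator W (z, y) ∂η z ≤ C * t := by
  have hWz : Measurable fun y => W (z, y) := hW.comp measurable_prodMk_left
  have hS : MeasurableSet {q | ∃ s, ballAvg η W (ρ s) q ≤ t} := by
    have : {q | ∃ s, ballAvg η W (ρ s) q ≤ t} = ⋃ s, {q | ballAvg η W (ρ s) q ≤ t} := by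
      ext; simp
    rw [this]
    exact MeasurableSet.iUnion fun s => measurableSet_le (measurable_ballAvg η hW _)
      measurable_const
  have hSz : MeasurableSet {y | ∃ s, ballAvg η W (ρ s) (z, y) ≤ t} := measurable_prodMk_left hS
  calc ∫⁻ y, {q | ∃ s, ballAvg η W (ρ s) q ≤ t}.indicator W (z, y) ∂η z
      = ∫⁻ y in {y | ∃ s, ballAvg η W (ρ s) (z, y) ≤ t}, W (z, y) ∂η z := by
        rw [← lintegral_indicator hSz]; rfl
    _ = ((η z).withDensity fun y => W (z, y)) {y | ∃ s, ballAvg η W (ρ s) (z, y) ≤ t} :=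
        (withDensity_apply _ hSz).symm
    _ ≤ ((η z).withDensity fun y => W (z, y)) {y | ∃ s,
        ((η z).withDensity fun y => W (z, y)) (Metric.closedBall y (ρ s)) ≤
          t * η z (Metric.closedBall y (ρ s))} := by
        refine measure_mono fun y ⟨s, hs⟩ => ⟨s, ?_⟩
        rw [withDensity_apply _ Metric.isClosed_closedBall.measurableSet,
          setLIntegral_eq_ballAvg_mul η W (ρ s) (z, y)]
        gcongr
    _ ≤ C * (t * η z Set.univ) := hC _ _ _
    _ = C * t := by simp

/-- A function with values in `[0, 1]` that is seldom small has an integrable logarithm. -/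
theorem integrable_neg_log_of_measure_le {Ω : Type*} [MeasurableSpace Ω] {m : Measure Ω}
    [IsFiniteMeasure m] {f : Ω → ℝ≥0∞} (hf : Measurable f) (hf1 : ∀ x, f x ≤ 1) {K : ℝ≥0∞}
    (hK : K ≠ ∞) (h : ∀ t : ℝ≥0∞, m {x | f x ≤ t} ≤ K * t) :
    Integrable (fun x => -Real.log (f x).toReal) m := by
  refine ⟨(Real.measurable_log.comp hf.ennreal_toReal).neg.aestronglyMeasurable, ?_⟩
  have hne : ∀ x, f x ≠ ∞ := fun x => ((hf1 x).trans_lt ENNReal.one_lt_top).ne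
  have h1 : ∀ x, (f x).toReal ≤ 1 := fun x => by
    simpa using ENNReal.toReal_mono ENNReal.one_ne_top (hf1 x)
  rw [hasFiniteIntegral_iff_ofReal (Eventually.of_forall fun x =>
    neg_nonneg.2 (Real.log_nonpos ENNReal.toReal_nonneg (h1 x)))]
  have hset : ∀ n : ℕ, MeasurableSet {x | f x ≤ ENNReal.ofReal (Real.exp (-(n : ℝ)))} := fun n =>
    measurableSet_le hf measurable_const
  -- `-log f` is at most the number of `n ≥ 0` with `f ≤ e^{-n}`, and the measures of these events
  -- are summable.
  have hbd : ∀ x, ENNReal.ofReal (-Real.log (f x).toReal) ≤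
      ∑' n : ℕ, {x | f x ≤ ENNReal.ofReal (Real.exp (-(n : ℝ)))}.indicator (1 : Ω → ℝ≥0∞) x := by
    intro x
    rcases eq_or_ne (f x) 0 with h0 | h0
    · simp [h0]
    have hpos : 0 < (f x).toReal := ENNReal.toReal_pos h0 (hne x)
    set l := -Real.log (f x).toReal with hl
    have hl0 : 0 ≤ l := neg_nonneg.2 (Real.log_nonpos ENNReal.toReal_nonneg (h1 x))
    have hmem : ∀ n ∈ Finset.range (⌊l⌋₊ + 1), {x | f x ≤ ENNReal.ofReal (Real.exp (-(n : ℝ)))}.indicator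
        (1 : Ω → ℝ≥0∞) x = 1 := by
      intro n hn
      rw [Set.indicator_of_mem]
      · rfl
      · have hn' : (n : ℝ) ≤ l := (Nat.le_floor_iff hl0).1 (by simpa [Nat.lt_succ_iff] using hn)
        show f x ≤ _
        rw [← ENNReal.ofReal_toReal (hne x)]
        refine ENNReal.ofReal_le_ofReal ?_
        rw [← Real.exp_log hpos]
        exact Real.exp_le_exp.2 (by linarith)
    refine le_trans ?_ (ENNReal.sum_le_tsum (Finset.range (⌊l⌋₊ + 1)))
    rw [Finset.sum_congr rfl hmem]
    simp only [Finset.sum_const, Finset.card_range, nsmul_eq_mul, mul_one]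
    rw [← ENNReal.ofReal_natCast]
    refine ENNReal.ofReal_le_ofReal ?_
    push_cast
    exact (Nat.lt_floor_add_one l).le
  refine (lintegral_mono hbd).trans_lt ?_
  rw [lintegral_tsum fun n => (measurable_one.indicator (hset n)).aemeasurable]
  simp_rw [lintegral_indicator_one (hset _)]
  refine (ENNReal.tsum_le_tsum fun n => h _).trans_lt ?_
  rw [ENNReal.tsum_mul_left]
  refine ENNReal.mul_lt_top hK.lt_top ?_
  have hs : Summable fun n : ℕ => Real.exp (-(n : ℝ)) := by
    simpa using Real.summable_exp_neg_nat
  rw [← ENNReal.ofReal_tsum_of_nonneg (fun n => (Real.exp_pos _).le) hs]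
  exact ENNReal.ofReal_lt_top

end BallAverage

/-! ### Conditional measures on the fibres of a map -/

section Fibre

variable {Ω F E A : Type*} [mΩ : MeasurableSpace Ω] [mF : MeasurableSpace F]
  [MeasurableSpace E]

/-- The conditional distribution of `y` given `p`. -/
def fibreKernel [StandardBorelSpace E] [Nonempty E] (m : Measure Ω) [IsFiniteMeasure m]
    (p : Ω → F) (y : Ω → E) : Kernel F E :=
  (m.map fun x => (p x, y x)).condKernel

instance [StandardBorelSpace E] [Nonempty E] (m : Measure Ω) [IsFiniteMeasure m]
    (p : Ω → F) (y : Ω → E) : IsMarkovKernel (fibreKernel m p y) := by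
  unfold fibreKernel; infer_instance

/-- The information gained by passing from `q ∘ T` to `q`. -/
def projInfo (m : Measure Ω) (T : Ω → Ω) (P : Ω → A) {G : Type*} [MeasurableSpace G] (q : Ω → G)
    (x : Ω) : ℝ :=
  atomInfo m (q ∘ T) P x - atomInfo m q P x

variable [StandardBorelSpace E] [Nonempty E]
variable {m : Measure Ω} [IsProbabilityMeasure m] {p : Ω → F} {y : Ω → E}

theorem compProd_fibreKernel (hp : Measurable p) (hy : Measurable y) :
    (m.map p) ⊗ₘ fibreKernel m p y = m.map fun x => (p x, y x) := by
  have h : (m.map fun x => (p x, y x)).fst = m.map p := Measure.fst_map_prodMk hy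
  rw [← h]
  exact (m.map fun x => (p x, y x)).disintegrate (m.map fun x => (p x, y x)).condKernel

theorem lintegral_fibreKernel (hp : Measurable p) (hy : Measurable y) {k : F × E → ℝ≥0∞}
    (hk : Measurable k) :
    ∫⁻ x, ∫⁻ y', k (p x, y') ∂fibreKernel m p y (p x) ∂m = ∫⁻ x, k (p x, y x) ∂m := by
  have h1 : ∫⁻ q, k q ∂((m.map p) ⊗ₘ fibreKernel m p y) = _ := Measure.lintegral_compProd hk
  rw [compProd_fibreKernel hp hy, lintegral_map hk (hp.prodMk hy), lintegral_map _ hp] at h1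
  · exact h1.symm
  · exact hk.lintegral_kernel_prod_right'

/-- Geometric inclusions are known only for points of the compact set carrying the coding map; this
discards the rest of a fibre. -/
theorem ae_fibreKernel_eq_zero (hp : Measurable p) (hy : Measurable y) {Y : Set E}
    (hY : MeasurableSet Y) (h : ∀ x, y x ∈ Y) : ∀ᵐ x ∂m, fibreKernel m p y (p x) Yᶜ = 0 := by
  have h1 := lintegral_fibreKernel (m := m) hp hy
    (k := (Prod.snd ⁻¹' Yᶜ).indicator 1) (measurable_one.indicator (measurable_snd hY.compl))
  have h2 : ∀ x, (Prod.snd ⁻¹' Yᶜ : Set (F × E)).indicator (1 : F × E → ℝ≥0∞) (p x, y x) = 0 := by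
    intro x
    simp [h x]
  simp_rw [h2, lintegral_zero] at h1
  rw [lintegral_eq_zero_iff] at h1
  · filter_upwards [h1] with x hx
    have : ∀ y', (Prod.snd ⁻¹' Yᶜ : Set (F × E)).indicator (1 : F × E → ℝ≥0∞) (p x, y') =
      Yᶜ.indicator 1 y' := fun y' => rfl
    simp_rw [this] at hx
    rwa [lintegral_indicator_one hY.compl] at hx
  · exact (Measurable.lintegral_kernel_prod_right' (κ := fibreKernel m p y)
      (measurable_one.indicator (measurable_snd hY.compl))).comp hp

variable {T : Ω → Ω} {P : Ω → A} [Fintype A] [MeasurableSpace A] [MeasurableSingletonClass A]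
  [MeasurableSpace.CountableOrCountablyGenerated F E]

/-- The change of the conditional measures on fibres under the dynamics. -/
theorem ae_atomDensity_mul_fibreKernel (hT : MeasurePreserving T m m) (hp : Measurable p)
    (hy : Measurable y) (hP : Measurable P) {φ ψ : A → F → F} {χ : A → E → E}
    (hφ : ∀ a, Measurable (φ a)) (hψ : ∀ a, Measurable (ψ a)) (hχ : ∀ a, Measurable (χ a))
    (hpφ : ∀ x, p x = φ (P x) (p (T x))) (hpψ : ∀ x, p (T x) = ψ (P x) (p x))
    (hyχ : ∀ x, y x = χ (P x) (y (T x))) (a : A) :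
    ∀ᵐ z ∂(m.map p), ∀ B, MeasurableSet B →
      atomDensity m (p ∘ T) P a z * ∫⁻ y' in B, atomDensity m (fun x => (p x, y x)) P a (φ a z, y')
          ∂fibreKernel m p y (φ a z) =
        atomDensity m p P a (φ a z) * ∫⁻ y' in χ a ⁻¹' B,
          atomDensity m ((fun x => (p x, y x)) ∘ T) P a (z, y') ∂fibreKernel m p y z := by
  set py : Ω → F × E := fun x => (p x, y x) with hpy
  have hpym : Measurable py := hp.prodMk hy
  set η := fibreKernel m p y
  let U : F × E → ℝ≥0∞ := atomDensity m py P a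
  let V : F × E → ℝ≥0∞ := atomDensity m (py ∘ T) P a
  let u : F → ℝ≥0∞ := atomDensity m p P a
  let v : F → ℝ≥0∞ := atomDensity m (p ∘ T) P a
  have hU : Measurable U := measurable_atomDensity a
  have hV : Measurable V := measurable_atomDensity a
  have hu : Measurable u := measurable_atomDensity a
  have hv : Measurable v := measurable_atomDensity a
  let f1 : F → E → ℝ≥0∞ := fun z y' => v z * U (φ a z, y')
  have hf1 : Measurable (Function.uncurry f1) :=
    (hv.comp measurable_fst).mul (hU.comp (((hφ a).comp measurable_fst).prodMk measurable_snd))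
  let f2 : F → E → ℝ≥0∞ := fun z y' => u (φ a z) * V (z, y')
  have hf2 : Measurable (Function.uncurry f2) :=
    (hu.comp ((hφ a).comp measurable_fst)).mul (hV.comp (measurable_fst.prodMk measurable_snd))
  let κ1 : Kernel F E := (η.comap (φ a) (hφ a)).withDensity f1
  let κ2 : Kernel F E := (η.withDensity f2).map (χ a)
  have hfin1 : IsFiniteKernel κ1 := Kernel.isFiniteKernel_withDensity_of_bounded _
    ENNReal.one_ne_top fun z y' => mul_le_one' (atomDensity_le_one _ _) (atomDensity_le_one _ _)
  have hfin2' : IsFiniteKernel (η.withDensity f2) := Kernel.isFiniteKernel_withDensity_of_bounded _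
    ENNReal.one_ne_top fun z y' => mul_le_one' (atomDensity_le_one _ _) (atomDensity_le_one _ _)
  have hfin2 : IsFiniteKernel κ2 := by
    show IsFiniteKernel ((η.withDensity f2).map (χ a))
    infer_instance
  -- Both kernels describe, up to the common factor `u v`, the law of `y` given `P = a` and `p ∘ T =
  -- z`. On `P = a` one has `p = φ_a(z)`, so this law is the fibre measure over `φ_a(z)` reweighted
  -- by `U / u`; also `y = χ_a(y ∘ T)`, so it is the image under `χ_a` of the fibre measure over `z`
  -- reweighted by `V / v`. The calculation below moves a test set from one description to the
  -- other, trading each density for a restriction to `P = a` and back.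
  have key : (m.map p) ⊗ₘ κ1 = (m.map p) ⊗ₘ κ2 := by
    ext s hs
    have hsz : ∀ z, MeasurableSet (Prod.mk z ⁻¹' s) := fun z => measurable_prodMk_left hs
    have e1 : ∀ z, κ1 z (Prod.mk z ⁻¹' s) =
        (∫⁻ y', s.indicator 1 (z, y') * U (φ a z, y') ∂η (φ a z)) * v z := by
      intro z
      show (η.comap (φ a) (hφ a)).withDensity f1 z _ = _
      rw [Kernel.withDensity_apply' _ hf1, Kernel.comap_apply, ← lintegral_indicator (hsz z),
        mul_comm, ← lintegral_const_mul]
      · refine lintegral_congr fun y' => ?_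
        by_cases h : (z, y') ∈ s
        · simp [h, f1]
        · simp [h]
      · exact ((measurable_one.indicator hs).comp measurable_prodMk_left).mul
          (hU.comp measurable_prodMk_left)
    have e2 : ∀ z, κ2 z (Prod.mk z ⁻¹' s) =
        ∫⁻ y', u (φ a z) * s.indicator 1 (z, χ a y') * V (z, y') ∂η z := by
      intro z
      show (η.withDensity f2).map (χ a) z _ = _
      rw [Kernel.map_apply' _ (hχ a) _ (hsz z), Kernel.withDensity_apply' _ hf2,
        ← lintegral_indicator ((hχ a) (hsz z))]
      refine lintegral_congr fun y' => ?_
      by_cases h : (z, χ a y') ∈ s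
      · simp [h, f2]
      · simp [h]
    have hint1 : Measurable fun z => ∫⁻ y', s.indicator 1 (z, y') * U (φ a z, y') ∂η (φ a z) := by
      have := Measurable.lintegral_kernel_prod_right' (κ := η.comap (φ a) (hφ a))
        (f := fun q => s.indicator 1 q * U (φ a q.1, q.2)) ((measurable_one.indicator hs).mul
          (hU.comp (((hφ a).comp measurable_fst).prodMk measurable_snd)))
      exact this
    let g : F × E → ℝ≥0∞ := fun q => s.indicator 1 (ψ a q.1, q.2)
    have hg : Measurable g := (measurable_one.indicator hs).comp
      (((hψ a).comp measurable_fst).prodMk measurable_snd)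
    let g' : F × E → ℝ≥0∞ := fun q => u (φ a q.1) * s.indicator 1 (q.1, χ a q.2)
    have hg' : Measurable g' := (hu.comp ((hφ a).comp measurable_fst)).mul
      ((measurable_one.indicator hs).comp
        (measurable_fst.prodMk ((hχ a).comp measurable_snd)))
    have hint2 : Measurable fun z => ∫⁻ y', g (z, y') * U (z, y') ∂η z :=
      Measurable.lintegral_kernel_prod_right' (f := fun q => g q * U q) (hg.mul hU)
    have hint3 : Measurable fun z => ∫⁻ y', g' (z, y') * V (z, y') ∂η z :=
      Measurable.lintegral_kernel_prod_right' (f := fun q => g' q * V q) (hg'.mul hV)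
    have hPa : MeasurableSet (P ⁻¹' {a}) := hP (measurableSet_singleton a)
    rw [Measure.compProd_apply hs, Measure.compProd_apply hs]
    simp_rw [e1, e2]
    let J : F → ℝ≥0∞ := fun z =>
      (∫⁻ y', s.indicator 1 (z, y') * U (φ a z, y') ∂η (φ a z)) * v z
    have hJ : Measurable J := hint1.mul hv
    have eJ : ∫⁻ z, J z ∂(m.map p) = ∫⁻ x, J (p (T x)) ∂m := by
      rw [lintegral_map hJ hp, hT.lintegral_comp (f := fun x => J (p x)) (hJ.comp hp)]
    refine eJ.trans ?_
    rw [show (fun z => ∫⁻ y', u (φ a z) * s.indicator 1 (z, χ a y') * V (z, y') ∂η z) =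
      fun z => ∫⁻ y', g' (z, y') * V (z, y') ∂η z from rfl, lintegral_map hint3 hp]
    calc ∫⁻ x, (∫⁻ y', s.indicator 1 (p (T x), y') * U (φ a (p (T x)), y')
            ∂η (φ a (p (T x)))) * v (p (T x)) ∂m
        = ∫⁻ x in P ⁻¹' {a}, ∫⁻ y', s.indicator 1 (p (T x), y') * U (φ a (p (T x)), y')
            ∂η (φ a (p (T x))) ∂m :=
          (setLIntegral_comp_atom (m := m) (p := p ∘ T) (hp.comp hT.measurable) a hint1).symm
      _ = ∫⁻ x in P ⁻¹' {a}, ∫⁻ y', g (p x, y') * U (p x, y') ∂η (p x) ∂m := by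
          refine setLIntegral_congr_fun hPa fun x hx => ?_
          have hx' : P x = a := hx
          simp only [g]
          rw [← hx', ← hpφ x, ← hpψ x]
      _ = ∫⁻ x, (∫⁻ y', g (p x, y') * U (p x, y') ∂η (p x)) * u (p x) ∂m :=
          setLIntegral_comp_atom hp a hint2
      _ = ∫⁻ x, ∫⁻ y', g (p x, y') * U (p x, y') * u (p x) ∂η (p x) ∂m := by
          refine lintegral_congr fun x => ?_
          rw [lintegral_mul_const]
          exact (hg.mul hU).comp measurable_prodMk_left
      _ = ∫⁻ x, g (p x, y x) * U (p x, y x) * u (p x) ∂m :=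
          lintegral_fibreKernel hp hy (k := fun q => g q * U q * u q.1)
            ((hg.mul hU).mul (hu.comp measurable_fst))
      _ = ∫⁻ x, (g (py x) * u (py x).1) * U (py x) ∂m := by
          refine lintegral_congr fun x => ?_
          simp only [hpy]; ring
      _ = ∫⁻ x in P ⁻¹' {a}, g (py x) * u (py x).1 ∂m :=
          (setLIntegral_comp_atom hpym a (k := fun q => g q * u q.1)
            (hg.mul (hu.comp measurable_fst))).symm
      _ = ∫⁻ x in P ⁻¹' {a}, g' ((py ∘ T) x) ∂m := by
          refine setLIntegral_congr_fun hPa fun x hx => ?_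
          have hx' : P x = a := hx
          simp only [g, g', hpy, Function.comp_apply]
          rw [← hx', ← hpφ x, ← hpψ x, ← hyχ x, mul_comm]
      _ = ∫⁻ x, g' ((py ∘ T) x) * V ((py ∘ T) x) ∂m :=
          setLIntegral_comp_atom (hpym.comp hT.measurable) a hg'
      _ = ∫⁻ x, g' (py x) * V (py x) ∂m :=
          hT.lintegral_comp (f := fun x => g' (py x) * V (py x)) ((hg'.mul hV).comp hpym)
      _ = ∫⁻ x, ∫⁻ y', g' (p x, y') * V (p x, y') ∂η (p x) ∂m :=
          (lintegral_fibreKernel hp hy (k := fun q => g' q * V q) (hg'.mul hV)).symm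
  filter_upwards [Kernel.ae_eq_of_compProd_eq key] with z hz B hB
  have h1 : κ1 z B = v z * ∫⁻ y' in B, U (φ a z, y') ∂η (φ a z) := by
    show (η.comap (φ a) (hφ a)).withDensity f1 z _ = _
    rw [Kernel.withDensity_apply' _ hf1, Kernel.comap_apply, ← lintegral_const_mul]
    exact hU.comp measurable_prodMk_left
  have h2 : κ2 z B = u (φ a z) * ∫⁻ y' in χ a ⁻¹' B, V (z, y') ∂η z := by
    show (η.withDensity f2).map (χ a) z _ = _
    rw [Kernel.map_apply' _ (hχ a) _ hB, Kernel.withDensity_apply' _ hf2, ← lintegral_const_mul]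
    exact hV.comp measurable_prodMk_left
  show v z * _ = u (φ a z) * _
  rw [← h1, ← h2, hz]

end Fibre

/-! ### Telescoping the measure of balls on fibres -/

section Telescope

theorem tendsto_iInf_add_of_tendsto {u : ℕ → ℝ≥0∞} {l : ℝ≥0∞} (h : Tendsto u atTop (𝓝 l)) :
    Tendsto (fun n => ⨅ i, u (i + n)) atTop (𝓝 l) := by
  rw [← h.liminf_eq, liminf_eq_iSup_iInf_of_nat']
  refine tendsto_atTop_iSup fun a b hab => le_iInf fun i => ?_
  refine (iInf_le _ (i + (b - a))).trans_eq ?_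
  congr 1; omega

theorem tendsto_iSup_add_of_tendsto {u : ℕ → ℝ≥0∞} {l : ℝ≥0∞} (h : Tendsto u atTop (𝓝 l)) :
    Tendsto (fun n => ⨆ i, u (i + n)) atTop (𝓝 l) := by
  rw [← h.limsup_eq, limsup_eq_iInf_iSup_of_nat']
  refine tendsto_atTop_iInf fun a b hab => iSup_le fun i => ?_
  refine le_trans (le_of_eq ?_) (le_iSup _ (i + (b - a)))
  congr 1; omega

variable {Ω F E A : Type*} [mΩ : MeasurableSpace Ω] [mF : MeasurableSpace F]
  [MetricSpace E] [MeasurableSpace E] [BorelSpace E] [SecondCountableTopology E]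
  [HasBesicovitchCovering E] [StandardBorelSpace E] [Nonempty E]
variable {m : Measure Ω} [IsProbabilityMeasure m] {p : Ω → F} {y : Ω → E}
variable {T : Ω → Ω} {P : Ω → A} [Fintype A] [MeasurableSpace A] [MeasurableSingletonClass A]

/-- Summing over the symbols with their conditional probabilities puts the density itself under the
integral, which is the quantity controlled on each fibre by `measure_exists_ballAvg_le`. -/
theorem exists_measure_iInf_ballAvg_le (E : Type*) [MetricSpace E] [MeasurableSpace E]
    [BorelSpace E] [SecondCountableTopology E] [HasBesicovitchCovering E]
    [StandardBorelSpace E] [Nonempty E] :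
    ∃ C : ℕ, ∀ {p : Ω → F} {y : Ω → E}, Measurable p → Measurable y → Measurable P →
      ∀ {ρ : ℕ → ℝ}, (∀ s, 0 < ρ s) → (∀ s, ρ s ≤ 1) → ∀ t : ℝ≥0∞, 
      m {x | ∃ s, ballAvg (fibreKernel m p y) (atomDensity m (fun x => (p x, y x)) P (P x)) (ρ s)
        (p x, y x) ≤ t} ≤ (Fintype.card A * C : ℕ) * t := by
  obtain ⟨C, hC⟩ := exists_measure_ball_ratio_le E
  refine ⟨C, fun {p y} hp hy hP {ρ} hρ0 hρ1 t => ?_⟩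
  set η := fibreKernel m p y
  set py : Ω → F × E := fun x => (p x, y x) with hpy
  have hpym : Measurable py := hp.prodMk hy
  have hU : ∀ a, Measurable (atomDensity m py P a) := fun a => measurable_atomDensity a
  let S : A → Set (F × E) := fun a => {q | ∃ s, ballAvg η (atomDensity m py P a) (ρ s) q ≤ t}
  have hS : ∀ a, MeasurableSet (S a) := by
    intro a
    have : S a = ⋃ s, {q | ballAvg η (atomDensity m py P a) (ρ s) q ≤ t} := by
      ext; simp [S]
    rw [this]
    exact MeasurableSet.iUnion fun s => measurableSet_le (measurable_ballAvg η (hU a) _)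
      measurable_const
  have hset : MeasurableSet {x | py x ∈ S (P x)} := by
    have h : {x | py x ∈ S (P x)} = ⋃ a, P ⁻¹' {a} ∩ py ⁻¹' S a := by
      ext x; simp
    rw [h]
    exact MeasurableSet.iUnion fun a => (hP (measurableSet_singleton a)).inter (hpym (hS a))
  calc m {x | py x ∈ S (P x)} = ∫⁻ x, {x | py x ∈ S (P x)}.indicator 1 x ∂m :=
        (lintegral_indicator_one hset).symm
    _ = ∫⁻ x, (S (P x)).indicator 1 (py x) ∂m := rfl
    _ = ∫⁻ x, ∑ a, (S a).indicator 1 (py x) * atomDensity m py P a (py x) ∂m :=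
        lintegral_comp_atom hpym hP (k := fun a => (S a).indicator 1)
          fun a => measurable_one.indicator (hS a)
    _ = ∫⁻ x, ∑ a, (S a).indicator (atomDensity m py P a) (py x) ∂m := by
        refine lintegral_congr fun x => Finset.sum_congr rfl fun a _ => ?_
        by_cases h : py x ∈ S a
        · simp [h]
        · simp [h]
    _ = ∑ a, ∫⁻ x, (S a).indicator (atomDensity m py P a) (py x) ∂m :=
        lintegral_finsetSum _ fun a _ => ((hU a).indicator (hS a)).comp hpym
    _ = ∑ a, ∫⁻ x, ∫⁻ y', (S a).indicator (atomDensity m py P a) (p x, y') ∂η (p x) ∂m := by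
        refine Finset.sum_congr rfl fun a _ => ?_
        exact (lintegral_fibreKernel hp hy ((hU a).indicator (hS a))).symm
    _ ≤ ∑ _a : A, ∫⁻ _x, C * t ∂m := by
        refine Finset.sum_le_sum fun a _ => lintegral_mono fun x => ?_
        exact measure_exists_ballAvg_le (hU a) (fun ν μ t => hC ν μ ρ hρ0 hρ1 t) t (p x)
    _ = (Fintype.card A * C : ℕ) * t := by
        simp [mul_assoc]

set_option maxHeartbeats 1600000 in
/-- One step of the telescoping of the measures of balls on the fibres of `p`. -/
theorem exists_fibreKernel_closedBall_le [MeasurableSpace.CountableOrCountablyGenerated F E]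
    (hT : MeasurePreserving T m m) (hp : Measurable p)
    (hy : Measurable y) (hP : Measurable P) {φ ψ : A → F → F} {χ : A → E → E}
    (hφ : ∀ a, Measurable (φ a)) (hψ : ∀ a, Measurable (ψ a)) (hχ : ∀ a, Measurable (χ a))
    (hpφ : ∀ x, p x = φ (P x) (p (T x))) (hpψ : ∀ x, p (T x) = ψ (P x) (p x))
    (hyχ : ∀ x, y x = χ (P x) (y (T x))) {Y : Set E} (hY : MeasurableSet Y) (hyY : ∀ x, y x ∈ Y)
    {ρ : ℕ → ℝ} (hρ0 : ∀ s, 0 < ρ s) (hρ1 : ∀ s, ρ s ≤ 1) (hρ : Tendsto ρ atTop (𝓝 0)) :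
    ∃ err : ℕ → Ω → ℝ, (∀ s, Measurable (err s)) ∧ (∀ s, Integrable (err s) m) ∧
      Tendsto (fun s => ∫ x, |err s x| ∂m) atTop (𝓝 0) ∧
      ∀ᵐ x ∂m, ∀ s₀ s s', s₀ ≤ s → s₀ ≤ s' →
        (∀ y' ∈ Y, dist (χ (P x) y') (y x) ≤ ρ s → dist y' (y (T x)) ≤ ρ s') →
        fibreKernel m p y (p x) (Metric.closedBall (y x) (ρ s)) ≤
          ENNReal.ofReal (Real.exp (projInfo m T P p x - projInfo m T P (fun x => (p x, y x)) x +
            err s₀ x)) * fibreKernel m p y (p (T x)) (Metric.closedBall (y (T x)) (ρ s')) := by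
  set η := fibreKernel m p y with hη
  set py : Ω → F × E := fun x => (p x, y x) with hpy
  have hpym : Measurable py := hp.prodMk hy
  let U : A → F × E → ℝ≥0∞ := atomDensity m py P
  let V : A → F × E → ℝ≥0∞ := atomDensity m (py ∘ T) P
  have hU : ∀ a, Measurable (U a) := fun a => measurable_atomDensity a
  have hV : ∀ a, Measurable (V a) := fun a => measurable_atomDensity a
  have hU1 : ∀ a q, U a q ≤ 1 := fun a q => atomDensity_le_one _ _
  have hV1 : ∀ a q, V a q ≤ 1 := fun a q => atomDensity_le_one _ _
  -- Averages of the densities over fibre balls enter Bayes' formula at unknown radii. The infimum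
  -- and the supremum over all indices at least `n` give bounds that hold for every such radius.
  let Ui : ℕ → Ω → ℝ≥0∞ := fun n x => ⨅ i, ballAvg η (U (P x)) (ρ (i + n)) (py x)
  let Vs : ℕ → Ω → ℝ≥0∞ := fun n x => ⨆ i, ballAvg η (V (P x)) (ρ (i + n)) (py (T x))
  have hUim : ∀ n, Measurable (Ui n) := fun n =>
    Measurable.iInf fun i => measurable_comp_atom (k := fun a => ballAvg η (U a) (ρ (i + n)))
      hpym hP fun a => measurable_ballAvg η (hU a) _
  have hVsm : ∀ n, Measurable (Vs n) := fun n =>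
    Measurable.iSup fun i => measurable_comp_atom (p := py ∘ T)
      (k := fun a => ballAvg η (V a) (ρ (i + n)))
      (hpym.comp hT.measurable) hP fun a => measurable_ballAvg η (hV a) _
  have hUi1 : ∀ n x, Ui n x ≤ 1 := fun n x => (iInf_le _ 0).trans (ballAvg_le_one η (hU1 _) _ _)
  have hVs1 : ∀ n x, Vs n x ≤ 1 := fun n x => iSup_le fun i => ballAvg_le_one η (hV1 _) _ _
  have hUimono : ∀ x, Monotone fun n => Ui n x := fun x a b hab => le_iInf fun i =>
    (iInf_le _ (i + (b - a))).trans_eq (by congr 2; omega)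
  have hUlim : ∀ᵐ x ∂m, Tendsto (fun n => Ui n x) atTop (𝓝 (atomProb m py P x)) := by
    have h : ∀ᵐ q ∂(m.map py), ∀ a, Tendsto (fun s => ballAvg η (U a) (ρ s) q) atTop
        (𝓝 (U a q)) := by
      rw [← compProd_fibreKernel hp hy, ae_all_iff]
      exact fun a => ae_tendsto_ballAvg (hU a) (hU1 a) hρ0 hρ
    filter_upwards [ae_of_ae_map hpym.aemeasurable h] with x hx
    exact tendsto_iInf_add_of_tendsto
      (u := fun s => ballAvg η (U (P x)) (ρ s) (py x)) (hx (P x))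
  have hVlim : ∀ᵐ x ∂m, Tendsto (fun s => ballAvg η (V (P x)) (ρ s) (py (T x))) atTop
      (𝓝 (atomProb m (py ∘ T) P x)) := by
    have h : ∀ᵐ q ∂(m.map py), ∀ a, Tendsto (fun s => ballAvg η (V a) (ρ s) q) atTop
        (𝓝 (V a q)) := by
      rw [← compProd_fibreKernel hp hy, ae_all_iff]
      exact fun a => ae_tendsto_ballAvg (hV a) (hV1 a) hρ0 hρ
    have h' := ae_of_ae_map hpym.aemeasurable h
    filter_upwards [hT.quasiMeasurePreserving.ae h'] with x hx
    exact hx (P x)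
  have hVslim : ∀ᵐ x ∂m, Tendsto (fun n => Vs n x) atTop (𝓝 (atomProb m (py ∘ T) P x)) := by
    filter_upwards [hVlim] with x hx
    exact tendsto_iSup_add_of_tendsto
      (u := fun s => ballAvg η (V (P x)) (ρ s) (py (T x))) hx
  have hVsge : ∀ᵐ x ∂m, ∀ n, atomProb m (py ∘ T) P x ≤ Vs n x := by
    filter_upwards [hVlim] with x hx n
    refine le_of_tendsto hx ?_
    filter_upwards [eventually_ge_atTop n] with s hs
    refine le_trans (le_of_eq ?_) (le_iSup _ (s - n))
    congr 2; omega
  obtain ⟨C, hC⟩ := exists_measure_iInf_ballAvg_le (m := m) (P := P) (Ω := Ω) (F := F) E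
  have hKtop : ((Fintype.card A * C : ℕ) : ℝ≥0∞) ≠ ∞ := ENNReal.natCast_ne_top _
  have hUimeas' : ∀ t : ℝ≥0∞, m {x | Ui 0 x ≤ t} ≤ (Fintype.card A * C : ℕ) * t := by
    intro t
    rcases eq_or_ne t ∞ with rfl | ht
    · refine le_trans (measure_mono fun x _ => ?_) (hC hp hy hP hρ0 hρ1 ∞)
      exact ⟨0, le_top⟩
    -- The infimum need not be attained, so the weak type bound is used at `t + 1/n` and `n` tends
    -- to infinity.
    have hlim : Tendsto (fun n : ℕ => ((Fintype.card A * C : ℕ) : ℝ≥0∞) * (t + (n : ℝ≥0∞)⁻¹)) atTop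
        (𝓝 ((Fintype.card A * C : ℕ) * (t + 0))) :=
      ENNReal.Tendsto.const_mul (tendsto_const_nhds.add ENNReal.tendsto_inv_nat_nhds_zero)
        (Or.inr hKtop)
    rw [add_zero] at hlim
    refine ge_of_tendsto' hlim fun n => ?_
    refine (measure_mono fun x hx => ?_).trans (hC hp hy hP hρ0 hρ1 _)
    have hlt : Ui 0 x < t + (n : ℝ≥0∞)⁻¹ := lt_of_le_of_lt hx
      (ENNReal.lt_add_right ht (by simp))
    obtain ⟨i, hi⟩ := iInf_lt_iff.1 (show (⨅ i, _) < t + (n : ℝ≥0∞)⁻¹ from hlt)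
    exact ⟨_, hi.le⟩
  have hUi0 : ∀ᵐ x ∂m, 0 < Ui 0 x := by
    have h := hUimeas' 0
    rw [mul_zero, nonpos_iff_eq_zero] at h
    filter_upwards [measure_eq_zero_iff_ae_notMem.1 h] with x hx
    exact not_le.1 hx
  have hint0 : Integrable (fun x => -Real.log (Ui 0 x).toReal) m :=
    integrable_neg_log_of_measure_le (hUim 0) (hUi1 0) hKtop hUimeas'
  have hintU : Integrable (atomInfo m py P) m := integrable_atomInfo hpym hP
  have hintV : Integrable (atomInfo m (py ∘ T) P) m :=
    integrable_atomInfo (hpym.comp hT.measurable) hP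
  -- The error is the change in the logarithms when the two densities are replaced by the extremal
  -- averages. It tends to zero almost everywhere; `Vs` lies between the density and `1`, so the
  -- only term of the dominating function that needs the weak type bound is `-log Ui 0`.
  let err : ℕ → Ω → ℝ := fun n x => (-Real.log (Ui n x).toReal - atomInfo m py P x) +
    (atomInfo m (py ∘ T) P x + Real.log (Vs n x).toReal)
  have herrm : ∀ n, Measurable (err n) := fun n =>
    ((Real.measurable_log.comp (hUim n).ennreal_toReal).neg.sub (measurable_atomInfo hpym hP)).add
      ((measurable_atomInfo (hpym.comp hT.measurable) hP).add
        (Real.measurable_log.comp (hVsm n).ennreal_toReal))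
  have hUVpos : ∀ᵐ x ∂m, (∀ n, 0 < (Ui n x).toReal) ∧ (∀ n, 0 < (Vs n x).toReal) ∧
      0 < (atomProb m (py ∘ T) P x).toReal ∧ 0 < (atomProb m py P x).toReal := by
    filter_upwards [hUi0, hVsge, ae_atomProb_pos (m := m) (hpym.comp hT.measurable) hP,
      ae_atomProb_pos (m := m) hpym hP] with x h1 h2 h3 h4
    refine ⟨fun n => ENNReal.toReal_pos (h1.trans_le (hUimono x (Nat.zero_le n))).ne'
      ((hUi1 n x).trans_lt ENNReal.one_lt_top).ne, fun n => ENNReal.toReal_pos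
      (h3.trans_le (h2 n)).ne' ((hVs1 n x).trans_lt ENNReal.one_lt_top).ne,
      ENNReal.toReal_pos h3.ne' (atomProb_ne_top _), ENNReal.toReal_pos h4.ne' (atomProb_ne_top _)⟩
  have hbd : ∀ᵐ x ∂m, ∀ n, |err n x| ≤
      -Real.log (Ui 0 x).toReal + atomInfo m py P x + atomInfo m (py ∘ T) P x := by
    filter_upwards [hUVpos, hVsge] with x ⟨h1, h2, h3, h4⟩ h5 n
    have a1 : 0 ≤ -Real.log (Ui n x).toReal := neg_nonneg.2 (Real.log_nonpos ENNReal.toReal_nonneg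
      (by simpa using ENNReal.toReal_mono ENNReal.one_ne_top (hUi1 n x)))
    have a2 : -Real.log (Ui n x).toReal ≤ -Real.log (Ui 0 x).toReal := by
      refine neg_le_neg (Real.log_le_log (h1 0) (ENNReal.toReal_mono
        ((hUi1 n x).trans_lt ENNReal.one_lt_top).ne (hUimono x (Nat.zero_le n))))
    have a3 : Real.log (Vs n x).toReal ≤ 0 := Real.log_nonpos ENNReal.toReal_nonneg
      (by simpa using ENNReal.toReal_mono ENNReal.one_ne_top (hVs1 n x))
    have a4 : -atomInfo m (py ∘ T) P x ≤ Real.log (Vs n x).toReal := by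
      unfold atomInfo
      rw [neg_neg]
      exact Real.log_le_log h3 (ENNReal.toReal_mono
        ((hVs1 n x).trans_lt ENNReal.one_lt_top).ne (h5 n))
    have a5 := atomInfo_nonneg (m := m) (p := py) (P := P) x
    have a6 := atomInfo_nonneg (m := m) (p := py ∘ T) (P := P) x
    rw [abs_le]
    constructor
    · show _ ≤ (-Real.log (Ui n x).toReal - atomInfo m py P x) +
        (atomInfo m (py ∘ T) P x + Real.log (Vs n x).toReal)
      linarith
    · show (-Real.log (Ui n x).toReal - atomInfo m py P x) +
        (atomInfo m (py ∘ T) P x + Real.log (Vs n x).toReal) ≤ _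
      linarith
  have hintG := (hint0.add hintU).add hintV
  have herri : ∀ n, Integrable (err n) m := fun n =>
    hintG.mono' (herrm n).aestronglyMeasurable (hbd.mono fun x hx => hx n)
  refine ⟨err, herrm, herri, ?_, ?_⟩
  · have h0 : ∫ x, (0 : ℝ) ∂m = 0 := integral_zero _ _
    rw [← h0]
    refine tendsto_integral_of_dominated_convergence _
      (fun n => (herri n).abs.aestronglyMeasurable) hintG ?_ ?_
    · intro n
      filter_upwards [hbd] with x hx
      rw [Real.norm_of_nonneg (abs_nonneg _)]
      exact hx n
    · filter_upwards [hUlim, hVslim, hUVpos] with x h1 h2 ⟨_, _, h3, h4⟩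
      have b1 := ((Real.continuousAt_log h4.ne').tendsto.comp
        ((ENNReal.tendsto_toReal (atomProb_ne_top (m := m) (p := py) (P := P) x)).comp h1)).neg
      have b2 := (Real.continuousAt_log h3.ne').tendsto.comp
        ((ENNReal.tendsto_toReal (atomProb_ne_top (m := m) (p := py ∘ T) (P := P) x)).comp h2)
      have b3 := ((b1.sub_const (atomInfo m py P x)).add
        (b2.const_add (atomInfo m (py ∘ T) P x))).abs
      have e : |-Real.log (atomProb m py P x).toReal - atomInfo m py P x +
          (atomInfo m (py ∘ T) P x + Real.log (atomProb m (py ∘ T) P x).toReal)| = 0 := by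
        simp [atomInfo]
      rw [e] at b3
      exact b3
  · have hrel : ∀ᵐ z ∂(m.map p), ∀ a, ∀ B, MeasurableSet B →
      atomDensity m (p ∘ T) P a z * ∫⁻ y' in B, U a (φ a z, y') ∂η (φ a z) =
        atomDensity m p P a (φ a z) * ∫⁻ y' in χ a ⁻¹' B, V a (z, y') ∂η z :=
      ae_all_iff.2 fun a => ae_atomDensity_mul_fibreKernel hT hp hy hP hφ hψ hχ hpφ hpψ hyχ a
    have hrel' := hT.quasiMeasurePreserving.ae (ae_of_ae_map hp.aemeasurable hrel)
    have hYnull := hT.quasiMeasurePreserving.ae (ae_fibreKernel_eq_zero (m := m) hp hy hY hyY)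
    filter_upwards [hrel', hYnull, hUVpos, ae_atomProb_pos (m := m) hp hP,
      ae_atomProb_pos (m := m) (hp.comp hT.measurable) hP] with x hx hYx ⟨hp1, hp2, hp3, hp4⟩ hu hv
    intro s₀ s s' hs hs' hinc
    have hB : MeasurableSet (Metric.closedBall (y x) (ρ s)) := Metric.isClosed_closedBall.measurableSet
    have h1 := hx (P x) _ hB
    rw [← hpφ x] at h1
    have hune : atomProb m p P x ≠ ∞ := atomProb_ne_top x
    have hvne : atomProb m (p ∘ T) P x ≠ ∞ := atomProb_ne_top x
    have h2 : Ui s₀ x * η (p x) (Metric.closedBall (y x) (ρ s)) ≤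
        ∫⁻ y' in Metric.closedBall (y x) (ρ s), U (P x) (p x, y') ∂η (p x) := by
      rw [setLIntegral_eq_ballAvg_mul η (U (P x)) (ρ s) (p x, y x)]
      gcongr
      exact (iInf_le _ (s - s₀)).trans_eq (by rw [Nat.sub_add_cancel hs])
    -- The part of the preimage inside `Y` lies in the ball about `y (T x)`, and the part outside is
    -- a null set of the fibre.
    have h3 : ∫⁻ y' in χ (P x) ⁻¹' Metric.closedBall (y x) (ρ s), V (P x) (p (T x), y')
        ∂η (p (T x)) ≤ Vs s₀ x * η (p (T x)) (Metric.closedBall (y (T x)) (ρ s')) := by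
      calc _ ≤ ∫⁻ y' in Metric.closedBall (y (T x)) (ρ s') ∪ Yᶜ, V (P x) (p (T x), y')
            ∂η (p (T x)) := by
            refine lintegral_mono_set fun y' hy' => ?_
            by_cases hyY' : y' ∈ Y
            · exact Or.inl (hinc y' hyY' hy')
            · exact Or.inr hyY'
        _ ≤ ∫⁻ y' in Metric.closedBall (y (T x)) (ρ s'), V (P x) (p (T x), y') ∂η (p (T x)) +
            ∫⁻ y' in Yᶜ, V (P x) (p (T x), y') ∂η (p (T x)) := lintegral_union_le _ _ _
        _ = ∫⁻ y' in Metric.closedBall (y (T x)) (ρ s'), V (P x) (p (T x), y') ∂η (p (T x)) := by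
            rw [Measure.restrict_eq_zero.2 hYx, lintegral_zero_measure, add_zero]
        _ ≤ _ := by
            rw [setLIntegral_eq_ballAvg_mul η (V (P x)) (ρ s') (p (T x), y (T x))]
            gcongr
            exact le_trans (le_of_eq (by rw [Nat.sub_add_cancel hs']))
              (le_iSup (fun i => ballAvg η (V (P x)) (ρ (i + s₀)) (py (T x))) (s' - s₀))
    have h4 : (atomProb m (p ∘ T) P x * Ui s₀ x) * η (p x) (Metric.closedBall (y x) (ρ s)) ≤
        (atomProb m p P x * Vs s₀ x) * η (p (T x)) (Metric.closedBall (y (T x)) (ρ s')) := by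
      rw [mul_assoc, mul_assoc]
      calc _ ≤ atomProb m (p ∘ T) P x * _ := by gcongr
        _ = atomProb m p P x * _ := h1
        _ ≤ _ := by gcongr
    have hUne : Ui s₀ x ≠ ∞ := ((hUi1 s₀ x).trans_lt ENNReal.one_lt_top).ne
    have hVne : Vs s₀ x ≠ ∞ := ((hVs1 s₀ x).trans_lt ENNReal.one_lt_top).ne
    have hu' : 0 < (atomProb m p P x).toReal := ENNReal.toReal_pos hu.ne' hune
    have hv' : 0 < (atomProb m (p ∘ T) P x).toReal := ENNReal.toReal_pos hv.ne' hvne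
    have hexp : Real.exp (projInfo m T P p x - projInfo m T P py x + err s₀ x) =
        (atomProb m p P x).toReal * (Vs s₀ x).toReal /
          ((atomProb m (p ∘ T) P x).toReal * (Ui s₀ x).toReal) := by
      have : projInfo m T P p x - projInfo m T P py x + err s₀ x =
          (Real.log (atomProb m p P x).toReal + Real.log (Vs s₀ x).toReal) -
          (Real.log (atomProb m (p ∘ T) P x).toReal + Real.log (Ui s₀ x).toReal) := by
        simp only [projInfo, atomInfo, err]
        ring
      rw [this, Real.exp_sub, Real.exp_add, Real.exp_add, Real.exp_log hu', Real.exp_log (hp2 s₀),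
        Real.exp_log hv', Real.exp_log (hp1 s₀)]
    rw [hexp, ENNReal.ofReal_div_of_pos (mul_pos hv' (hp1 s₀)), ENNReal.ofReal_mul hu'.le,
      ENNReal.ofReal_mul hv'.le, ENNReal.ofReal_toReal hune, ENNReal.ofReal_toReal hVne,
      ENNReal.ofReal_toReal hvne, ENNReal.ofReal_toReal hUne, div_eq_mul_inv]
    have hne0 : atomProb m (p ∘ T) P x * Ui s₀ x ≠ 0 :=
      mul_ne_zero hv.ne' (fun h => by have := hp1 s₀; simp [h] at this)
    have hnet : atomProb m (p ∘ T) P x * Ui s₀ x ≠ ∞ := ENNReal.mul_ne_top hvne hUne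
    calc _ = (atomProb m (p ∘ T) P x * Ui s₀ x)⁻¹ * ((atomProb m (p ∘ T) P x * Ui s₀ x) *
          η (p x) (Metric.closedBall (y x) (ρ s))) := by
          rw [← mul_assoc, ENNReal.inv_mul_cancel hne0 hnet, one_mul]
      _ ≤ (atomProb m (p ∘ T) P x * Ui s₀ x)⁻¹ * ((atomProb m p P x * Vs s₀ x) *
          η (p (T x)) (Metric.closedBall (y (T x)) (ρ s'))) := by gcongr
      _ = _ := by ring

end Telescope

/-! ### The information of words -/

section WordInfo

variable {Ω F A B : Type*} [mΩ : MeasurableSpace Ω] [mF : MeasurableSpace F]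
variable {m : Measure Ω} [IsProbabilityMeasure m] {T : Ω → Ω}
variable [Fintype A] [MeasurableSpace A] [MeasurableSingletonClass A]
variable [Fintype B] [MeasurableSpace B] [MeasurableSingletonClass B]

/-- If `p` and `p'` determine each other given `P`, then `m(Q | p) / m(P | p)` and
`m(Q | p') / m(P | p')` agree for all refinements `Q` of `P`. -/
theorem ae_atomProb_mul_comm {p p' : Ω → F} {P : Ω → A} {Q : Ω → B} {f : B → A}
    (hp : Measurable p) (hp' : Measurable p') (hP : Measurable P) (hQ : Measurable Q)
    (hf : ∀ x, P x = f (Q x)) {φ ψ : A → F → F}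
    (hφ : ∀ a, Measurable (φ a)) (hψ : ∀ a, Measurable (ψ a))
    (hpφ : ∀ x, p x = φ (P x) (p' x)) (hpψ : ∀ x, p' x = ψ (P x) (p x)) :
    ∀ᵐ x ∂m, atomProb m p Q x * atomProb m p' P x = atomProb m p' Q x * atomProb m p P x := by
  -- Dividing by the probabilities of `P`, both sides express `m(Q | P, p) = m(Q | P, p')`: on an
  -- atom of `P` the maps `p` and `p'` are functions of each other. Weak form: either side is tested
  -- against `k` by trading densities for restrictions to atoms.
  have key : ∀ b, ∀ᵐ z ∂(m.map p),
      atomDensity m p Q b z * atomDensity m p' P (f b) (ψ (f b) z) =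
        atomDensity m p' Q b (ψ (f b) z) * atomDensity m p P (f b) z := by
    intro b
    set a := f b
    have hQb : MeasurableSet (Q ⁻¹' {b}) := hQ (measurableSet_singleton b)
    have hPa : MeasurableSet (P ⁻¹' {a}) := hP (measurableSet_singleton a)
    have m1 : Measurable (atomDensity m p Q b) := measurable_atomDensity b
    have m2 : Measurable (atomDensity m p' Q b) := measurable_atomDensity b
    have m3 : Measurable (atomDensity m p P a) := measurable_atomDensity a
    have m4 : Measurable (atomDensity m p' P a) := measurable_atomDensity a
    have n4 : Measurable fun z => atomDensity m p' P a (ψ a z) := m4.comp (hψ a)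
    have n2 : Measurable fun z => atomDensity m p' Q b (ψ a z) := m2.comp (hψ a)
    have hPQ : ∀ x, x ∈ Q ⁻¹' {b} → P x = a := fun x hx => by
      rw [hf x, show Q x = b from hx]
    refine ae_eq_of_forall_setLIntegral_eq_of_sigmaFinite (m1.mul n4) (n2.mul m3) fun s hs _ => ?_
    let k : F → ℝ≥0∞ := s.indicator 1
    have hk : Measurable k := measurable_one.indicator hs
    have hind : ∀ g : F → ℝ≥0∞, Measurable g →
        ∫⁻ z in s, g z ∂(m.map p) = ∫⁻ x, k (p x) * g (p x) ∂m := by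
      intro g hg
      rw [← lintegral_indicator hs, lintegral_map (hg.indicator hs) hp]
      refine lintegral_congr fun x => ?_
      by_cases h : p x ∈ s
      · simp [k, h]
      · simp [k, h]
    refine (hind _ (m1.mul n4)).trans (Eq.trans ?_ (hind _ (n2.mul m3)).symm)
    simp only [Pi.mul_apply]
    calc ∫⁻ x, k (p x) * (atomDensity m p Q b (p x) * atomDensity m p' P a (ψ a (p x))) ∂m
        = ∫⁻ x, (k (p x) * atomDensity m p' P a (ψ a (p x))) * atomDensity m p Q b (p x) ∂m := by
          refine lintegral_congr fun x => ?_
          ring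
      _ = ∫⁻ x in Q ⁻¹' {b}, k (p x) * atomDensity m p' P a (ψ a (p x)) ∂m :=
          (setLIntegral_comp_atom hp b (hk.mul n4)).symm
      _ = ∫⁻ x in Q ⁻¹' {b}, k (φ a (p' x)) * atomDensity m p' P a (p' x) ∂m := by
          refine setLIntegral_congr_fun hQb fun x hx => ?_
          have := hPQ x hx
          rw [← this, ← hpφ x, ← hpψ x]
      _ = ∫⁻ x, (k (φ a (p' x)) * atomDensity m p' P a (p' x)) * atomDensity m p' Q b (p' x) ∂m :=
          setLIntegral_comp_atom hp' b ((hk.comp (hφ a)).mul m4)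
      _ = ∫⁻ x, (k (φ a (p' x)) * atomDensity m p' Q b (p' x)) * atomDensity m p' P a (p' x) ∂m := by
          refine lintegral_congr fun x => ?_
          ring
      _ = ∫⁻ x in P ⁻¹' {a}, k (φ a (p' x)) * atomDensity m p' Q b (p' x) ∂m :=
          (setLIntegral_comp_atom hp' a ((hk.comp (hφ a)).mul m2)).symm
      _ = ∫⁻ x in P ⁻¹' {a}, k (p x) * atomDensity m p' Q b (ψ a (p x)) ∂m := by
          refine setLIntegral_congr_fun hPa fun x hx => ?_
          have hx' : P x = a := hx
          rw [← hx', ← hpφ x, ← hpψ x]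
      _ = ∫⁻ x, (k (p x) * atomDensity m p' Q b (ψ a (p x))) * atomDensity m p P a (p x) ∂m :=
          setLIntegral_comp_atom hp a (hk.mul n2)
      _ = _ := by
          refine lintegral_congr fun x => ?_
          ring
  filter_upwards [ae_of_ae_map hp.aemeasurable (ae_all_iff.2 key)] with x hx
  have := hx (Q x)
  rw [← hf x, ← hpψ x] at this
  exact this

theorem atomProb_comp (hT : MeasurePreserving T m m) {p : Ω → F} {P : Ω → A}
    (hp : Measurable p) (hP : Measurable P) (x : Ω) :
    atomProb m (p ∘ T) (P ∘ T) x = atomProb m p P (T x) := by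
  have h1 : m.map (p ∘ T) = m.map p := by
    rw [← Measure.map_map hp hT.measurable, hT.map_eq]
  have h2 : ∀ a, (m.restrict ((P ∘ T) ⁻¹' {a})).map (p ∘ T) = (m.restrict (P ⁻¹' {a})).map p := by
    intro a
    rw [← Measure.map_map hp hT.measurable, Set.preimage_comp,
      (hT.restrict_preimage (hP (measurableSet_singleton a))).map_eq]
  simp only [atomProb, atomDensity, h1, h2, Function.comp_apply]

/-- The maps `φ_{w₁} ∘ ⋯ ∘ φ_{wₙ}`. -/
def wordComp {A : Type*} {F : Type*} (φ : A → F → F) : (n : ℕ) → (Fin n → A) → F → F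
  | 0 => fun _ => id
  | n + 1 => fun w => φ (w 0) ∘ wordComp φ n (Fin.tail w)

/-- The maps `ψ_{wₙ} ∘ ⋯ ∘ ψ_{w₁}`. -/
def wordCompRev {A : Type*} {F : Type*} (ψ : A → F → F) : (n : ℕ) → (Fin n → A) → F → F
  | 0 => fun _ => id
  | n + 1 => fun w => wordCompRev ψ n (Fin.tail w) ∘ ψ (w 0)

theorem measurable_wordComp {φ : A → F → F} (hφ : ∀ a, Measurable (φ a)) (n : ℕ)
    (w : Fin n → A) : Measurable (wordComp φ n w) := by
  induction n with
  | zero => exact measurable_id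
  | succ n ih => exact (hφ _).comp (ih _)

theorem measurable_wordCompRev {ψ : A → F → F} (hψ : ∀ a, Measurable (ψ a)) (n : ℕ)
    (w : Fin n → A) : Measurable (wordCompRev ψ n w) := by
  induction n with
  | zero => exact measurable_id
  | succ n ih => exact (ih _).comp (hψ _)

theorem eq_wordComp {p : Ω → F} {P : Ω → A} {φ : A → F → F}
    (hpφ : ∀ x, p x = φ (P x) (p (T x))) (n : ℕ) (x : Ω) :
    p x = wordComp φ n (itinerary T P n x) (p (T^[n] x)) := by
  induction n generalizing x with
  | zero => rfl
  | succ n ih =>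
    rw [itinerary_succ]
    simp only [wordComp, Fin.cons_zero, Fin.tail_cons, Function.comp_apply, Function.iterate_succ]
    rw [← ih (T x)]
    exact hpφ x

theorem eq_wordCompRev {p : Ω → F} {P : Ω → A} {ψ : A → F → F}
    (hpψ : ∀ x, p (T x) = ψ (P x) (p x)) (n : ℕ) (x : Ω) :
    p (T^[n] x) = wordCompRev ψ n (itinerary T P n x) (p x) := by
  induction n generalizing x with
  | zero => rfl
  | succ n ih =>
    rw [itinerary_succ]
    simp only [wordCompRev, Fin.cons_zero, Fin.tail_cons, Function.comp_apply,
      Function.iterate_succ]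
    rw [ih (T x), hpψ x]

/-- The information gained along a word is the sum of the information gained at each symbol. -/
theorem ae_projInfo_itinerary (hT : MeasurePreserving T m m) {p : Ω → F} {P : Ω → A}
    (hp : Measurable p) (hP : Measurable P) {φ ψ : A → F → F}
    (hφ : ∀ a, Measurable (φ a)) (hψ : ∀ a, Measurable (ψ a))
    (hpφ : ∀ x, p x = φ (P x) (p (T x))) (hpψ : ∀ x, p (T x) = ψ (P x) (p x)) (n : ℕ) :
    ∀ᵐ x ∂m, projInfo m T^[n] (itinerary T P n) p x = birkhoffSum T (projInfo m T P p) n x := by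
  induction n with
  | zero =>
    refine Eventually.of_forall fun x => ?_
    simp [projInfo, birkhoffSum]
  | succ n ih =>
    have hin := measurable_itinerary hT.measurable hP n
    have hin1 := measurable_itinerary hT.measurable hP (n + 1)
    have hTn : Measurable T^[n] := hT.measurable.iterate n
    have hpT : Measurable (p ∘ T) := hp.comp hT.measurable
    have hpTn : Measurable (p ∘ T^[n]) := hp.comp hTn
    have hpTn1 : Measurable (p ∘ T^[n + 1]) := hp.comp (hT.measurable.iterate (n + 1))
    -- `hA` compares `p` with `p ∘ T`, which determine each other given the first symbol; `hB`
    -- compares `p ∘ T` with `p ∘ T^{n+1}`, given the remaining `n` symbols. The probability of the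
    -- whole word given `p ∘ T` occurs in both and cancels.
    have hA := ae_atomProb_mul_comm (m := m) (p := p) (p' := p ∘ T) (P := P)
      (Q := itinerary T P (n + 1)) (f := fun w => w 0) hp hpT hP hin1
      (fun x => by simp [itinerary]) hφ hψ hpφ hpψ
    have hB := ae_atomProb_mul_comm (m := m) (p := p ∘ T) (p' := p ∘ T^[n + 1])
      (P := itinerary T P n ∘ T) (Q := itinerary T P (n + 1)) (f := fun w => Fin.tail w) hpT hpTn1
      (hin.comp hT.measurable) hin1 (fun x => by rw [itinerary_succ]; simp)
      (measurable_wordComp hφ n) (measurable_wordCompRev hψ n)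
      (fun x => eq_wordComp hpφ n (T x)) (fun x => eq_wordCompRev hpψ n (T x))
    have c1 : ∀ x, atomProb m (p ∘ T) (itinerary T P n ∘ T) x =
        atomProb m p (itinerary T P n) (T x) := atomProb_comp hT hp hin
    have c2 : ∀ x, atomProb m (p ∘ T^[n + 1]) (itinerary T P n ∘ T) x =
        atomProb m (p ∘ T^[n]) (itinerary T P n) (T x) := by
      rw [Function.iterate_succ, ← Function.comp_assoc]
      exact atomProb_comp hT hpTn hin
    simp_rw [c1, c2] at hB
    filter_upwards [hA, hB, hT.quasiMeasurePreserving.ae ih,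
      ae_atomProb_pos (m := m) hp hP, ae_atomProb_pos (m := m) hpT hP,
      ae_atomProb_pos (m := m) hp hin1, ae_atomProb_pos (m := m) hpT hin1,
      ae_atomProb_pos (m := m) hpTn1 hin1,
      hT.quasiMeasurePreserving.ae (ae_atomProb_pos (m := m) hp hin),
      hT.quasiMeasurePreserving.ae (ae_atomProb_pos (m := m) hpTn hin)]
      with x hA hB ih h1 h2 h3 h4 h5 h6 h7
    rw [birkhoffSum_succ', ← ih]
    have pos : ∀ {t : ℝ≥0∞}, 0 < t → t ≤ 1 → t.toReal ≠ 0 := fun h h' =>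
      (ENNReal.toReal_pos h.ne' (h'.trans_lt ENNReal.one_lt_top).ne).ne'
    have hA' := congrArg (fun t => Real.log t.toReal) hA
    have hB' := congrArg (fun t => Real.log t.toReal) hB
    simp only [ENNReal.toReal_mul] at hA' hB'
    rw [Real.log_mul (pos h3 (atomProb_le_one _)) (pos h2 (atomProb_le_one _)),
      Real.log_mul (pos h4 (atomProb_le_one _)) (pos h1 (atomProb_le_one _))] at hA'
    rw [Real.log_mul (pos h4 (atomProb_le_one _)) (pos h7 (atomProb_le_one _)),
      Real.log_mul (pos h5 (atomProb_le_one _)) (pos h6 (atomProb_le_one _))] at hB'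
    simp only [projInfo, atomInfo]
    linarith

end WordInfo

/-! ### Coding maps -/

section Coding

theorem continuous_shift (ℓ : ℕ) : Continuous (shift ℓ) :=
  continuous_pi fun n => continuous_apply (n + 1)

theorem shift_iterate_apply {ℓ : ℕ} (x : ShiftSpace ℓ) (n k : ℕ) :
    (shift ℓ)^[n] x k = x (k + n) := by
  induction n generalizing x with
  | zero => rfl
  | succ n ih => rw [Function.iterate_succ_apply, ih]; simp only [shift]; congr 1

variable {ℓ : ℕ} {E : Type*} [NormedAddCommGroup E]

theorem wordMap_succ' (S : Fin ℓ → E → E) (x : ShiftSpace ℓ) (n : ℕ) :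
    wordMap S x (n + 1) = S (x 0) ∘ wordMap S (shift ℓ x) n := by
  induction n with
  | zero => rfl
  | succ n ih =>
    rw [wordMap, ih]
    rfl

theorem wordMap_add (S : Fin ℓ → E → E) (x : ShiftSpace ℓ) (n k : ℕ) :
    wordMap S x (n + k) = wordMap S x n ∘ wordMap S ((shift ℓ)^[n] x) k := by
  induction n generalizing x with
  | zero => simp [wordMap]
  | succ n ih =>
    rw [show n + 1 + k = (n + k) + 1 by omega, wordMap_succ', ih, wordMap_succ' S x n]
    rfl

theorem wordMap_congr (S : Fin ℓ → E → E) {x x' : ShiftSpace ℓ} {n : ℕ}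
    (h : ∀ i < n, x i = x' i) : wordMap S x n = wordMap S x' n := by
  induction n with
  | zero => rfl
  | succ n ih => rw [wordMap, wordMap, ih fun i hi => h i (by omega), h n (by omega)]

/-- A system of contractions of a nonempty compact set into itself. -/
structure IsContractive (X : Set E) (S : Fin ℓ → E → E) (c : ℝ≥0) : Prop where
  isCompact : IsCompact X
  nonempty : X.Nonempty
  mapsTo : ∀ i, Set.MapsTo (S i) X X
  lt_one : c < 1
  lipschitz : ∀ i, LipschitzOnWith c (S i) X

variable {X : Set E} {S : Fin ℓ → E → E} {c : ℝ≥0}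

theorem IsContractive.isAttractor_attractor (h : IsContractive X S c) (x : ShiftSpace ℓ) :
    IsAttractor X S (attractor X S) := by
  have : NeZero ℓ := ⟨fun h => (h ▸ x 0 : Fin 0).elim0⟩
  exact Classical.epsilon_spec (exists_isAttractor h.isCompact h.nonempty h.mapsTo h.lipschitz)

theorem IsContractive.iInter_image (h : IsContractive X S c) (x : ShiftSpace ℓ) :
    (⋂ n : ℕ, wordMap S x (n + 1) '' attractor X S) = {codingMap X S x} :=
  iInter_wordMap_image_attractor h.isCompact h.nonempty h.mapsTo h.lt_one h.lipschitz x

theorem IsContractive.codingMap_mem_attractor (h : IsContractive X S c) (x : ShiftSpace ℓ) :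
    codingMap X S x ∈ attractor X S := by
  have h1 : codingMap X S x ∈ ⋂ n : ℕ, wordMap S x (n + 1) '' attractor X S := by
    rw [h.iInter_image x]; rfl
  have h2 := Set.mem_iInter.1 h1 0
  have hK := h.isAttractor_attractor x
  rw [hK.2.2.2]
  obtain ⟨z, hz, e⟩ := h2
  exact Set.mem_iUnion.2 ⟨x 0, z, hz, e⟩

theorem IsContractive.codingMap_mem (h : IsContractive X S c) (x : ShiftSpace ℓ) :
    codingMap X S x ∈ X := (h.isAttractor_attractor x).1 (h.codingMap_mem_attractor x)

theorem IsContractive.codingMap_eq (h : IsContractive X S c) (x : ShiftSpace ℓ) :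
    codingMap X S x = S (x 0) (codingMap X S (shift ℓ x)) := by
  have h1 : S (x 0) (codingMap X S (shift ℓ x)) ∈
      ⋂ n : ℕ, wordMap S x (n + 1) '' attractor X S := by
    refine Set.mem_iInter.2 fun n => ?_
    rcases n with _ | n
    · exact ⟨_, h.codingMap_mem_attractor _, rfl⟩
    · have h2 : codingMap X S (shift ℓ x) ∈
          ⋂ n : ℕ, wordMap S (shift ℓ x) (n + 1) '' attractor X S := by
        rw [h.iInter_image]; rfl
      obtain ⟨z, hz, e⟩ := Set.mem_iInter.1 h2 n
      refine ⟨z, hz, ?_⟩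
      rw [wordMap_succ', Function.comp_apply, e]
  rw [h.iInter_image x] at h1
  exact h1.symm

theorem IsContractive.wordMap_codingMap (h : IsContractive X S c) (x : ShiftSpace ℓ) (n : ℕ) :
    wordMap S x n (codingMap X S ((shift ℓ)^[n] x)) = codingMap X S x := by
  induction n with
  | zero => rfl
  | succ n ih =>
    rw [wordMap, Function.comp_apply, Function.iterate_succ_apply', ← ih]
    congr 1
    rw [h.codingMap_eq ((shift ℓ)^[n] x), shift_iterate_apply]
    simp

/-- The equation `p x = S (x 0) (p (σ x))` is contracting. This one estimate gives both the
uniqueness of its solution, which identifies the coding map of a product, and the continuity of the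
coding map. -/
theorem IsContractive.dist_le (h : IsContractive X S c) {p p' : ShiftSpace ℓ → E}
    (hp : ∀ x, p x ∈ X) (hp' : ∀ x, p' x ∈ X)
    (ep : ∀ x, p x = S (x 0) (p (shift ℓ x))) (ep' : ∀ x, p' x = S (x 0) (p' (shift ℓ x)))
    (n : ℕ) {x x' : ShiftSpace ℓ} (hx : ∀ i < n, x i = x' i) :
    dist (p x) (p' x') ≤ c ^ n * Metric.diam X := by
  induction n generalizing x x' with
  | zero => simpa using Metric.dist_le_diam_of_mem h.isCompact.isBounded (hp x) (hp' x')
  | succ n ih =>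
    rw [ep, ep', hx 0 (by omega)]
    refine ((h.lipschitz _).dist_le_mul _ (hp _) _ (hp' _)).trans ?_
    rw [pow_succ', mul_assoc]
    gcongr
    exact ih fun i hi => hx (i + 1) (by omega)

theorem IsContractive.tendsto_pow_mul (h : IsContractive X S c) (D : ℝ) :
    Tendsto (fun n : ℕ => (c : ℝ) ^ n * D) atTop (𝓝 0) := by
  simpa using (tendsto_pow_atTop_nhds_zero_of_lt_one c.2
    (by exact_mod_cast h.lt_one)).mul_const D

theorem IsContractive.eq_codingMap (h : IsContractive X S c) {p : ShiftSpace ℓ → E}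
    (hp : ∀ x, p x ∈ X) (ep : ∀ x, p x = S (x 0) (p (shift ℓ x))) : codingMap X S = p := by
  funext x
  refine dist_le_zero.1 (ge_of_tendsto' (h.tendsto_pow_mul (Metric.diam X)) fun n => ?_)
  exact h.dist_le h.codingMap_mem hp h.codingMap_eq ep n fun _ _ => rfl

theorem IsContractive.continuous_codingMap (h : IsContractive X S c) :
    Continuous (codingMap X S) := by
  rw [continuous_iff_continuousAt]
  intro x
  rw [Metric.continuousAt_iff']
  intro ε hε
  obtain ⟨n, hn⟩ := ((h.tendsto_pow_mul (Metric.diam X)).eventually_lt_const hε).exists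
  have hev : ∀ᶠ x' in 𝓝 x, ∀ i < n, x' i = x i := by
    have : ∀ᶠ x' in 𝓝 x, ∀ i ∈ Finset.range n, x' i = x i := by
      rw [Finset.eventually_all]
      intro i _
      have ho : IsOpen {x' : ShiftSpace ℓ | x' i = x i} :=
        (isOpen_discrete {x i}).preimage
          (continuous_apply i : Continuous fun x' : ShiftSpace ℓ => x' i)
      exact ho.mem_nhds rfl
    filter_upwards [this] with x' hx' i hi
    exact hx' i (Finset.mem_range.2 hi)
  filter_upwards [hev] with x' hx'
  exact (h.dist_le h.codingMap_mem h.codingMap_mem h.codingMap_eq h.codingMap_eq n hx').trans_lt hn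

theorem IsContractive.lipschitzOn_wordMap (h : IsContractive X S c) (x : ShiftSpace ℓ) (n : ℕ) :
    LipschitzOnWith (c ^ n) (wordMap S x n) X ∧ Set.MapsTo (wordMap S x n) X X :=
  wordMap_lipschitzOn h.mapsTo h.lipschitz x n

/-! ### Coding maps of direct products. -/

section ProductCoding

variable {ι : Type*} [Fintype ι] {E : ι → Type*} [∀ a, NormedAddCommGroup (E a)]

theorem IsContractive.prod {X : ∀ a, Set (E a)} {S : ∀ a, Fin ℓ → E a → E a} {c : ℝ≥0}
    (hc : c < 1) (h : ∀ a, IsContractive (X a) (S a) c) :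
    IsContractive (prodSet X) (prodMaps S) c where
  isCompact := by
    have h1 : IsCompact (Set.univ.pi X) := isCompact_univ_pi fun a => (h a).isCompact
    have h2 : prodSet X = (WithLp.toLp 2) '' (Set.univ.pi X) := by
      ext z
      constructor
      · intro hz
        exact ⟨z.ofLp, fun a _ => hz a, rfl⟩
      · rintro ⟨z, hz, rfl⟩ a
        exact hz a trivial
    rw [h2]
    exact h1.image (PiLp.continuous_toLp 2 E)
  nonempty := by
    choose z hz using fun a => (h a).nonempty
    exact ⟨WithLp.toLp 2 z, hz⟩
  mapsTo := fun i z hz a => (h a).mapsTo i (hz a)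
  lt_one := hc
  lipschitz := fun i => by
    refine LipschitzOnWith.of_dist_le_mul fun z hz w hw => ?_
    rw [PiLp.dist_eq_of_L2, PiLp.dist_eq_of_L2]
    refine Real.sqrt_le_iff.2 ⟨by positivity, ?_⟩
    rw [mul_pow, Real.sq_sqrt (Finset.sum_nonneg fun a _ => sq_nonneg _), Finset.mul_sum]
    refine Finset.sum_le_sum fun a _ => ?_
    rw [← mul_pow]
    exact pow_le_pow_left₀ dist_nonneg
      (((h a).lipschitz i).dist_le_mul _ (hz a) _ (hw a)) 2

theorem codingMap_prod {X : ∀ a, Set (E a)} {S : ∀ a, Fin ℓ → E a → E a} {c : ℝ≥0}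
    (hc : c < 1) (h : ∀ a, IsContractive (X a) (S a) c) (x : ShiftSpace ℓ) :
    codingMap (prodSet X) (prodMaps S) x = WithLp.toLp 2 fun a => codingMap (X a) (S a) x := by
  refine congrFun ((IsContractive.prod hc h).eq_codingMap
    (p := fun x => WithLp.toLp 2 fun a => codingMap (X a) (S a) x)
    (fun x a => (h a).codingMap_mem x) fun x => ?_) x
  ext a
  exact (h a).codingMap_eq x

end ProductCoding

/-- A continuous map on a compact set, extended by zero, is measurable. -/
theorem measurable_indicator_of_continuousOn [MeasurableSpace E] [BorelSpace E] {X : Set E}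
    (hX : IsCompact X) {f : E → E} (hf : ContinuousOn f X) : Measurable (X.indicator f) := by
  classical
  have := hf.measurable_piecewise (g := 0) continuousOn_const hX.isClosed.measurableSet
  rwa [Set.piecewise_eq_indicator] at this

/-- An injective continuous map on a compact set is a closed embedding. The left inverse expresses
the coding of the shifted point through the first symbol and the coding of the point. -/
theorem exists_measurable_leftInverse [MeasurableSpace E] [BorelSpace E] {X : Set E}
    (hX : IsCompact X) {f : E → E} (hf : ContinuousOn f X) (hinj : Set.InjOn f X) :
    ∃ g : E → E, Measurable g ∧ ∀ z ∈ X, g (f z) = z := by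
  have hc : CompactSpace X := isCompact_iff_compactSpace.1 hX
  have hemb : IsClosedEmbedding (X.domRestrict f) :=
    IsClosedEmbedding.of_continuous_injective_isClosedMap (continuousOn_iff_continuous_domRestrict.1 hf)
      (Set.injOn_iff_injective.1 hinj)
      (continuousOn_iff_continuous_domRestrict.1 hf).isClosedMap
  obtain ⟨g, hg, hgf⟩ := hemb.measurableEmbedding.exists_measurable_extend
    (measurable_subtype_coe : Measurable (Subtype.val : X → E)) (fun _ => ⟨0⟩)
  exact ⟨g, hg, fun z hz => congrFun hgf ⟨z, hz⟩⟩

end Coding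

/-! ### Smallest singular values -/

section SingularValue

variable {E : Type*} [NormedAddCommGroup E] [NormedSpace ℝ E]

theorem bddBelow_range_norm_sphere (M : E →L[ℝ] E) :
    BddBelow (Set.range fun v : Metric.sphere (0 : E) 1 => ‖M v‖) :=
  ⟨0, by rintro _ ⟨v, rfl⟩; exact norm_nonneg _⟩

theorem smallestSingularValue_nonneg (M : E →L[ℝ] E) : 0 ≤ smallestSingularValue M :=
  Real.iInf_nonneg fun _ => norm_nonneg _

theorem smallestSingularValue_mul_norm_le (M : E →L[ℝ] E) (v : E) :
    smallestSingularValue M * ‖v‖ ≤ ‖M v‖ := by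
  rcases eq_or_ne v 0 with rfl | hv
  · simp
  have hv' : 0 < ‖v‖ := norm_pos_iff.2 hv
  have h1 : ‖v‖⁻¹ • v ∈ Metric.sphere (0 : E) 1 := by
    rw [mem_sphere_zero_iff_norm, norm_smul, norm_inv, norm_norm, inv_mul_cancel₀ hv'.ne']
  have h2 := ciInf_le (bddBelow_range_norm_sphere M) ⟨_, h1⟩
  simp only [map_smul, norm_smul, norm_inv, norm_norm] at h2
  rw [inv_mul_eq_div, le_div_iff₀ hv'] at h2
  exact h2

variable [Nontrivial E]

theorem le_smallestSingularValue {M : E →L[ℝ] E} {a : ℝ} (h : ∀ v, a * ‖v‖ ≤ ‖M v‖) :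
    a ≤ smallestSingularValue M := by
  have : Nonempty (Metric.sphere (0 : E) 1) :=
    (NormedSpace.sphere_nonempty.2 zero_le_one).to_subtype
  refine le_ciInf fun v => ?_
  have := h v
  rwa [mem_sphere_zero_iff_norm.1 v.2, mul_one] at this

theorem smallestSingularValue_le_norm (M : E →L[ℝ] E) : smallestSingularValue M ≤ ‖M‖ := by
  obtain ⟨v, hv⟩ := exists_ne (0 : E)
  have hv' : 0 < ‖v‖ := norm_pos_iff.2 hv
  exact le_of_mul_le_mul_right ((smallestSingularValue_mul_norm_le M v).trans (M.le_opNorm v)) hv'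

theorem smallestSingularValue_comp_ge (A B : E →L[ℝ] E) :
    smallestSingularValue A * smallestSingularValue B ≤ smallestSingularValue (A.comp B) := by
  refine le_smallestSingularValue fun v => ?_
  rw [mul_assoc]
  exact (mul_le_mul_of_nonneg_left (smallestSingularValue_mul_norm_le B v)
    (smallestSingularValue_nonneg A)).trans (smallestSingularValue_mul_norm_le A (B v))

theorem smallestSingularValue_le_add (A B : E →L[ℝ] E) :
    smallestSingularValue A - ‖A - B‖ ≤ smallestSingularValue B := by
  refine le_smallestSingularValue fun v => ?_
  have h1 := smallestSingularValue_mul_norm_le A v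
  have h2 := (A - B).le_opNorm v
  have h3 : ‖A v‖ ≤ ‖(A - B) v‖ + ‖B v‖ := by
    have := norm_add_le ((A - B) v) (B v)
    simpa using this
  rw [sub_mul]
  linarith

theorem continuous_smallestSingularValue :
    Continuous (smallestSingularValue : (E →L[ℝ] E) → ℝ) := by
  refine (LipschitzWith.of_dist_le_mul (K := 1) fun A B => ?_).continuous
  rw [NNReal.coe_one, one_mul, Real.dist_eq, dist_eq_norm, abs_le]
  have h1 := smallestSingularValue_le_add A B
  have h2 := smallestSingularValue_le_add B A
  rw [norm_sub_rev] at h2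
  constructor <;> linarith

theorem smallestSingularValue_pos {M : E →L[ℝ] E} (h : M.IsInvertible) :
    0 < smallestSingularValue M := by
  obtain ⟨e, rfl⟩ := h
  obtain ⟨v, hv⟩ := exists_ne (0 : E)
  have hpos : 0 < ‖(e.symm : E →L[ℝ] E)‖ := by
    rw [norm_pos_iff]
    intro h0
    have h1 := congrArg (fun f : E →L[ℝ] E => f (e v)) h0
    simp at h1
    exact hv h1
  refine (inv_pos.2 hpos).trans_le (le_smallestSingularValue fun v => ?_)
  rw [inv_mul_le_iff₀ hpos]
  have := (e.symm : E →L[ℝ] E).le_opNorm (e v)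
  simpa using this

end SingularValue

/-! ### Smooth iterated function systems -/

section Smooth

variable {ℓ : ℕ} {E : Type*} [NormedAddCommGroup E] [NormedSpace ℝ E]

/-- A `C¹` iterated function system with domain `U` and contraction ratio `c`. -/
structure IsSmoothIFS (X U : Set E) (S : Fin ℓ → E → E) (c : ℝ≥0) : Prop
    extends IsContractive X S c where
  pos : 0 < c
  isOpen : IsOpen U
  subset : X ⊆ U
  mapsTo_domain : ∀ i, Set.MapsTo (S i) U U
  injOn : ∀ i, Set.InjOn (S i) U
  contDiffOn : ∀ i, ContDiffOn ℝ 1 (S i) U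
  isInvertible : ∀ i, ∀ z ∈ U, (fderiv ℝ (S i) z).IsInvertible
  lipschitz_domain : ∀ i, LipschitzOnWith c (S i) U

theorem IsC1IFS.exists_isSmoothIFS {X : Set E} {S : Fin ℓ → E → E} (h : IsC1IFS X S) :
    ∃ U c, IsSmoothIFS X U S c := by
  obtain ⟨hX, hne, hmaps, U, hU, hXU, hi⟩ := h
  choose h1 h2 h3 h4 c hc hlip using hi
  -- The bound `1/2` keeps the common ratio positive, so that its logarithm is meaningful and
  -- negative.
  have hle : ∀ i, c i ≤ max (1 / 2) (Finset.univ.sup c) := fun i =>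
    (Finset.le_sup (Finset.mem_univ i)).trans (le_max_right _ _)
  have hlip' : ∀ i, LipschitzOnWith (max (1 / 2) (Finset.univ.sup c)) (S i) U := fun i =>
    (hlip i).weaken (hle i)
  refine ⟨U, max (1 / 2) (Finset.univ.sup c), ⟨⟨hX, hne, hmaps, ?_, fun i => (hlip' i).mono hXU⟩,
    lt_max_of_lt_left (by norm_num), hU, hXU, h1, h2, h3, h4, hlip'⟩⟩
  refine max_lt ?_ ((Finset.sup_lt_iff (by simp)).2 fun i _ => hc i)
  rw [← NNReal.coe_lt_coe]
  norm_num

variable {X U : Set E} {S : Fin ℓ → E → E} {c : ℝ≥0}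

theorem IsSmoothIFS.codingMap_mem_domain (h : IsSmoothIFS X U S c) (x : ShiftSpace ℓ) :
    codingMap X S x ∈ U := h.subset (h.codingMap_mem x)

theorem IsSmoothIFS.wordMap_domain (h : IsSmoothIFS X U S c) (x : ShiftSpace ℓ) (n : ℕ) :
    Set.MapsTo (wordMap S x n) U U ∧ ContDiffOn ℝ 1 (wordMap S x n) U := by
  induction n with
  | zero => exact ⟨fun z hz => hz, contDiffOn_id⟩
  | succ n ih =>
    exact ⟨ih.1.comp (h.mapsTo_domain _), ih.2.comp (h.contDiffOn _) (h.mapsTo_domain _)⟩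

theorem IsSmoothIFS.differentiableAt_wordMap (h : IsSmoothIFS X U S c) (x : ShiftSpace ℓ) (n : ℕ)
    {u : E} (hu : u ∈ U) : DifferentiableAt ℝ (wordMap S x n) u :=
  ((h.wordMap_domain x n).2.differentiableOn one_ne_zero).differentiableAt (h.isOpen.mem_nhds hu)

theorem IsSmoothIFS.wordDeriv_zero (x : ShiftSpace ℓ) :
    wordDeriv X S x 0 = ContinuousLinearMap.id ℝ E := by
  simp only [wordDeriv, wordMap]
  exact fderiv_id

theorem IsSmoothIFS.wordDeriv_add (h : IsSmoothIFS X U S c) (x : ShiftSpace ℓ) (n k : ℕ) :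
    wordDeriv X S x (n + k) = (wordDeriv X S x n).comp (wordDeriv X S ((shift ℓ)^[n] x) k) := by
  have h1 : (shift ℓ)^[n + k] x = (shift ℓ)^[k] ((shift ℓ)^[n] x) := by
    rw [← Function.iterate_add_apply, add_comm]
  simp only [wordDeriv]
  rw [wordMap_add, h1, fderiv_comp]
  · rw [h.wordMap_codingMap]
  · exact h.differentiableAt_wordMap _ _
      ((h.wordMap_domain _ _).1 (h.codingMap_mem_domain _))
  · exact h.differentiableAt_wordMap _ _ (h.codingMap_mem_domain _)

theorem IsSmoothIFS.wordDeriv_one (x : ShiftSpace ℓ) :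
    wordDeriv X S x 1 = fderiv ℝ (S (x 0)) (codingMap X S (shift ℓ x)) := rfl

theorem IsSmoothIFS.continuous_wordDeriv (h : IsSmoothIFS X U S c) (n : ℕ) :
    Continuous fun x => wordDeriv X S x n := by
  have hone : Continuous fun x => wordDeriv X S x 1 := by
    have h1 : ∀ i : Fin ℓ, Continuous fun x => fderiv ℝ (S i) (codingMap X S (shift ℓ x)) := by
      intro i
      exact ((h.contDiffOn i).continuousOn_fderiv_of_isOpen h.isOpen le_rfl).comp_continuous
        (h.continuous_codingMap.comp (continuous_shift ℓ)) fun x => h.codingMap_mem_domain _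
    have h2 : Continuous fun p : Fin ℓ × ShiftSpace ℓ =>
        fderiv ℝ (S p.1) (codingMap X S (shift ℓ p.2)) :=
      continuous_prod_of_discrete_left.2 h1
    exact h2.comp ((continuous_apply (0 : ℕ) : Continuous fun x : ShiftSpace ℓ => x 0).prodMk
      continuous_id)
  induction n with
  | zero => simp only [IsSmoothIFS.wordDeriv_zero]; exact continuous_const
  | succ n ih =>
    simp only [h.wordDeriv_add _ n 1]
    exact ih.clm_comp (hone.comp ((continuous_shift ℓ).iterate n))

theorem IsSmoothIFS.norm_wordDeriv_one_le (h : IsSmoothIFS X U S c) (x : ShiftSpace ℓ) :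
    ‖wordDeriv X S x 1‖ ≤ c := by
  rw [IsSmoothIFS.wordDeriv_one]
  exact norm_fderiv_le_of_lipschitzOn ℝ (h.isOpen.mem_nhds (h.codingMap_mem_domain _))
    (h.lipschitz_domain _)

variable [Nontrivial E]

theorem IsSmoothIFS.exists_le_smallestSingularValue (h : IsSmoothIFS X U S c) :
    ∃ c₀ : ℝ, 0 < c₀ ∧ ∀ x, c₀ ≤ smallestSingularValue (wordDeriv X S x 1) := by
  have hf : ∀ i, ∃ a : ℝ, 0 < a ∧ ∀ z ∈ X, a ≤ smallestSingularValue (fderiv ℝ (S i) z) := by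
    intro i
    obtain ⟨z, hz, hmin⟩ := h.isCompact.exists_isMinOn h.nonempty
      (continuous_smallestSingularValue.comp_continuousOn
        (((h.contDiffOn i).continuousOn_fderiv_of_isOpen h.isOpen le_rfl).mono h.subset))
    exact ⟨_, smallestSingularValue_pos (h.isInvertible i z (h.subset hz)), fun w hw => hmin hw⟩
  choose a ha hle using hf
  rcases isEmpty_or_nonempty (Fin ℓ) with he | hne
  · exact ⟨1, one_pos, fun x => (he.false (x 0)).elim⟩
  · refine ⟨Finset.univ.inf' Finset.univ_nonempty a, ?_, fun x => ?_⟩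
    · exact (Finset.lt_inf'_iff _).2 fun i _ => ha i
    · exact (Finset.inf'_le a (Finset.mem_univ (x 0))).trans (hle _ _ (h.codingMap_mem _))

theorem IsSmoothIFS.norm_wordDeriv_le (h : IsSmoothIFS X U S c) (x : ShiftSpace ℓ) (n : ℕ) :
    ‖wordDeriv X S x n‖ ≤ (c : ℝ) ^ n := by
  induction n with
  | zero => rw [IsSmoothIFS.wordDeriv_zero]; simp
  | succ n ih =>
    rw [h.wordDeriv_add, pow_succ]
    exact (ContinuousLinearMap.opNorm_comp_le _ _).trans
      (mul_le_mul ih (h.norm_wordDeriv_one_le _) (norm_nonneg _) (by positivity))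

theorem IsSmoothIFS.le_smallestSingularValue_wordDeriv (h : IsSmoothIFS X U S c) {c₀ : ℝ}
    (hc₀ : 0 < c₀) (hle : ∀ x, c₀ ≤ smallestSingularValue (wordDeriv X S x 1))
    (x : ShiftSpace ℓ) (n : ℕ) : c₀ ^ n ≤ smallestSingularValue (wordDeriv X S x n) := by
  induction n with
  | zero =>
    rw [IsSmoothIFS.wordDeriv_zero]
    exact le_smallestSingularValue fun v => by simp
  | succ n ih =>
    rw [h.wordDeriv_add, pow_succ]
    exact (mul_le_mul ih (hle _) hc₀.le (smallestSingularValue_nonneg _)).trans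
      (smallestSingularValue_comp_ge _ _)

/-- Finitely many word maps of a given length exist, so local estimates for each of them become
uniform in `x`. -/
theorem finite_range_wordMap (S : Fin ℓ → E → E) (n : ℕ) :
    (Set.range fun x : ShiftSpace ℓ => wordMap S x n).Finite := by
  induction n with
  | zero =>
    refine (Set.finite_singleton id).subset ?_
    rintro _ ⟨x, rfl⟩
    rfl
  | succ n ih =>
    refine (Set.Finite.image2 (fun f g => f ∘ g) ih (Set.finite_range S)).subset ?_
    rintro _ ⟨x, rfl⟩
    exact ⟨_, ⟨x, rfl⟩, _, ⟨x n, rfl⟩, rfl⟩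

/-- Strict differentiability and continuity of the derivative give the bound near each point; a
Lebesgue number of the resulting cover of `X` makes the scale uniform. -/
theorem exists_uniform_fderiv_approx {X U : Set E} (hX : IsCompact X) (hU : IsOpen U)
    (hXU : X ⊆ U) {f : E → E} (hf : ContDiffOn ℝ 1 f U) {η : ℝ} (hη : 0 < η) :
    ∀ᶠ δ in 𝓝[>] (0 : ℝ), ∀ w ∈ X, ∀ u, dist u w ≤ δ →
      ‖f u - f w - fderiv ℝ f w (u - w)‖ ≤ η * ‖u - w‖ := by
  have hloc : ∀ z ∈ X, ∃ V, IsOpen V ∧ z ∈ V ∧ ∀ w ∈ V, ∀ u ∈ V,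
      ‖f u - f w - fderiv ℝ f w (u - w)‖ ≤ η * ‖u - w‖ := by
    intro z hz
    have hzU := hU.mem_nhds (hXU hz)
    have hs : HasStrictFDerivAt f (fderiv ℝ f z) z :=
      (hf.contDiffAt hzU).hasStrictFDerivAt one_ne_zero
    have h1 := (hasStrictFDerivAt_iff_isLittleO.1 hs).def (half_pos hη)
    have hcont : ContinuousAt (fderiv ℝ f) z :=
      (hf.continuousOn_fderiv_of_isOpen hU le_rfl).continuousAt hzU
    have h2 : ∀ᶠ w in 𝓝 z, ‖fderiv ℝ f w - fderiv ℝ f z‖ < η / 2 := by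
      have := (tendsto_iff_norm_sub_tendsto_zero.1 hcont).eventually_lt_const (half_pos hη)
      exact this
    rw [nhds_prod_eq] at h1
    obtain ⟨V1, hV1, hV1'⟩ := (Filter.HasBasis.prod_self (𝓝 z).basis_sets).eventually_iff.1 h1
    obtain ⟨V, hVs, hVo, hzV⟩ := mem_nhds_iff.1 (inter_mem hV1 h2)
    refine ⟨V, hVo, hzV, fun w hw u hu => ?_⟩
    have a1 := hV1' (x := (u, w)) ⟨(hVs hu).1, (hVs hw).1⟩
    have a2 : ‖(fderiv ℝ f w - fderiv ℝ f z) (u - w)‖ ≤ η / 2 * ‖u - w‖ :=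
      ((fderiv ℝ f w - fderiv ℝ f z).le_opNorm _).trans
        (mul_le_mul_of_nonneg_right (hVs hw).2.le (norm_nonneg _))
    have a3 : f u - f w - fderiv ℝ f w (u - w) =
        (f u - f w - fderiv ℝ f z (u - w)) - (fderiv ℝ f w - fderiv ℝ f z) (u - w) := by
      simp
    rw [a3]
    refine (norm_sub_le _ _).trans ?_
    simp only at a1
    linarith
  choose! V hVo hzV hV using hloc
  obtain ⟨δ, hδ, hleb⟩ := lebesgue_number_lemma_of_metric hX (c := fun z : X => V z)
    (fun z => hVo z z.2) (fun z hz => Set.mem_iUnion.2 ⟨⟨z, hz⟩, hzV z hz⟩)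
  filter_upwards [Ioo_mem_nhdsGT hδ] with δ' hδ' w hw u hu
  obtain ⟨z, hz⟩ := hleb w hw
  exact hV z z.2 w (hz (Metric.mem_ball_self hδ)) u (hz (hu.trans_lt hδ'.2))

theorem IsSmoothIFS.exists_wordMap_approx (h : IsSmoothIFS X U S c) (n : ℕ) {θ : ℝ} (hθ : 0 < θ) :
    ∃ δ > 0, ∀ x, ∀ u, dist u (codingMap X S ((shift ℓ)^[n] x)) ≤ δ →
      Real.exp (-θ) * smallestSingularValue (wordDeriv X S x n) *
          dist u (codingMap X S ((shift ℓ)^[n] x)) ≤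
        dist (wordMap S x n u) (codingMap X S x) ∧
      dist (wordMap S x n u) (codingMap X S x) ≤
        Real.exp θ * ‖wordDeriv X S x n‖ * dist u (codingMap X S ((shift ℓ)^[n] x)) := by
  obtain ⟨c₀, hc₀, hle⟩ := h.exists_le_smallestSingularValue
  have he : 0 < 1 - Real.exp (-θ) := by
    have : Real.exp (-θ) < 1 := Real.exp_zero ▸ Real.exp_lt_exp.2 (by linarith)
    linarith
  -- `c₀ ^ n` bounds the smallest singular values from below, so this error is at most the fraction
  -- `1 - e^{-θ}` of the smallest singular value, and also at most `e^θ - 1` times the norm.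
  have hη : 0 < (1 - Real.exp (-θ)) * c₀ ^ n := by positivity
  have hall := ((finite_range_wordMap S n).eventually_all (l := 𝓝[>] (0 : ℝ))
    (p := fun f δ => ∀ w ∈ X, ∀ u, dist u w ≤ δ →
      ‖f u - f w - fderiv ℝ f w (u - w)‖ ≤ (1 - Real.exp (-θ)) * c₀ ^ n * ‖u - w‖)).2 (by
    rintro _ ⟨x, rfl⟩
    exact exists_uniform_fderiv_approx h.isCompact h.isOpen h.subset (h.wordMap_domain x n).2 hη)
  obtain ⟨δ, hδ, hδ0⟩ := (hall.and self_mem_nhdsWithin).exists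
  refine ⟨δ, hδ0, fun x u hu => ?_⟩
  have h1 := hδ _ ⟨x, rfl⟩ _ (h.codingMap_mem ((shift ℓ)^[n] x)) u hu
  simp only [h.wordMap_codingMap] at h1
  change ‖wordMap S x n u - codingMap X S x - wordDeriv X S x n _‖ ≤ _ at h1
  set v := u - codingMap X S ((shift ℓ)^[n] x) with hv
  rw [dist_eq_norm, dist_eq_norm, ← hv]
  set w := wordMap S x n u - codingMap X S x
  have h2 := smallestSingularValue_mul_norm_le (wordDeriv X S x n) v
  have h3 := (wordDeriv X S x n).le_opNorm v
  have h4 := h.le_smallestSingularValue_wordDeriv hc₀ hle x n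
  have h5 := h4.trans (smallestSingularValue_le_norm _)
  have h6 : ‖wordDeriv X S x n v‖ ≤ ‖w‖ + ‖w - wordDeriv X S x n v‖ := by
    have := norm_sub_le w (w - wordDeriv X S x n v)
    simpa using this
  have h7 : ‖w‖ ≤ ‖wordDeriv X S x n v‖ + ‖w - wordDeriv X S x n v‖ := by
    have := norm_add_le (wordDeriv X S x n v) (w - wordDeriv X S x n v)
    simpa using this
  have h8 : (1 - Real.exp (-θ)) * c₀ ^ n * ‖v‖ ≤
      (1 - Real.exp (-θ)) * smallestSingularValue (wordDeriv X S x n) * ‖v‖ := by gcongr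
  have h9 : (1 - Real.exp (-θ)) * c₀ ^ n * ‖v‖ ≤ (Real.exp θ - 1) * ‖wordDeriv X S x n‖ * ‖v‖ := by
    have : 1 - Real.exp (-θ) ≤ Real.exp θ - 1 := by
      have h1 := Real.add_one_le_exp θ
      have h2 := Real.add_one_le_exp (-θ)
      linarith
    have h0 := Real.add_one_le_exp θ
    gcongr
    linarith
  constructor <;> linarith

end Smooth

/-! ### Birkhoff sums and invariant functions -/

section Birkhoff

/-- The constant absorbs the finitely many early times, so the bound holds for all `n` at once. -/
theorem exists_abs_birkhoffSum_sub_le {Ω : Type*} {T : Ω → Ω} {f : Ω → ℝ} {x : Ω} {g : ℝ}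
    (h : Tendsto (fun n => birkhoffAverage ℝ T f n x) atTop (𝓝 g)) {ε : ℝ} (hε : 0 < ε) :
    ∃ C : ℝ, 0 ≤ C ∧ ∀ n : ℕ, |birkhoffSum T f n x - n * g| ≤ ε * n + C := by
  obtain ⟨n₀, hn₀⟩ := eventually_atTop.1
    ((tendsto_iff_norm_sub_tendsto_zero.1 h).eventually_lt_const hε)
  refine ⟨∑ i ∈ Finset.range n₀, |birkhoffSum T f i x - i * g|,
    Finset.sum_nonneg fun _ _ => abs_nonneg _, fun n => ?_⟩
  have h0 : 0 ≤ ∑ i ∈ Finset.range n₀, |birkhoffSum T f i x - i * g| :=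
    Finset.sum_nonneg fun _ _ => abs_nonneg _
  rcases lt_or_ge n n₀ with hn | hn
  · have h1 := Finset.single_le_sum (f := fun i : ℕ => |birkhoffSum T f i x - i * g|)
      (fun _ _ => abs_nonneg _) (Finset.mem_range.2 hn)
    have : 0 ≤ ε * n := by positivity
    linarith
  · rcases Nat.eq_zero_or_pos n with rfl | hpos
    · simpa using h0
    have h1 := hn₀ n hn
    have hn' : (0 : ℝ) < n := by exact_mod_cast hpos
    rw [birkhoffAverage, Real.norm_eq_abs, smul_eq_mul] at h1
    have h2 : birkhoffSum T f n x - n * g = n * ((n : ℝ)⁻¹ * birkhoffSum T f n x - g) := by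
      field_simp
    rw [h2, abs_mul, abs_of_pos hn']
    nlinarith

variable {Ω : Type*} [mΩ : MeasurableSpace Ω] {m : Measure Ω} [IsProbabilityMeasure m]
  {T : Ω → Ω}

theorem ae_iterate_of_ae (hT : MeasurePreserving T m m) {p : Ω → Prop} (h : ∀ᵐ x ∂m, p x) :
    ∀ᵐ x ∂m, ∀ n, p (T^[n] x) :=
  ae_all_iff.2 fun n => (hT.iterate n).quasiMeasurePreserving.ae h

/-- The Birkhoff averages of `f` are almost everywhere constant in `n`, so the ergodic theorem
identifies the limit. It suffices that `f` is invariant almost everywhere. -/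
theorem condExp_invariants_eq_self (hT : MeasurePreserving T m m) {f : Ω → ℝ} (hfm : Measurable f)
    (hf : Integrable f m) (hinv : ∀ᵐ x ∂m, f (T x) = f x) :
    m[f | MeasurableSpace.invariants T] =ᵐ[m] f := by
  filter_upwards [ae_tendsto_birkhoffAverage hT hfm hf, ae_iterate_of_ae hT hinv] with x hx hi
  have h1 : ∀ n, f (T^[n] x) = f x := by
    intro n
    induction n with
    | zero => rfl
    | succ n ih => rw [Function.iterate_succ_apply', hi, ih]
  refine tendsto_nhds_unique hx (tendsto_const_nhds.congr' ?_)
  filter_upwards [eventually_gt_atTop 0] with n hn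
  have hn' : (n : ℝ) ≠ 0 := by exact_mod_cast hn.ne'
  rw [birkhoffAverage, birkhoffSum]
  simp only [h1, Finset.sum_const, Finset.card_range, smul_eq_mul, nsmul_eq_mul]
  field_simp

theorem ae_iterate_eq_of_ae_eq (hT : MeasurePreserving T m m) {f : Ω → ℝ}
    (hinv : ∀ᵐ x ∂m, f (T x) = f x) : ∀ᵐ x ∂m, ∀ n, f (T^[n] x) = f x := by
  filter_upwards [ae_iterate_of_ae hT hinv] with x hi n
  induction n with
  | zero => rfl
  | succ n ih => rw [Function.iterate_succ_apply', hi, ih]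

end Birkhoff

/-! ### Lyapunov exponents of conformal systems -/

section Lyapunov

variable {ℓ : ℕ} {E : Type*} [NormedAddCommGroup E] [NormedSpace ℝ E] [Nontrivial E]
  {X U : Set E} {S : Fin ℓ → E → E} {c : ℝ≥0}

theorem IsSmoothIFS.exists_log_bounds (h : IsSmoothIFS X U S c) :
    ∃ a b : ℝ, a ≤ b ∧ b < 0 ∧ ∀ x (n : ℕ), 0 < smallestSingularValue (wordDeriv X S x n) ∧
      n * a ≤ Real.log (smallestSingularValue (wordDeriv X S x n)) ∧
      Real.log (smallestSingularValue (wordDeriv X S x n)) ≤ Real.log ‖wordDeriv X S x n‖ ∧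
      Real.log ‖wordDeriv X S x n‖ ≤ n * b := by
  obtain ⟨c₀, hc₀, hle⟩ := h.exists_le_smallestSingularValue
  have hc : (0 : ℝ) < c := by exact_mod_cast h.pos
  have hc1 : (c : ℝ) < 1 := by exact_mod_cast h.lt_one
  refine ⟨min (Real.log c₀) (Real.log c), Real.log c, min_le_right _ _, Real.log_neg hc hc1,
    fun x n => ?_⟩
  have h1 := h.le_smallestSingularValue_wordDeriv hc₀ hle x n
  have h2 := (pow_pos hc₀ n).trans_le h1
  have h3 := smallestSingularValue_le_norm (wordDeriv X S x n)
  refine ⟨h2, ?_, Real.log_le_log h2 h3, ?_⟩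
  · have := Real.log_le_log (pow_pos hc₀ n) h1
    rw [Real.log_pow] at this
    exact (mul_le_mul_of_nonneg_left (min_le_left _ _) n.cast_nonneg).trans this
  · have := Real.log_le_log (h2.trans_le h3) (h.norm_wordDeriv_le x n)
    rwa [Real.log_pow] at this

theorem IsSmoothIFS.abs_log_le (h : IsSmoothIFS X U S c) :
    ∃ B : ℝ, 0 < B ∧ ∀ x (n : ℕ),
      |Real.log (smallestSingularValue (wordDeriv X S x n))| ≤ n * B ∧
      |Real.log ‖wordDeriv X S x n‖| ≤ n * B ∧
      |(1 / (n : ℝ)) * Real.log (smallestSingularValue (wordDeriv X S x n))| ≤ B ∧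
      |(1 / (n : ℝ)) * Real.log ‖wordDeriv X S x n‖| ≤ B := by
  obtain ⟨a, b, hab, hb, hle⟩ := h.exists_log_bounds
  have key : ∀ (n : ℕ) (r : ℝ), |r| ≤ n * (-a) → |(1 / (n : ℝ)) * r| ≤ -a := by
    intro n r hr
    rw [abs_mul, abs_of_nonneg (by positivity : (0 : ℝ) ≤ 1 / n)]
    rcases Nat.eq_zero_or_pos n with rfl | hn
    · simp; linarith
    have hn' : (0 : ℝ) < n := by exact_mod_cast hn
    rw [one_div, inv_mul_le_iff₀ hn']
    exact hr
  refine ⟨-a, by linarith, fun x n => ?_⟩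
  obtain ⟨h1, h2, h3, h4⟩ := hle x n
  have h5 : (n : ℝ) * b ≤ 0 := mul_nonpos_of_nonneg_of_nonpos n.cast_nonneg hb.le
  have h6 : |Real.log (smallestSingularValue (wordDeriv X S x n))| ≤ n * (-a) := by
    rw [abs_of_nonpos (by linarith)]; linarith
  have h7 : |Real.log ‖wordDeriv X S x n‖| ≤ n * (-a) := by
    rw [abs_of_nonpos (by linarith)]; linarith
  exact ⟨h6, h7, key n _ h6, key n _ h7⟩

/-- The sequence of smallest singular values lies below that of the norms. If the lower limit of the
first equals the upper limit of the second, both converge. -/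
theorem IsSmoothIFS.tendsto_log (h : IsSmoothIFS X U S c) {x : ShiftSpace ℓ}
    (hx : upperLyapunov X S x = lowerLyapunov X S x) :
    Tendsto (fun n : ℕ => (1 / (n : ℝ)) * Real.log (smallestSingularValue (wordDeriv X S x n)))
      atTop (𝓝 (-upperLyapunov X S x)) ∧
    Tendsto (fun n : ℕ => (1 / (n : ℝ)) * Real.log ‖wordDeriv X S x n‖)
      atTop (𝓝 (-upperLyapunov X S x)) := by
  obtain ⟨B, hB, hle⟩ := h.abs_log_le
  obtain ⟨a, b, hab, hb, hle'⟩ := h.exists_log_bounds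
  set u : ℕ → ℝ := fun n => (1 / (n : ℝ)) * Real.log (smallestSingularValue (wordDeriv X S x n))
  set v : ℕ → ℝ := fun n => (1 / (n : ℝ)) * Real.log ‖wordDeriv X S x n‖
  have huv : ∀ n, u n ≤ v n := fun n =>
    mul_le_mul_of_nonneg_left (hle' x n).2.2.1 (by positivity)
  have hu1 : IsBoundedUnder (· ≤ ·) atTop u := isBoundedUnder_of ⟨B, fun n =>
    (abs_le.1 (hle x n).2.2.1).2⟩
  have hu2 : IsBoundedUnder (· ≥ ·) atTop u := isBoundedUnder_of ⟨-B, fun n =>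
    (abs_le.1 (hle x n).2.2.1).1⟩
  have hv1 : IsBoundedUnder (· ≤ ·) atTop v := isBoundedUnder_of ⟨B, fun n =>
    (abs_le.1 (hle x n).2.2.2).2⟩
  have hv2 : IsBoundedUnder (· ≥ ·) atTop v := isBoundedUnder_of ⟨-B, fun n =>
    (abs_le.1 (hle x n).2.2.2).1⟩
  have e1 : liminf u atTop = -upperLyapunov X S x := by simp [upperLyapunov, u]
  have e2 : limsup v atTop = -upperLyapunov X S x := by rw [hx]; simp [lowerLyapunov, v]
  have l1 : limsup u atTop ≤ limsup v atTop :=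
    limsup_le_limsup (Eventually.of_forall huv) hu2.isCoboundedUnder_le hv1
  have l2 : liminf u atTop ≤ liminf v atTop :=
    liminf_le_liminf (Eventually.of_forall huv) hu2 hv1.isCoboundedUnder_ge
  exact ⟨tendsto_of_le_liminf_of_limsup_le e1.ge (l1.trans e2.le) hu1 hu2,
    tendsto_of_le_liminf_of_limsup_le (e1.ge.trans l2) e2.le hv1 hv2⟩

theorem IsSmoothIFS.continuous_log_norm (h : IsSmoothIFS X U S c) (n : ℕ) :
    Continuous fun x => Real.log ‖wordDeriv X S x n‖ :=
  (h.continuous_wordDeriv n).norm.log fun x => by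
    obtain ⟨a, b, hab, hb, hle⟩ := h.exists_log_bounds
    exact ((hle x n).1.trans_le (smallestSingularValue_le_norm _)).ne'

theorem IsSmoothIFS.continuous_log_smallestSingularValue (h : IsSmoothIFS X U S c) (n : ℕ) :
    Continuous fun x => Real.log (smallestSingularValue (wordDeriv X S x n)) :=
  (continuous_smallestSingularValue.comp (h.continuous_wordDeriv n)).log fun x => by
    obtain ⟨a, b, hab, hb, hle⟩ := h.exists_log_bounds
    exact (hle x n).1.ne'

theorem IsSmoothIFS.measurable_upperLyapunov (h : IsSmoothIFS X U S c) :
    Measurable (upperLyapunov X S) := by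
  refine Measurable.neg (Measurable.liminf fun n => ?_)
  exact (h.continuous_log_smallestSingularValue n).measurable.const_mul _

variable {m : Measure (ShiftSpace ℓ)} [IsProbabilityMeasure m]

theorem IsSmoothIFS.exists_upperLyapunov_bounds (h : IsSmoothIFS X U S c) :
    ∃ a b : ℝ, 0 < a ∧ ∀ x, upperLyapunov X S x = lowerLyapunov X S x →
      a ≤ upperLyapunov X S x ∧ upperLyapunov X S x ≤ b := by
  obtain ⟨a, b, hab, hb, hle⟩ := h.exists_log_bounds
  obtain ⟨B, hB, hle'⟩ := h.abs_log_le
  refine ⟨-b, B, by linarith, fun x hx => ⟨?_, ?_⟩⟩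
  · have := le_of_tendsto (h.tendsto_log hx).2 (b := b) (by
      filter_upwards [eventually_gt_atTop 0] with n hn
      have hn' : (0 : ℝ) < n := by exact_mod_cast hn
      rw [one_div, inv_mul_le_iff₀ hn']
      exact (hle x n).2.2.2)
    linarith
  · have := ge_of_tendsto' (h.tendsto_log hx).2 (b := -B) fun n => (abs_le.1 (hle' x n).2.2.2).1
    linarith

/-- Submultiplicativity of the norm gives one inequality and supermultiplicativity of the smallest
singular value the other; they concern the same number where the exponents exist at both `x` and `σ
x`. -/
theorem IsSmoothIFS.ae_upperLyapunov_shift (h : IsSmoothIFS X U S c)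
    (hm : MeasurePreserving (shift ℓ) m m) (hconf : IsConformalFor m X S) :
    ∀ᵐ x ∂m, upperLyapunov X S (shift ℓ x) = upperLyapunov X S x := by
  obtain ⟨a, b, hab, hb, hle⟩ := h.exists_log_bounds
  filter_upwards [hconf, hm.quasiMeasurePreserving.ae hconf] with x hx hx'
  have t1 := h.tendsto_log hx
  have t2 := h.tendsto_log hx'
  have hd : ∀ n, wordDeriv X S x (n + 1) =
      (wordDeriv X S x 1).comp (wordDeriv X S (shift ℓ x) n) := by
    intro n
    rw [add_comm n 1, h.wordDeriv_add x 1 n]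
    rfl
  have hpos : ∀ y n, 0 < ‖wordDeriv X S y n‖ := fun y n =>
    (hle y n).1.trans_le (smallestSingularValue_le_norm (wordDeriv X S y n))
  have hlim : ∀ (K : ℝ) (w : ℕ → ℝ) (L : ℝ),
      Tendsto (fun n : ℕ => (1 / (n : ℝ)) * w n) atTop (𝓝 L) →
      Tendsto (fun n : ℕ => (1 / ((n + 1 : ℕ) : ℝ)) * (K + w n)) atTop (𝓝 L) := by
    intro K w L hw
    have c1 : Tendsto (fun n : ℕ => (1 / ((n : ℝ) + 1))) atTop (𝓝 0) :=
      tendsto_one_div_add_atTop_nhds_zero_nat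
    have c2 : Tendsto (fun n : ℕ => (n : ℝ) / ((n : ℝ) + 1)) atTop (𝓝 1) :=
      tendsto_natCast_div_add_atTop 1
    have := (c1.mul_const K).add (c2.mul hw)
    simp only [zero_mul, one_mul, zero_add] at this
    refine this.congr' ?_
    filter_upwards [eventually_gt_atTop 0] with n hn
    have hn' : (0 : ℝ) < n := by exact_mod_cast hn
    push_cast
    field_simp
  have s1 := (tendsto_add_atTop_iff_nat 1).2 t1.1
  have s2 := (tendsto_add_atTop_iff_nat 1).2 t1.2
  have i1 := le_of_tendsto_of_tendsto' s2
    (hlim (Real.log ‖wordDeriv X S x 1‖) _ _ t2.2) fun n => by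
      refine mul_le_mul_of_nonneg_left ?_ (by positivity)
      rw [← Real.log_mul (hpos _ _).ne' (hpos _ _).ne']
      refine Real.log_le_log (hpos _ _) ?_
      rw [hd n]
      exact ContinuousLinearMap.opNorm_comp_le _ _
  have i2 := le_of_tendsto_of_tendsto'
    (hlim (Real.log (smallestSingularValue (wordDeriv X S x 1))) _ _ t2.1) s1 fun n => by
      refine mul_le_mul_of_nonneg_left ?_ (by positivity)
      rw [← Real.log_mul (hle x 1).1.ne' (hle (shift ℓ x) n).1.ne']
      refine Real.log_le_log (mul_pos (hle x 1).1 (hle (shift ℓ x) n).1) ?_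
      rw [hd n]
      exact smallestSingularValue_comp_ge (wordDeriv X S x 1) (wordDeriv X S (shift ℓ x) n)
  linarith

theorem IsSmoothIFS.integrable_upperLyapunov (h : IsSmoothIFS X U S c)
    (hconf : IsConformalFor m X S) : Integrable (upperLyapunov X S) m := by
  obtain ⟨a, b, ha, hab⟩ := h.exists_upperLyapunov_bounds
  refine Integrable.of_bound h.measurable_upperLyapunov.aestronglyMeasurable b ?_
  filter_upwards [hconf] with x hx
  rw [Real.norm_of_nonneg (ha.le.trans (hab x hx).1)]
  exact (hab x hx).2

theorem tendsto_integral_abs_add {w : ℕ → ShiftSpace ℓ → ℝ} {L : ShiftSpace ℓ → ℝ} {B : ℝ}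
    (hw : ∀ n, Measurable (w n)) (hL : Measurable L) (hLi : Integrable L m)
    (hB : ∀ n x, |w n x| ≤ B)
    (hlim : ∀ᵐ x ∂m, Tendsto (fun n => w n x) atTop (𝓝 (-L x))) :
    Tendsto (fun n => ∫ x, |w n x + L x| ∂m) atTop (𝓝 0) := by
  have := tendsto_integral_of_dominated_convergence (μ := m) (F := fun n x => |w n x + L x|)
    (f := fun _ => (0 : ℝ)) (fun x => B + |L x|)
    (fun n => ((hw n).add hL).abs.aestronglyMeasurable)
    ((integrable_const B).add hLi.abs)
    (fun n => Eventually.of_forall fun x => by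
      rw [Real.norm_eq_abs, abs_abs]
      exact (abs_add_le _ _).trans (add_le_add (hB n x) le_rfl))
    (by
      filter_upwards [hlim] with x hx
      have := (hx.add_const (L x)).abs
      simpa using this)
  simpa using this

theorem IsSmoothIFS.tendsto_integral_log_norm (h : IsSmoothIFS X U S c)
    (hconf : IsConformalFor m X S) :
    Tendsto (fun n : ℕ => ∫ x, |(1 / (n : ℝ)) * Real.log ‖wordDeriv X S x n‖ +
      upperLyapunov X S x| ∂m) atTop (𝓝 0) := by
  obtain ⟨B, hB, hle⟩ := h.abs_log_le
  refine tendsto_integral_abs_add (fun n => (h.continuous_log_norm n).measurable.const_mul _)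
    h.measurable_upperLyapunov (h.integrable_upperLyapunov hconf) (fun n x => (hle x n).2.2.2) ?_
  filter_upwards [hconf] with x hx using (h.tendsto_log hx).2

theorem IsSmoothIFS.tendsto_integral_log_smallestSingularValue (h : IsSmoothIFS X U S c)
    (hconf : IsConformalFor m X S) :
    Tendsto (fun n : ℕ => ∫ x, |(1 / (n : ℝ)) *
      Real.log (smallestSingularValue (wordDeriv X S x n)) + upperLyapunov X S x| ∂m)
      atTop (𝓝 0) := by
  obtain ⟨B, hB, hle⟩ := h.abs_log_le
  refine tendsto_integral_abs_add
    (fun n => (h.continuous_log_smallestSingularValue n).measurable.const_mul _)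
    h.measurable_upperLyapunov (h.integrable_upperLyapunov hconf) (fun n x => (hle x n).2.2.1) ?_
  filter_upwards [hconf] with x hx using (h.tendsto_log hx).1

/-! ### Contraction along orbits -/

/-- Telescoping with step `N` from every starting time, rather than only along multiples of `N`,
leads to Birkhoff sums of `σ` itself instead of `σ^N`. -/
theorem sum_Ico_sub_shift (g : ℕ → ℝ) (N : ℕ) {s n : ℕ} (hsn : s ≤ n) :
    ∑ i ∈ Finset.Ico s n, (g i - g (i + N)) = ∑ k ∈ Finset.range N, (g (s + k) - g (n + k)) := by
  induction N with
  | zero => simp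
  | succ N ih =>
    rw [Finset.sum_range_succ, ← ih]
    have h1 : ∑ i ∈ Finset.Ico s n, (g (i + N) - g (i + (N + 1))) = g (s + N) - g (n + N) := by
      have := Finset.sum_Ico_sub (fun i => -g (i + N)) hsn
      rw [show g (s + N) - g (n + N) = -g (n + N) - -g (s + N) by ring, ← this]
      refine Finset.sum_congr rfl fun i _ => ?_
      rw [show i + (N + 1) = i + 1 + N by omega]
      ring
    rw [← h1, ← Finset.sum_add_distrib]
    refine Finset.sum_congr rfl fun i _ => ?_
    ring

/-- Let `d i` be the distance at time `i` between the orbit ending in `u` and the coded orbit. The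
linear approximation bounds `d i / d (i + N)` whenever `d (i + N) ≤ δ`, which contraction ensures up
to `M` steps before `t`. Summing over all `i` and dividing by `N` gives the bound. -/
theorem IsSmoothIFS.exists_dist_wordMap_le_exp_sum (h : IsSmoothIFS X U S c) {N : ℕ} (hN : 0 < N)
    {θ : ℝ} (hθ : 0 < θ) : ∃ M : ℕ, ∀ x, ∀ s t : ℕ, s ≤ t → ∀ u ∈ X,
      dist (wordMap S ((shift ℓ)^[s] x) (t - s) u) (codingMap X S ((shift ℓ)^[s] x)) ≤
        Real.exp (∑ i ∈ Finset.Ico s (t + 1 - (N + M)),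
          ((1 / (N : ℝ)) * Real.log ‖wordDeriv X S ((shift ℓ)^[i] x) N‖ + θ)) *
        dist u (codingMap X S ((shift ℓ)^[t] x)) := by
  obtain ⟨δ, hδ, happ⟩ := h.exists_wordMap_approx N hθ
  obtain ⟨M, hM⟩ := ((h.tendsto_pow_mul (Metric.diam X)).eventually_lt_const hδ).exists
  refine ⟨M, fun x s t hst u hu => ?_⟩
  set d : ℕ → ℝ := fun i =>
    dist (wordMap S ((shift ℓ)^[i] x) (t - i) u) (codingMap X S ((shift ℓ)^[i] x)) with hd
  have hmem : ∀ i n, wordMap S ((shift ℓ)^[i] x) n u ∈ X := fun i n =>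
    (h.lipschitzOn_wordMap _ n).2 hu
  have hsplit : ∀ i j, i + j ≤ t → wordMap S ((shift ℓ)^[i] x) (t - i) u =
      wordMap S ((shift ℓ)^[i] x) j (wordMap S ((shift ℓ)^[i + j] x) (t - (i + j)) u) := by
    intro i j hij
    rw [show t - i = j + (t - (i + j)) by omega, wordMap_add, Function.comp_apply,
      add_comm i j, Function.iterate_add_apply]
  have hcontr : ∀ i j, i + j ≤ t → d i ≤ (c : ℝ) ^ j * d (i + j) := by
    intro i j hij
    simp only [hd]
    rw [hsplit i j hij, ← h.wordMap_codingMap ((shift ℓ)^[i] x) j,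
      ← Function.iterate_add_apply, add_comm j i]
    have := (h.lipschitzOn_wordMap ((shift ℓ)^[i] x) j).1.dist_le_mul _
      (hmem (i + j) (t - (i + j))) _ (h.codingMap_mem ((shift ℓ)^[i + j] x))
    push_cast at this
    exact this
  have hc1 : (c : ℝ) ≤ 1 := by exact_mod_cast h.lt_one.le
  have hmono : ∀ i j, i ≤ j → j ≤ t → d i ≤ d j := by
    intro i j hij hj
    have := hcontr i (j - i) (by omega)
    rw [show i + (j - i) = j by omega] at this
    refine this.trans (mul_le_of_le_one_left dist_nonneg (pow_le_one₀ c.2 hc1))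
  have hdt : d t = dist u (codingMap X S ((shift ℓ)^[t] x)) := by
    simp [hd, wordMap]
  rw [← hdt]
  change d s ≤ _
  rcases (dist_nonneg : 0 ≤ d s).eq_or_lt with h0 | h0
  · rw [show d s = 0 from h0.symm]
    exact mul_nonneg (Real.exp_pos _).le dist_nonneg
  rcases le_or_gt (t + 1 - (N + M)) s with hn | hn
  · rw [Finset.Ico_eq_empty (by omega), Finset.sum_empty, Real.exp_zero, one_mul]
    exact hmono s t hst le_rfl
  set n := t + 1 - (N + M) with hn_def
  have hpos : ∀ i, s ≤ i → i ≤ t → 0 < d i := fun i hi hit => h0.trans_le (hmono s i hi hit)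
  have hstep : ∀ i ∈ Finset.Ico s n, Real.log (d i) - Real.log (d (i + N)) ≤
      Real.log ‖wordDeriv X S ((shift ℓ)^[i] x) N‖ + θ := by
    intro i hi
    rw [Finset.mem_Ico] at hi
    have hiN : d (i + N) ≤ δ := by
      have h1 := hcontr (i + N) M (by omega)
      have h2 : d (i + N + M) ≤ Metric.diam X :=
        Metric.dist_le_diam_of_mem h.isCompact.isBounded (hmem _ _) (h.codingMap_mem _)
      exact h1.trans ((mul_le_mul_of_nonneg_left h2 (by positivity)).trans hM.le)
    have h3 := (happ ((shift ℓ)^[i] x) (wordMap S ((shift ℓ)^[i + N] x) (t - (i + N)) u) (by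
      rw [← Function.iterate_add_apply, add_comm N i]; exact hiN)).2
    rw [← hsplit i N (by omega), ← Function.iterate_add_apply, add_comm N i] at h3
    change d i ≤ _ * d (i + N) at h3
    have hp1 := hpos i hi.1 (by omega)
    have hp2 := hpos (i + N) (by omega) (by omega)
    have hp3 : 0 < ‖wordDeriv X S ((shift ℓ)^[i] x) N‖ := by
      obtain ⟨a, b, hab, hb, hle⟩ := h.exists_log_bounds
      exact (hle _ N).1.trans_le (smallestSingularValue_le_norm _)
    have h4 := Real.log_le_log hp1 h3
    rw [Real.log_mul (by positivity) hp2.ne', Real.log_mul (by positivity) hp3.ne',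
      Real.log_exp] at h4
    linarith
  have hsum := Finset.sum_le_sum hstep
  rw [sum_Ico_sub_shift (fun i => Real.log (d i)) N hn.le] at hsum
  -- By monotonicity of `d`, each of the `N` telescoped terms is at least `log (d s) - log (d t)`.
  have hlow : (N : ℝ) * (Real.log (d s) - Real.log (d t)) ≤
      ∑ k ∈ Finset.range N, (Real.log (d (s + k)) - Real.log (d (n + k))) := by
    have hcard := Finset.card_nsmul_le_sum (Finset.range N)
      (fun k => Real.log (d (s + k)) - Real.log (d (n + k)))
      (Real.log (d s) - Real.log (d t)) fun k hk => ?_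
    · rwa [Finset.card_range, nsmul_eq_mul] at hcard
    rw [Finset.mem_range] at hk
    refine sub_le_sub (Real.log_le_log h0 (hmono _ _ (by omega) (by omega)))
      (Real.log_le_log (hpos _ (by omega) (by omega)) (hmono _ _ (by omega) le_rfl))
  have hN' : (0 : ℝ) < N := by exact_mod_cast hN
  have hN1 : (1 : ℝ) ≤ N := by exact_mod_cast hN
  have hfin : Real.log (d s) - Real.log (d t) ≤ ∑ i ∈ Finset.Ico s n,
      ((1 / (N : ℝ)) * Real.log ‖wordDeriv X S ((shift ℓ)^[i] x) N‖ + θ) := by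
    have h1 : Real.log (d s) - Real.log (d t) ≤ (N : ℝ)⁻¹ * ∑ i ∈ Finset.Ico s n,
        (Real.log ‖wordDeriv X S ((shift ℓ)^[i] x) N‖ + θ) := by
      rw [le_inv_mul_iff₀ hN']
      exact hlow.trans hsum
    refine h1.trans ?_
    rw [Finset.mul_sum]
    refine Finset.sum_le_sum fun i _ => ?_
    rw [mul_add, one_div]
    have : (N : ℝ)⁻¹ * θ ≤ θ := mul_le_of_le_one_left hθ.le (inv_le_one_of_one_le₀ hN1)
    linarith
  rw [← Real.log_le_log_iff h0 (mul_pos (Real.exp_pos _) (hpos t hst le_rfl)),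
    Real.log_mul (Real.exp_pos _).ne' (hpos t hst le_rfl).ne', Real.log_exp]
  linarith

/-- For suitable `N`, depending on `x`, the Birkhoff limit of `(1/N) log ‖wordDeriv N‖` is at most
slightly above `-λ(x)`. The constant is the same for all `s ≤ t`, since the sum between them is a
difference of two Birkhoff sums. -/
theorem IsSmoothIFS.ae_exists_dist_wordMap_le (h : IsSmoothIFS X U S c)
    (hm : MeasurePreserving (shift ℓ) m m) (hconf : IsConformalFor m X S) :
    ∀ᵐ x ∂m, ∀ ε : ℝ, 0 < ε → ∃ C : ℝ, 0 ≤ C ∧ ∀ s t : ℕ, s ≤ t → ∀ u ∈ X,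
      dist (wordMap S ((shift ℓ)^[s] x) (t - s) u) (codingMap X S ((shift ℓ)^[s] x)) ≤
        Real.exp (C - ((t : ℝ) - s) * upperLyapunov X S x + ε * t) *
        dist u (codingMap X S ((shift ℓ)^[t] x)) := by
  obtain ⟨B, hB, hBle⟩ := h.abs_log_le
  obtain ⟨a', b', ha', hab'⟩ := h.exists_upperLyapunov_bounds
  have hβm : ∀ N : ℕ, Measurable fun x => (1 / (N : ℝ)) * Real.log ‖wordDeriv X S x N‖ := fun N =>
    (h.continuous_log_norm N).measurable.const_mul _
  have hβi : ∀ N : ℕ, Integrable (fun x => (1 / (N : ℝ)) * Real.log ‖wordDeriv X S x N‖) m :=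
    fun N => Integrable.of_bound (hβm N).aestronglyMeasurable B
      (Eventually.of_forall fun x => (hBle x N).2.2.2)
  have hbirk := ae_all_iff.2 fun N => ae_tendsto_birkhoffAverage hm (hβm N) (hβi N)
  have hLi := h.integrable_upperLyapunov hconf
  have hcl := condExp_invariants_eq_self hm h.measurable_upperLyapunov hLi
    (h.ae_upperLyapunov_shift hm hconf)
  have hadd := ae_all_iff.2 fun N => condExp_add (hβi N) hLi (MeasurableSpace.invariants (shift ℓ))
  have hfreq := ae_frequently_abs_condExp_lt (I := fun _ => MeasurableSpace.invariants (shift ℓ))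
    (h.tendsto_integral_log_norm hconf)
  filter_upwards [hbirk, hcl, hadd, hfreq, hconf] with x hb hc ha hf hx ε hε
  obtain ⟨N, hNlt, hNpos⟩ := ((hf (ε / 8) (by positivity)).and_eventually
    (eventually_gt_atTop 0)).exists
  have hg : (m[fun x => (1 / (N : ℝ)) * Real.log ‖wordDeriv X S x N‖ |
      MeasurableSpace.invariants (shift ℓ)]) x < -upperLyapunov X S x + ε / 8 := by
    have := ha N
    rw [Pi.add_apply, hc] at this
    have h2 := (abs_lt.1 hNlt).2
    change (m[(fun x => (1 / (N : ℝ)) * Real.log ‖wordDeriv X S x N‖) + upperLyapunov X S |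
      MeasurableSpace.invariants (shift ℓ)]) x < _ at h2
    rw [this] at h2
    linarith
  set g := (m[fun x => (1 / (N : ℝ)) * Real.log ‖wordDeriv X S x N‖ |
      MeasurableSpace.invariants (shift ℓ)]) x
  obtain ⟨M, hM⟩ := h.exists_dist_wordMap_le_exp_sum hNpos (θ := ε / 8) (by positivity)
  obtain ⟨C, hC0, hC⟩ := exists_abs_birkhoffSum_sub_le (hb N) (ε := ε / 8) (by positivity)
  set lam := upperLyapunov X S x
  have hlam : 0 < lam := ha'.trans_le (hab' x hx).1
  -- `2 * C` pays for the Birkhoff sums at both ends, `(N + M) * lam` for the last times before `t`,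
  -- which the sum omits.
  refine ⟨2 * C + (N + M) * lam, by positivity, fun s t hst u hu => ?_⟩
  refine (hM x s t hst u hu).trans (mul_le_mul_of_nonneg_right (Real.exp_le_exp.2 ?_) dist_nonneg)
  have hst' : (s : ℝ) ≤ t := by exact_mod_cast hst
  have hs0 : (0 : ℝ) ≤ s := s.cast_nonneg
  rcases le_or_gt (t + 1 - (N + M)) s with hn | hn
  · rw [Finset.Ico_eq_empty (by omega), Finset.sum_empty]
    have h1 : (t : ℝ) ≤ s + (N + M) := by
      have : t ≤ s + (N + M) := by omega
      exact_mod_cast this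
    have h2 : ((t : ℝ) - s) * lam ≤ (N + M) * lam :=
      mul_le_mul_of_nonneg_right (by linarith) hlam.le
    have h3 : 0 ≤ ε * t := by positivity
    linarith
  · set n := t + 1 - (N + M) with hn_def
    have hnt : (n : ℝ) ≤ t := by
      have : n ≤ t := by omega
      exact_mod_cast this
    have htn : (t : ℝ) ≤ n + (N + M) := by
      have : t ≤ n + (N + M) := by omega
      exact_mod_cast this
    have hsn : (s : ℝ) ≤ n := by exact_mod_cast hn.le
    rw [Finset.sum_add_distrib, Finset.sum_const, Nat.card_Ico, nsmul_eq_mul,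
      Nat.cast_sub hn.le, Finset.sum_Ico_eq_sub _ hn.le]
    have hCn := (abs_le.1 (hC n)).2
    have hCs := (abs_le.1 (hC s)).1
    simp only [birkhoffSum] at hCn hCs
    have h1 : ((n : ℝ) - s) * g ≤ (n - s) * (-lam + ε / 8) :=
      mul_le_mul_of_nonneg_left hg.le (by linarith)
    have h2 : ((t : ℝ) - n) * lam ≤ (N + M) * lam :=
      mul_le_mul_of_nonneg_right (by linarith) hlam.le
    have h3 : ε * n ≤ ε * t := mul_le_mul_of_nonneg_left hnt hε.le
    have h4 : ε * s ≤ ε * t := mul_le_mul_of_nonneg_left hst' hε.le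
    have h5 : 0 ≤ ε * s := by positivity
    nlinarith

end Lyapunov

/-! ### Decay of the conditional measures of balls -/

section FibreDecay

/-- Steps are taken as long as the index `s` of the radius lasts; the remaining mass is bounded by
`1`. -/
theorem le_exp_sum_of_step {H : ℕ → ℕ → ℝ≥0∞} (hH : ∀ i s, H i s ≤ 1) {d : ℕ → ℕ} {w : ℕ → ℝ}
    {s₂ : ℕ} (h : ∀ i s, s₂ + d i ≤ s → H i s ≤ ENNReal.ofReal (Real.exp (w i)) * H (i + 1) (s - d i))
    (k s : ℕ) (hs : s₂ + ∑ i ∈ Finset.range k, d i ≤ s) :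
    H 0 s ≤ ENNReal.ofReal (Real.exp (∑ i ∈ Finset.range k, w i)) := by
  have key : H 0 s ≤ ENNReal.ofReal (Real.exp (∑ i ∈ Finset.range k, w i)) *
      H k (s - ∑ i ∈ Finset.range k, d i) := by
    induction k with
    | zero => simp
    | succ k ih =>
      rw [Finset.sum_range_succ] at hs
      refine (ih (by omega)).trans ?_
      rw [Finset.sum_range_succ, Finset.sum_range_succ, Real.exp_add,
        ENNReal.ofReal_mul (Real.exp_pos _).le, mul_assoc, ← Nat.sub_sub]
      gcongr
      exact h k _ (by omega)
  exact key.trans (mul_le_of_le_one_right' (hH _ _))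

/-- Each step consumes about `a` of the budget `s` and gains `b`, so about `s / a` steps are taken.
The sign of `b` is arbitrary, whence the absolute values in the proof. -/
theorem eventually_exists_le_mul {D : ℕ → ℕ} {W : ℕ → ℝ} {a b C : ℝ} (s₂ : ℕ) (ha : 0 < a)
    (hC : 0 ≤ C) (hD : ∀ k, (D k : ℝ) ≤ k * a + C) (hW : ∀ k, W k ≤ -(k * b) + C) {ε : ℝ}
    (hε : 0 < ε) :
    ∀ᶠ s : ℕ in atTop, ∃ k, s₂ + D k ≤ s ∧ W k ≤ -(s * (b / a - ε)) := by
  have h1 : ∀ᶠ s : ℕ in atTop, |b| * ((s₂ + C) / a + 1) + C ≤ ε * s :=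
    (tendsto_natCast_atTop_atTop.const_mul_atTop hε).eventually_ge_atTop _
  have h2 : ∀ᶠ s : ℕ in atTop, (s₂ : ℝ) + C ≤ s :=
    tendsto_natCast_atTop_atTop.eventually_ge_atTop _
  filter_upwards [h1, h2] with s h1 h2
  set t := ((s : ℝ) - s₂ - C) / a with ht
  have ht0 : 0 ≤ t := div_nonneg (by linarith) ha.le
  have hk1 : (⌊t⌋₊ : ℝ) ≤ t := Nat.floor_le ht0
  have hk2 : t - 1 < ⌊t⌋₊ := Nat.sub_one_lt_floor t
  refine ⟨⌊t⌋₊, ?_, ?_⟩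
  · have h3 : (⌊t⌋₊ : ℝ) * a ≤ s - s₂ - C := by
      rw [ht, le_div_iff₀ ha] at hk1
      exact hk1
    have h4 := hD ⌊t⌋₊
    have : (s₂ : ℝ) + D ⌊t⌋₊ ≤ s := by linarith
    exact_mod_cast this
  · refine (hW _).trans ?_
    have h5 : t = s / a - (s₂ + C) / a := by rw [ht]; field_simp; ring
    have h6 : |(s : ℝ) / a - ⌊t⌋₊| ≤ (s₂ + C) / a + 1 := by
      have : 0 ≤ (s₂ + C) / a := by positivity
      rw [abs_le]
      constructor <;> linarith
    have h7 : b * ((s : ℝ) / a - ⌊t⌋₊) ≤ |b| * ((s₂ + C) / a + 1) :=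
      (le_abs_self _).trans (by rw [abs_mul]; exact mul_le_mul_of_nonneg_left h6 (abs_nonneg b))
    have h8 : (s : ℝ) * (b / a - ε) = b * (s / a) - ε * s := by ring
    rw [h8]
    linarith

theorem birkhoffSum_iterate_block {Ω : Type*} (T : Ω → Ω) (f : Ω → ℝ) (N k : ℕ) (x : Ω) :
    ∑ i ∈ Finset.range k, birkhoffSum T f N ((T^[N])^[i] x) = birkhoffSum T f (k * N) x := by
  induction k with
  | zero => simp
  | succ k ih =>
    rw [Finset.sum_range_succ, ih, Nat.succ_mul, birkhoffSum_add, ← Function.iterate_mul, mul_comm]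

variable {ℓ : ℕ} {E : Type*} [NormedAddCommGroup E] [NormedSpace ℝ E] [Nontrivial E]
  {X U : Set E} {S : Fin ℓ → E → E} {c : ℝ≥0}

theorem IsSmoothIFS.injOn_wordMap (h : IsSmoothIFS X U S c) (x : ShiftSpace ℓ) (n : ℕ) :
    Set.InjOn (wordMap S x n) X := by
  induction n with
  | zero => exact Set.injOn_id X
  | succ n ih => exact ih.comp ((h.injOn _).mono h.subset) (h.mapsTo _)

/-- A word map is injective on the compact `X`, so points at distance at least `δ` have images at
distance bounded below. This brings a point into the range of the linear approximation. -/
theorem IsSmoothIFS.exists_dist_le_of_dist_wordMap_le (h : IsSmoothIFS X U S c) (n : ℕ) {δ : ℝ}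
    (hδ : 0 < δ) : ∃ r > 0, ∀ x, ∀ u ∈ X, ∀ w ∈ X,
      dist (wordMap S x n u) (wordMap S x n w) ≤ r → dist u w ≤ δ := by
  have hall := ((finite_range_wordMap S n).eventually_all (l := 𝓝[>] (0 : ℝ))
    (p := fun f r => ∀ u ∈ X, ∀ w ∈ X, dist (f u) (f w) ≤ r → dist u w ≤ δ)).2 (by
    rintro _ ⟨x, rfl⟩
    have hcont : ContinuousOn (wordMap S x n) X := (h.lipschitzOn_wordMap x n).1.continuousOn
    have hK : IsCompact ((X ×ˢ X) ∩ {q : E × E | δ ≤ dist q.1 q.2}) :=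
      (h.isCompact.prod h.isCompact).inter_right
        (isClosed_le continuous_const continuous_dist)
    rcases Set.eq_empty_or_nonempty ((X ×ˢ X) ∩ {q : E × E | δ ≤ dist q.1 q.2}) with he | hne
    · refine Eventually.of_forall fun r u hu w hw _ => ?_
      by_contra hlt
      have : (u, w) ∈ (X ×ˢ X) ∩ {q : E × E | δ ≤ dist q.1 q.2} :=
        ⟨⟨hu, hw⟩, (not_le.1 hlt).le⟩
      rw [he] at this
      exact this
    · obtain ⟨q, hq, hmin⟩ := hK.exists_isMinOn hne
        (f := fun q : E × E => dist (wordMap S x n q.1) (wordMap S x n q.2)) (by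
        exact continuous_dist.comp_continuousOn
          ((hcont.comp continuousOn_fst fun q hq => hq.1.1).prodMk
            (hcont.comp continuousOn_snd fun q hq => hq.1.2)))
      have hpos : 0 < dist (wordMap S x n q.1) (wordMap S x n q.2) := by
        rw [dist_pos]
        intro he
        have := h.injOn_wordMap x n hq.1.1 hq.1.2 he
        have h2 : δ ≤ dist q.1 q.2 := hq.2
        rw [this, dist_self] at h2
        linarith
      filter_upwards [Ioo_mem_nhdsGT hpos] with r hr u hu w hw hd
      by_contra hlt
      have h3 := hmin (a := (u, w)) ⟨⟨hu, hw⟩, (not_le.1 hlt).le⟩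
      exact absurd (lt_of_le_of_lt hd hr.2) (not_lt.2 h3))
  obtain ⟨r, hr, hr0⟩ := (hall.and self_mem_nhdsWithin).exists
  exact ⟨r, hr0, fun x => hr _ ⟨x, rfl⟩⟩

theorem wordComp_indicator (hmaps : ∀ i, Set.MapsTo (S i) X X) (n : ℕ) (x : ShiftSpace ℓ) {u : E}
    (hu : u ∈ X) :
    wordComp (fun a => X.indicator (S a)) n (itinerary (shift ℓ) (fun x => x 0) n x) u =
      wordMap S x n u ∧ wordMap S x n u ∈ X := by
  induction n generalizing x with
  | zero => exact ⟨rfl, hu⟩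
  | succ n ih =>
    rw [itinerary_succ, wordMap_succ']
    simp only [wordComp, Fin.cons_zero, Fin.tail_cons, Function.comp_apply]
    obtain ⟨h1, h2⟩ := ih (shift ℓ x)
    rw [h1, Set.indicator_of_mem h2]
    exact ⟨rfl, hmaps _ h2⟩

/-- The preimage of a ball is larger by at most the inverse smallest singular value, times the
factor `e` allowed by the linear approximation with `θ = 1`; this factor is the summand `1` in the
ceiling. -/
theorem IsSmoothIFS.exists_ball_step (h : IsSmoothIFS X U S c) (N : ℕ) :
    ∃ s₁ : ℕ, ∀ x, ∀ s, s₁ ≤ s →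
      ⌈1 - Real.log (smallestSingularValue (wordDeriv X S x N))⌉₊ ≤ s →
      ∀ u ∈ X, dist (wordMap S x N u) (codingMap X S x) ≤ Real.exp (-(s : ℝ)) →
        dist u (codingMap X S ((shift ℓ)^[N] x)) ≤ Real.exp (-((s -
          ⌈1 - Real.log (smallestSingularValue (wordDeriv X S x N))⌉₊ : ℕ) : ℝ)) := by
  obtain ⟨δ, hδ, happ⟩ := h.exists_wordMap_approx N one_pos
  obtain ⟨r, hr, hinj⟩ := h.exists_dist_le_of_dist_wordMap_le N hδ
  have ht : Tendsto (fun s : ℕ => Real.exp (-(s : ℝ))) atTop (𝓝 0) :=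
    Real.tendsto_exp_neg_atTop_nhds_zero.comp tendsto_natCast_atTop_atTop
  obtain ⟨s₁, hs₁⟩ := eventually_atTop.1 (ht.eventually_le_const hr)
  obtain ⟨a, b, hab, hb, hle⟩ := h.exists_log_bounds
  refine ⟨s₁, fun x s hs hds u hu hd => ?_⟩
  have hssv := (hle x N).1
  set σ := smallestSingularValue (wordDeriv X S x N)
  have h1 : dist u (codingMap X S ((shift ℓ)^[N] x)) ≤ δ := by
    refine hinj x u hu _ (h.codingMap_mem _) ?_
    rw [h.wordMap_codingMap]
    exact hd.trans (hs₁ s hs)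
  have h2 := (happ x u h1).1.trans hd
  have h3 : 0 < Real.exp (-1) * σ := by positivity
  rw [← le_div_iff₀' h3] at h2
  refine h2.trans ?_
  rw [div_le_iff₀' h3, ← Real.exp_log hssv, ← Real.exp_add, ← Real.exp_add, Real.exp_le_exp,
    Real.log_exp, Nat.cast_sub hds]
  have := Nat.le_ceil (1 - Real.log σ)
  linarith

variable [FiniteDimensional ℝ E] [MeasurableSpace E] [BorelSpace E]
variable {m : Measure (ShiftSpace ℓ)} [IsProbabilityMeasure m]
variable {F : Type*} [MeasurableSpace F] {p : ShiftSpace ℓ → F} {φ ψ : Fin ℓ → F → F}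

theorem measurable_projInfo {Ω A G : Type*} [MeasurableSpace Ω] [MeasurableSpace G] [Fintype A]
    [MeasurableSpace A] [MeasurableSingletonClass A] {m : Measure Ω} {T : Ω → Ω}
    (hT : Measurable T) {P : Ω → A} (hP : Measurable P) {q : Ω → G} (hq : Measurable q) :
    Measurable (projInfo m T P q) :=
  (measurable_atomInfo (hq.comp hT) hP).sub (measurable_atomInfo hq hP)

theorem integrable_projInfo {Ω A G : Type*} [MeasurableSpace Ω] [MeasurableSpace G] [Fintype A]
    [MeasurableSpace A] [MeasurableSingletonClass A] {m : Measure Ω} [IsProbabilityMeasure m]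
    {T : Ω → Ω} (hT : Measurable T) {P : Ω → A} (hP : Measurable P) {q : Ω → G}
    (hq : Measurable q) : Integrable (projInfo m T P q) m :=
  (integrable_atomInfo (hq.comp hT) hP).sub (integrable_atomInfo hq hP)

theorem ae_projInfo_iterate {Ω A G : Type*} [MeasurableSpace Ω] [MeasurableSpace G] [Fintype A]
    [MeasurableSpace A] [MeasurableSingletonClass A] {m : Measure Ω} [IsProbabilityMeasure m]
    {T : Ω → Ω} (hT : MeasurePreserving T m m) {P : Ω → A} (hP : Measurable P) {q : Ω → G}
    (hq : Measurable q) {φ ψ : A → G → G} (hφ : ∀ a, Measurable (φ a)) (hψ : ∀ a, Measurable (ψ a))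
    (hqφ : ∀ x, q x = φ (P x) (q (T x))) (hqψ : ∀ x, q (T x) = ψ (P x) (q x)) (N : ℕ) :
    ∀ᵐ x ∂m, ∀ k, ∑ i ∈ Finset.range k, projInfo m T^[N] (itinerary T P N) q ((T^[N])^[i] x) =
      birkhoffSum T (projInfo m T P q) (k * N) x := by
  filter_upwards [ae_iterate_of_ae (hT.iterate N) (ae_projInfo_itinerary hT hq hP hφ hψ hqφ hqψ N)]
    with x hx k
  rw [← birkhoffSum_iterate_block]
  exact Finset.sum_congr rfl fun i _ => hx i

/-- The conditional distribution of the coding map given `p` decays at least at the rate given by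
the increase of projection information divided by the Lyapunov exponent. -/
theorem IsSmoothIFS.ae_fibreKernel_closedBall_le (h : IsSmoothIFS X U S c)
    (hm : MeasurePreserving (shift ℓ) m m) (hconf : IsConformalFor m X S)
    (hp : Measurable p) (hφ : ∀ a, Measurable (φ a)) (hψ : ∀ a, Measurable (ψ a))
    (hpφ : ∀ x, p x = φ (x 0) (p (shift ℓ x))) (hpψ : ∀ x, p (shift ℓ x) = ψ (x 0) (p x)) :
    ∀ᵐ x ∂m, ∀ ε : ℝ, 0 < ε → ∀ᶠ s : ℕ in atTop,
      fibreKernel m p (codingMap X S) (p x)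
        (Metric.closedBall (codingMap X S x) (Real.exp (-(s : ℝ)))) ≤
      ENNReal.ofReal (Real.exp (-(s * (((m[projInfo m (shift ℓ) (fun x => x 0)
          (fun x => (p x, codingMap X S x)) | MeasurableSpace.invariants (shift ℓ)]) x -
        (m[projInfo m (shift ℓ) (fun x => x 0) p | MeasurableSpace.invariants (shift ℓ)]) x) /
          upperLyapunov X S x - ε)))) := by
  set T := shift ℓ with hTdef
  set P : ShiftSpace ℓ → Fin ℓ := fun x => x 0 with hPdef
  set y := codingMap X S with hydef
  have hP : Measurable P := measurable_pi_apply 0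
  have hy : Measurable y := h.continuous_codingMap.measurable
  have hScont : ∀ a, ContinuousOn (S a) X := fun a => (h.lipschitz a).continuousOn
  set χ : Fin ℓ → E → E := fun a => X.indicator (S a) with hχdef
  have hχ : ∀ a, Measurable (χ a) := fun a =>
    measurable_indicator_of_continuousOn h.isCompact (hScont a)
  choose ζ hζ hζS using fun a => exists_measurable_leftInverse h.isCompact (hScont a)
    ((h.injOn a).mono h.subset)
  have hyχ : ∀ x, y x = χ (P x) (y (T x)) := fun x => by
    rw [hχdef]
    simp only
    rw [Set.indicator_of_mem (h.codingMap_mem _)]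
    exact h.codingMap_eq x
  have hyζ : ∀ x, y (T x) = ζ (P x) (y x) := fun x => by
    rw [hydef, h.codingMap_eq x, hζS _ _ (h.codingMap_mem _)]
  have hpym : Measurable fun x => (p x, y x) := hp.prodMk hy
  have hX : MeasurableSet X := h.isCompact.isClosed.measurableSet
  -- the step for the iterates
  have hstep := fun N : ℕ => exists_fibreKernel_closedBall_le (hm.iterate N) hp hy
    (measurable_itinerary hm.measurable hP N)
    (measurable_wordComp hφ N) (measurable_wordCompRev hψ N) (measurable_wordComp hχ N)
    (eq_wordComp hpφ N) (eq_wordCompRev hpψ N) (eq_wordComp hyχ N) hX h.codingMap_mem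
    (ρ := fun s : ℕ => Real.exp (-(s : ℝ))) (fun s => Real.exp_pos _)
    (fun s => Real.exp_le_one_iff.2 (by simp))
    (Real.tendsto_exp_neg_atTop_nhds_zero.comp tendsto_natCast_atTop_atTop)
  choose err herrm herri herr0 herrle using hstep
  choose s₁ hs₁ using h.exists_ball_step
  have b1 := ae_all_iff.2 fun N => ae_projInfo_iterate hm hP hp hφ hψ hpφ hpψ N
  have b2 := ae_all_iff.2 fun N => ae_projInfo_iterate hm hP hpym
    (φ := fun a q => (φ a q.1, χ a q.2)) (ψ := fun a q => (ψ a q.1, ζ a q.2))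
    (fun a => ((hφ a).comp measurable_fst).prodMk ((hχ a).comp measurable_snd))
    (fun a => ((hψ a).comp measurable_fst).prodMk ((hζ a).comp measurable_snd))
    (fun x => Prod.ext (hpφ x) (hyχ x)) (fun x => Prod.ext (hpψ x) (hyζ x)) N
  have b3 := ae_tendsto_birkhoffAverage hm (measurable_projInfo (m := m) hm.measurable hP hp)
    (integrable_projInfo hm.measurable hP hp)
  have b4 := ae_tendsto_birkhoffAverage hm (measurable_projInfo (m := m) hm.measurable hP hpym)
    (integrable_projInfo hm.measurable hP hpym)
  have b5 := ae_all_iff.2 fun N => ae_all_iff.2 fun s =>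
    ae_tendsto_birkhoffAverage (hm.iterate N) (herrm N s) (herri N s)
  obtain ⟨B, hB, hBle⟩ := h.abs_log_le
  have hαm : ∀ N : ℕ, Measurable fun x =>
      (1 / (N : ℝ)) * Real.log (smallestSingularValue (wordDeriv X S x N)) :=
    fun N => (h.continuous_log_smallestSingularValue N).measurable.const_mul _
  have hαi : ∀ N : ℕ, Integrable (fun x =>
      (1 / (N : ℝ)) * Real.log (smallestSingularValue (wordDeriv X S x N))) m :=
    fun N => Integrable.of_bound (hαm N).aestronglyMeasurable B
      (Eventually.of_forall fun x => (hBle x N).2.2.1)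
  have b6 := ae_all_iff.2 fun N => ae_tendsto_birkhoffAverage (hm.iterate N) (hαm N) (hαi N)
  have hLi := h.integrable_upperLyapunov hconf
  have hinv := ae_iterate_eq_of_ae_eq hm (h.ae_upperLyapunov_shift hm hconf)
  -- Blocks of length `N` are averaged along `T^[N]`, whose invariant sets may be more numerous than
  -- those of `T`. The exponent is invariant under both, so it is its own conditional expectation
  -- here too.
  have b7 := ae_all_iff.2 fun N => condExp_invariants_eq_self (hm.iterate N)
    h.measurable_upperLyapunov hLi (by filter_upwards [hinv] with x hx using hx N)
  have b8 := ae_all_iff.2 fun N => condExp_add (hαi N) hLi (MeasurableSpace.invariants T^[N])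
  have b9 := ae_frequently_abs_condExp_lt (I := fun N => MeasurableSpace.invariants T^[N])
    (h.tendsto_integral_log_smallestSingularValue hconf)
  have b10 := ae_all_iff.2 fun N => ae_frequently_abs_condExp_lt (m := m)
    (I := fun _ => MeasurableSpace.invariants T^[N]) (herr0 N)
  have b11 := ae_all_iff.2 fun N => ae_iterate_of_ae (hm.iterate N) (herrle N)
  obtain ⟨l₀, l₁, hl₀, hl₁⟩ := h.exists_upperLyapunov_bounds
  filter_upwards [b1, b2, b3, b4, b5, b6, b7, b8, b9, b10, b11, hconf]
    with x b1 b2 b3 b4 b5 b6 b7 b8 b9 b10 b11 hx ε hε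
  set g₁ := (m[projInfo m T P p | MeasurableSpace.invariants T]) x
  set g₂ := (m[projInfo m T P (fun x => (p x, y x)) | MeasurableSpace.invariants T]) x
  set lam := upperLyapunov X S x
  have hlam : 0 < lam := hl₀.trans_le (hl₁ x hx).1
  -- Three errors of size `η` per symbol will occur both in the loss of radius and in the gain of
  -- information.
  obtain ⟨η, hη, hηpos⟩ : ∃ η : ℝ, (g₂ - g₁) / lam - ε / 2 < (g₂ - g₁ - 3 * η) / (lam + 3 * η) ∧
      0 < η := by
    have ht : Tendsto (fun η : ℝ => (g₂ - g₁ - 3 * η) / (lam + 3 * η)) (𝓝[>] 0)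
        (𝓝 ((g₂ - g₁ - 3 * 0) / (lam + 3 * 0))) := by
      refine Tendsto.mono_left ?_ nhdsWithin_le_nhds
      refine Tendsto.div ?_ ?_ (by simpa using hlam.ne')
      · exact (continuous_const.sub (continuous_const.mul continuous_id)).tendsto 0
      · exact (continuous_const.add (continuous_const.mul continuous_id)).tendsto 0
    simp only [mul_zero, sub_zero, add_zero] at ht
    have hlt : (g₂ - g₁) / lam - ε / 2 < (g₂ - g₁) / lam := by linarith
    exact ((ht.eventually_const_lt hlt).and self_mem_nhdsWithin).exists
  -- The rounding and the distortion of a block cost at most `2`; the requirement `N ≥ 2/η` makes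
  -- this at most `η` per symbol.
  obtain ⟨N, hN, hN2⟩ := ((b9 η hηpos).and_eventually
    (tendsto_natCast_atTop_atTop.eventually_ge_atTop (max 1 (2 / η)))).exists
  have hN1 : (1 : ℝ) ≤ N := (le_max_left _ _).trans hN2
  have hNη : 2 ≤ N * η := by
    have := (le_max_right _ _).trans hN2
    rwa [div_le_iff₀ hηpos] at this
  obtain ⟨s₀, hs₀⟩ := (b10 N η hηpos).exists
  set α := (m[fun x => (1 / (N : ℝ)) * Real.log (smallestSingularValue (wordDeriv X S x N)) |
    MeasurableSpace.invariants T^[N]]) x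
  have hα : -lam - η < α := by
    have h1 := b8 N
    rw [Pi.add_apply, b7 N] at h1
    have h2 := (abs_lt.1 hN).1
    change _ < (m[(fun x => (1 / (N : ℝ)) * Real.log (smallestSingularValue (wordDeriv X S x N))) +
      upperLyapunov X S | MeasurableSpace.invariants T^[N]]) x at h2
    rw [h1] at h2
    linarith
  obtain ⟨C₁, hC₁, hb1⟩ := exists_abs_birkhoffSum_sub_le (b6 N) hηpos
  obtain ⟨C₂, hC₂, hb2⟩ := exists_abs_birkhoffSum_sub_le b3 (half_pos hηpos)
  obtain ⟨C₃, hC₃, hb3⟩ := exists_abs_birkhoffSum_sub_le b4 (half_pos hηpos)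
  obtain ⟨C₄, hC₄, hb4⟩ := exists_abs_birkhoffSum_sub_le (b5 N s₀) hηpos
  set d : ℕ → ℕ := fun i =>
    ⌈1 - Real.log (smallestSingularValue (wordDeriv X S ((T^[N])^[i] x) N))⌉₊ with hd
  set w : ℕ → ℝ := fun i => projInfo m T^[N] (itinerary T P N) p ((T^[N])^[i] x) -
    projInfo m T^[N] (itinerary T P N) (fun x => (p x, y x)) ((T^[N])^[i] x) +
      err N s₀ ((T^[N])^[i] x) with hw
  -- Telescoping along blocks: `d i` is the loss of logarithmic radius in the block `i`, and `w i`
  -- bounds the logarithm of the factor gained by the conditional mass.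
  have htel := le_exp_sum_of_step (H := fun i s => fibreKernel m p y (p ((T^[N])^[i] x))
    (Metric.closedBall (y ((T^[N])^[i] x)) (Real.exp (-(s : ℝ))))) (fun i s => prob_le_one)
    (d := d) (w := w) (s₂ := max s₀ (s₁ N)) (fun i s hs => by
      have := b11 N i s₀ s (s - d i) (by omega) (by omega) fun y' hy' hdist => by
        refine hs₁ N ((T^[N])^[i] x) s (by omega) (by simp only [hd] at hs; omega) y' hy' ?_
        rw [← (wordComp_indicator h.mapsTo N _ hy').1]
        exact hdist
      simp only [Function.iterate_succ_apply' T^[N] i x]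
      exact this)
  have hlog0 : ∀ z, 0 ≤ 1 - Real.log (smallestSingularValue (wordDeriv X S z N)) := fun z => by
    obtain ⟨a, b, hab, hb, hle⟩ := h.exists_log_bounds
    obtain ⟨-, -, h2, h3⟩ := hle z N
    nlinarith
  have hD : ∀ k : ℕ, ((∑ i ∈ Finset.range k, d i : ℕ) : ℝ) ≤
      k * (N * (lam + 3 * η)) + (N * C₁ + C₂ + C₃ + C₄) := by
    intro k
    have h1 : ((∑ i ∈ Finset.range k, d i : ℕ) : ℝ) ≤ ∑ i ∈ Finset.range k, (2 - N * ((1 / (N : ℝ)) *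
        Real.log (smallestSingularValue (wordDeriv X S ((T^[N])^[i] x) N)))) := by
      rw [Nat.cast_sum]
      refine Finset.sum_le_sum fun i _ => ?_
      have := (Nat.ceil_lt_add_one (hlog0 ((T^[N])^[i] x))).le
      have hN0 : (N : ℝ) ≠ 0 := by linarith
      simp only [hd]
      rw [← mul_assoc, mul_one_div_cancel hN0]
      linarith
    rw [Finset.sum_sub_distrib, Finset.sum_const, Finset.card_range, ← Finset.mul_sum,
      nsmul_eq_mul] at h1
    have h2 := (abs_le.1 (hb1 k)).1
    simp only [birkhoffSum] at h2
    have hk0 : (0 : ℝ) ≤ k := k.cast_nonneg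
    have h3 : (N : ℝ) * (k * (-lam - η) - η * k - C₁) ≤ N * ∑ i ∈ Finset.range k, ((1 / (N : ℝ)) *
        Real.log (smallestSingularValue (wordDeriv X S ((T^[N])^[i] x) N))) := by
      refine mul_le_mul_of_nonneg_left ?_ (by linarith)
      have := mul_le_mul_of_nonneg_left hα.le hk0
      linarith
    have h4 : (k : ℝ) * 2 ≤ k * (N * η) := mul_le_mul_of_nonneg_left hNη hk0
    nlinarith
  have hW : ∀ k : ℕ, ∑ i ∈ Finset.range k, w i ≤
      -(k * (N * (g₂ - g₁ - 3 * η))) + (N * C₁ + C₂ + C₃ + C₄) := by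
    intro k
    rw [hw, Finset.sum_add_distrib, Finset.sum_sub_distrib, b1 N k, b2 N k]
    have h2 := (abs_le.1 (hb2 (k * N))).2
    have h3 := (abs_le.1 (hb3 (k * N))).1
    have h4 := (abs_le.1 (hb4 k)).2
    simp only [birkhoffSum] at h4
    have h5 := (abs_lt.1 hs₀).2
    have hk0 : (0 : ℝ) ≤ k := k.cast_nonneg
    have h6 := mul_le_mul_of_nonneg_left h5.le hk0
    push_cast at h2 h3
    have h7 : η * k ≤ η * (k * N) :=
      mul_le_mul_of_nonneg_left (le_mul_of_one_le_right hk0 hN1) hηpos.le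
    have h8 : 0 ≤ N * C₁ := by positivity
    nlinarith
  have hpos : (0 : ℝ) < N * (lam + 3 * η) := by positivity
  filter_upwards [eventually_exists_le_mul (max s₀ (s₁ N)) hpos (by positivity) hD hW
    (half_pos hε)] with s hs
  obtain ⟨k, hk1, hk2⟩ := hs
  refine (htel k s hk1).trans (ENNReal.ofReal_le_ofReal (Real.exp_le_exp.2 (hk2.trans ?_)))
  have hN0 : (N : ℝ) ≠ 0 := by linarith
  rw [mul_div_mul_left _ _ hN0, neg_le_neg_iff]
  exact mul_le_mul_of_nonneg_left (by linarith) s.cast_nonneg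

end FibreDecay

/-! ### Grids -/

section Grid

/-- A map `κ` to cells such that points of the same cell are `R`-neighbours, and `R`-neighbours lie
in adjacent cells, each cell being adjacent to at most `C` others. -/
structure IsGrid {Z K : Type*} (R : Z → Set Z) (κ : Z → K) (adj : K → K → Prop) (C : ℕ) : Prop where
  encard_le : ∀ j, {i | adj i j}.encard ≤ C
  mem_of_eq : ∀ z z', κ z = κ z' → z' ∈ R z
  adj_of_mem : ∀ z z', z' ∈ R z → adj (κ z) (κ z')

theorem encard_pi_le {ι : Type*} [Fintype ι] [DecidableEq ι] {K : ι → Type*} {s : ∀ b, Set (K b)}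
    {C : ι → ℕ} (h : ∀ b, (s b).encard ≤ C b) : {z : ∀ b, K b | ∀ b, z b ∈ s b}.encard ≤ (∏ b, C b : ℕ) := by
  have hfin : ∀ b, (s b).Finite := fun b => Set.finite_of_encard_le_coe (h b)
  have heq : {z : ∀ b, K b | ∀ b, z b ∈ s b} =
      (Fintype.piFinset fun b => (hfin b).toFinset : Finset (∀ b, K b)) := by
    ext z
    simp
  rw [heq, Set.encard_coe_eq_coe_finsetCard, Fintype.card_piFinset]
  refine Nat.cast_le.2 (Finset.prod_le_prod' fun b _ => ?_)
  have := h b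
  rw [(hfin b).encard_eq_coe_toFinset_card] at this
  exact_mod_cast this

/-- Cubes of side `r / q` have diameter at most `r`, and a ball of radius `r` reaches at most `q +
1` cubes away in each direction. The constant does not depend on `r`. -/
theorem exists_isGrid_closedBall (q : ℕ) : ∃ C : ℕ, ∀ r : ℝ, 0 < r →
    ∃ (κ : EuclideanSpace ℝ (Fin q) → Fin q → ℤ) (adj : (Fin q → ℤ) → (Fin q → ℤ) → Prop),
      Measurable κ ∧ IsGrid (fun z => Metric.closedBall z r) κ adj C := by
  refine ⟨∏ _i : Fin q, (2 * (q + 1) + 1), fun r hr =>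
    ⟨fun z i => ⌊z i * q / r⌋, fun k k' => ∀ i, k i ∈ Set.Icc (k' i - (q + 1)) (k' i + (q + 1)),
    ?_, ?_, ?_, ?_⟩⟩
  · refine measurable_pi_lambda _ fun i => Int.measurable_floor.comp ?_
    have : Measurable fun z : EuclideanSpace ℝ (Fin q) => z i :=
      (EuclideanSpace.proj (𝕜 := ℝ) i).continuous.measurable
    exact (this.mul_const _).div_const _
  · intro k'
    refine encard_pi_le fun i => le_of_eq ?_
    rw [← Finset.coe_Icc, Set.encard_coe_eq_coe_finsetCard, Int.card_Icc]
    congr 1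
    omega
  · intro z z' he
    rw [Metric.mem_closedBall, EuclideanSpace.dist_eq]
    refine Real.sqrt_le_iff.2 ⟨hr.le, ?_⟩
    rcases Nat.eq_zero_or_pos q with rfl | hq
    · simp; positivity
    have hq' : (0 : ℝ) < q := by exact_mod_cast hq
    have hq1 : (1 : ℝ) ≤ q := by exact_mod_cast hq
    have hi : ∀ i, dist (z' i) (z i) ^ 2 ≤ (r / q) ^ 2 := by
      intro i
      have h1 := Int.abs_sub_lt_one_of_floor_eq_floor (congrFun he i)
      have h2 : z i * q / r - z' i * q / r = (z i - z' i) * (q / r) := by ring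
      rw [h2, abs_mul, abs_of_pos (by positivity : (0 : ℝ) < q / r), ← lt_div_iff₀ (by positivity),
        one_div_div] at h1
      refine pow_le_pow_left₀ dist_nonneg ?_ 2
      rw [dist_comm, Real.dist_eq]
      exact h1.le
    refine (Finset.sum_le_sum fun i _ => hi i).trans ?_
    rw [Finset.sum_const, Finset.card_univ, Fintype.card_fin, nsmul_eq_mul, div_pow]
    rw [mul_div_assoc', div_le_iff₀ (by positivity)]
    have : (q : ℝ) ≤ q ^ 2 := by nlinarith
    nlinarith [sq_nonneg r]
  · intro z z' hz i
    rw [Metric.mem_closedBall] at hz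
    have hq' : (0 : ℝ) ≤ q := q.cast_nonneg
    have h1 : |z' i - z i| ≤ r := by
      rw [← Real.dist_eq]
      exact (EuclideanSpace.dist_eq z' z ▸ Real.le_sqrt_of_sq_le (Finset.single_le_sum
        (f := fun i => dist (z' i) (z i) ^ 2) (fun _ _ => sq_nonneg _) (Finset.mem_univ i)) :
          dist (z' i) (z i) ≤ dist z' z).trans hz
    have h2 : |z' i * q / r - z i * q / r| ≤ q := by
      have h2 : z' i * q / r - z i * q / r = (z' i - z i) * (q / r) := by ring
      rw [h2, abs_mul, abs_of_nonneg (by positivity : (0 : ℝ) ≤ q / r)]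
      refine (mul_le_mul_of_nonneg_right h1 (by positivity)).trans_eq ?_
      field_simp
    rw [abs_le] at h2
    have f1 := Int.floor_le (z i * q / r)
    have f2 := Int.lt_floor_add_one (z i * q / r)
    have f3 := Int.floor_le (z' i * q / r)
    have f4 := Int.lt_floor_add_one (z' i * q / r)
    constructor
    · have : ((⌊z' i * q / r⌋ : ℤ) : ℝ) - (q + 1) < (⌊z i * q / r⌋ : ℤ) := by linarith
      have : (⌊z' i * q / r⌋ : ℤ) - ((q : ℤ) + 1) < ⌊z i * q / r⌋ := by exact_mod_cast this
      exact this.le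
    · have : ((⌊z i * q / r⌋ : ℤ) : ℝ) < (⌊z' i * q / r⌋ : ℤ) + (q + 1) := by linarith
      have : (⌊z i * q / r⌋ : ℤ) < ⌊z' i * q / r⌋ + ((q : ℤ) + 1) := by exact_mod_cast this
      exact this.le

variable {ι : Type*} [Fintype ι]

/-- The product of the closed balls of radii `r b` about the coordinates of `z`. -/
def box {E : ι → Type*} [∀ b, PseudoMetricSpace (E b)] (r : ι → ℝ) (z : ∀ b, E b) : Set (∀ b, E b) :=
  {z' | ∀ b, dist (z' b) (z b) ≤ r b}

theorem measurableSet_box {E : ι → Type*} [∀ b, PseudoMetricSpace (E b)]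
    [∀ b, SecondCountableTopology (E b)] [∀ b, MeasurableSpace (E b)] [∀ b, BorelSpace (E b)]
    (r : ι → ℝ) : MeasurableSet {q : (∀ b, E b) × (∀ b, E b) | q.2 ∈ box r q.1} := by
  have : {q : (∀ b, E b) × (∀ b, E b) | q.2 ∈ box r q.1} = ⋂ b, {q | dist (q.2 b) (q.1 b) ≤ r b} := by
    ext q
    simp [box]
  rw [this]
  refine MeasurableSet.iInter fun b => measurableSet_le ?_ measurable_const
  exact ((measurable_pi_apply b).comp measurable_snd).dist
    ((measurable_pi_apply b).comp measurable_fst)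

theorem exists_isGrid_box [DecidableEq ι] (q : ι → ℕ) : ∃ C : ℕ, ∀ r : ι → ℝ, (∀ b, 0 < r b) →
    ∃ (κ : (∀ b, EuclideanSpace ℝ (Fin (q b))) → ∀ b, Fin (q b) → ℤ)
      (adj : (∀ b, Fin (q b) → ℤ) → (∀ b, Fin (q b) → ℤ) → Prop),
      Measurable κ ∧ IsGrid (box r) κ adj C := by
  choose C hC using fun b => exists_isGrid_closedBall (q b)
  refine ⟨∏ b, C b, fun r hr => ?_⟩
  choose κ adj hκ hg using fun b => hC b (r b) (hr b)
  refine ⟨fun z b => κ b (z b), fun k k' => ∀ b, adj b (k b) (k' b), ?_, ?_, ?_, ?_⟩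
  · exact measurable_pi_lambda _ fun b => (hκ b).comp (measurable_pi_apply b)
  · exact fun j => encard_pi_le fun b => (hg b).encard_le (j b)
  · exact fun z z' he b => (hg b).mem_of_eq _ _ (congrFun he b)
  · exact fun z z' hz b => (hg b).adj_of_mem _ _ (hz b)

end Grid

/-! ### Measures of products and fibre measures -/

section Chebyshev

variable {Ω F E : Type*} [mΩ : MeasurableSpace Ω] [mF : MeasurableSpace F] [MeasurableSpace E]
  {m : Measure Ω} [IsProbabilityMeasure m]

/-- The functions `e^{-aL} f L` have a summable sequence of integrals, so they tend to zero almost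
everywhere; countably many rates `a` suffice. -/
theorem ae_eventually_le_exp {f : ℕ → Ω → ℝ≥0∞} (hf : ∀ L, Measurable (f L)) {K : ℝ≥0∞}
    (hK : K ≠ ∞) (h : ∀ L, ∫⁻ x, f L x ∂m ≤ K) :
    ∀ᵐ x ∂m, ∀ η : ℝ, 0 < η → ∀ᶠ L : ℕ in atTop, f L x ≤ ENNReal.ofReal (Real.exp (η * L)) := by
  have key : ∀ k : ℕ, ∀ᵐ x ∂m, ∀ᶠ L : ℕ in atTop,
      f L x ≤ ENNReal.ofReal (Real.exp (1 / ((k : ℝ) + 1) * L)) := by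
    intro k
    set a : ℝ := 1 / ((k : ℝ) + 1)
    have ha : 0 < a := by positivity
    have hm : ∀ L : ℕ, Measurable fun x => ENNReal.ofReal (Real.exp (-(a * L))) * f L x :=
      fun L => (hf L).const_mul _
    have hint : ∫⁻ x, ∑' L : ℕ, ENNReal.ofReal (Real.exp (-(a * L))) * f L x ∂m ≠ ∞ := by
      rw [lintegral_tsum fun L => (hm L).aemeasurable]
      simp_rw [lintegral_const_mul _ (hf _)]
      refine ne_top_of_le_ne_top ?_ (ENNReal.tsum_le_tsum fun L => mul_le_mul' le_rfl (h L))
      rw [ENNReal.tsum_mul_right]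
      refine ENNReal.mul_ne_top ?_ hK
      have hs : Summable fun L : ℕ => Real.exp (-(a * L)) := by
        have := Real.summable_exp_nat_mul_iff.2 (neg_lt_zero.2 ha)
        refine this.congr fun L => ?_
        congr 1; ring
      rw [← ENNReal.ofReal_tsum_of_nonneg (fun _ => (Real.exp_pos _).le) hs]
      exact ENNReal.ofReal_ne_top
    filter_upwards [ae_lt_top (Measurable.tsum hm) hint] with x hx
    have ht := ENNReal.tendsto_atTop_zero_of_tsum_ne_top hx.ne
    filter_upwards [ht.eventually_le_const one_pos] with L hL
    have e1 : ENNReal.ofReal (Real.exp (-(a * L))) = (ENNReal.ofReal (Real.exp (a * L)))⁻¹ := by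
      rw [Real.exp_neg, ENNReal.ofReal_inv_of_pos (Real.exp_pos _)]
    rw [e1, mul_comm, ← div_eq_mul_inv, ENNReal.div_le_iff_le_mul
      (Or.inl (ENNReal.ofReal_pos.2 (Real.exp_pos _)).ne') (Or.inl ENNReal.ofReal_ne_top),
      one_mul] at hL
    exact hL
  filter_upwards [ae_all_iff.2 key] with x hx η hη
  obtain ⟨k, hk⟩ := exists_nat_one_div_lt hη
  filter_upwards [hx k] with L hL
  refine hL.trans (ENNReal.ofReal_le_ofReal (Real.exp_le_exp.2 ?_))
  gcongr

theorem measurable_measure_rel {Z : Type*} [MeasurableSpace Z] {s : Set (Z × Ω)}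
    (hs : MeasurableSet s) : Measurable fun z => m {x | (z, x) ∈ s} :=
  measurable_measure_prodMk_left hs

variable [StandardBorelSpace E] [Nonempty E]
variable {p : Ω → F} {y : Ω → E} {K : Type*} [Countable K] [MeasurableSpace K]
  [MeasurableSingletonClass K]

/-- The conditional mass of a ball given `p` may be far below the conditional mass given `p ∈ R`,
but not on average. Passing to cells, the integral along the fibre cancels the inverse fibre mass of
the cell, and the masses of the neighbourhoods of all cells sum to at most `C` times that of `R`. -/
theorem lintegral_measure_inter_mul_inv_le (hp : Measurable p) (hy : Measurable y) {R : F → Set F}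
    (hR : MeasurableSet {q : F × F | q.2 ∈ R q.1}) {R' : E → Set E} {κ : E → K}
    (hκ : Measurable κ) {adj : K → K → Prop} {C : ℕ} (hg : IsGrid R' κ adj C) :
    ∫⁻ x, m {x' | p x' ∈ R (p x) ∧ y x' ∈ R' (y x)} * (m {x' | p x' ∈ R (p x)})⁻¹ *
      (fibreKernel m p y (p x) (R' (y x)))⁻¹ ∂m ≤ C := by
  let cell : K → Set E := fun j => κ ⁻¹' {j}
  let nbr : K → Set E := fun j => κ ⁻¹' {j' | adj j j'}
  have hcell : ∀ j, MeasurableSet (cell j) := fun j => hκ (measurableSet_singleton j)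
  have hnbr : ∀ j, MeasurableSet (nbr j) := fun j => hκ (Set.to_countable _).measurableSet
  let G : K → F → ℝ≥0∞ := fun j z => m {x' | p x' ∈ R z ∧ y x' ∈ nbr j} *
    (m {x' | p x' ∈ R z})⁻¹ * (fibreKernel m p y z (cell j))⁻¹
  have hRp : MeasurableSet {q : F × Ω | p q.2 ∈ R q.1} :=
    (measurable_fst.prodMk (hp.comp measurable_snd)) hR
  have hm1 : ∀ j, Measurable fun z => m {x' | p x' ∈ R z ∧ y x' ∈ nbr j} := fun j =>
    measurable_measure_rel (s := {q : F × Ω | p q.2 ∈ R q.1 ∧ y q.2 ∈ nbr j})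
      (hRp.inter ((hy.comp measurable_snd) (hnbr j)))
  have hm2 : Measurable fun z => m {x' | p x' ∈ R z} := measurable_measure_rel hRp
  have hm3 : ∀ j, Measurable fun z => fibreKernel m p y z (cell j) := fun j =>
    (fibreKernel m p y).measurable_coe (hcell j)
  have hG : ∀ j, Measurable (G j) := fun j => ((hm1 j).mul hm2.inv).mul (hm3 j).inv
  have hk : ∀ j, Measurable fun q : F × E => (cell j).indicator (1 : E → ℝ≥0∞) q.2 * G j q.1 :=
    fun j => ((measurable_one.indicator (hcell j)).comp measurable_snd).mul
      ((hG j).comp measurable_fst)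
  calc _ ≤ ∫⁻ x, ∑' j, (cell j).indicator (1 : E → ℝ≥0∞) (y x) * G j (p x) ∂m := by
        refine lintegral_mono fun x => ?_
        refine le_trans ?_ (ENNReal.le_tsum (κ (y x)))
        have : (cell (κ (y x))).indicator (1 : E → ℝ≥0∞) (y x) = 1 := by simp [cell]
        rw [this, one_mul]
        refine mul_le_mul' (mul_le_mul' (measure_mono ?_) le_rfl)
          (ENNReal.inv_le_inv.2 (measure_mono ?_))
        · rintro x' ⟨h1, h2⟩
          exact ⟨h1, hg.adj_of_mem _ _ h2⟩
        · intro y' hy'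
          exact hg.mem_of_eq _ _ (Eq.symm hy')
    _ = ∑' j, ∫⁻ x, (cell j).indicator (1 : E → ℝ≥0∞) (y x) * G j (p x) ∂m :=
        lintegral_tsum fun j => ((hk j).comp (hp.prodMk hy)).aemeasurable
    _ = ∑' j, ∫⁻ x, fibreKernel m p y (p x) (cell j) * G j (p x) ∂m := by
        refine tsum_congr fun j => ?_
        rw [← lintegral_fibreKernel hp hy (hk j)]
        refine lintegral_congr fun x => ?_
        change ∫⁻ y', (cell j).indicator 1 y' * G j (p x) ∂_ = _
        rw [lintegral_mul_const _ (measurable_one.indicator (hcell j)),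
          lintegral_indicator_one (hcell j)]
    _ ≤ ∑' j, ∫⁻ x, m {x' | p x' ∈ R (p x) ∧ y x' ∈ nbr j} * (m {x' | p x' ∈ R (p x)})⁻¹ ∂m := by
        refine ENNReal.tsum_le_tsum fun j => lintegral_mono fun x => ?_
        simp only [G]
        rw [mul_comm, mul_assoc]
        exact mul_le_of_le_one_right' (ENNReal.inv_mul_le_one _)
    _ = ∫⁻ x, ∑' j, m {x' | p x' ∈ R (p x) ∧ y x' ∈ nbr j} * (m {x' | p x' ∈ R (p x)})⁻¹ ∂m :=
        (lintegral_tsum fun j => (((hm1 j).mul hm2.inv).comp hp).aemeasurable).symm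
    _ ≤ ∫⁻ _, C ∂m := by
        refine lintegral_mono fun x => ?_
        have hs : MeasurableSet {x' | p x' ∈ R (p x)} :=
          (measurable_prodMk_left (x := p x)) hRp
        have h1 := tsum_measure_adj_le (m := m.restrict {x' | p x' ∈ R (p x)}) (hκ.comp hy)
          hg.encard_le
        have h2 : ∀ j, m.restrict {x' | p x' ∈ R (p x)} ((κ ∘ y) ⁻¹' {j' | adj j j'}) =
            m {x' | p x' ∈ R (p x) ∧ y x' ∈ nbr j} := by
          intro j
          change m.restrict {x' | p x' ∈ R (p x)} (y ⁻¹' nbr j) = _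
          rw [Measure.restrict_apply (hy (hnbr j)), Set.inter_comm]
          rfl
        simp_rw [h2] at h1
        rw [Measure.restrict_apply_univ] at h1
        simp only
        rw [ENNReal.tsum_mul_right]
        refine (mul_le_mul' h1 le_rfl).trans ?_
        rw [mul_assoc]
        exact mul_le_of_le_one_right' (ENNReal.mul_inv_le_one _)
    _ = C := by simp

end Chebyshev

/-! ### Information given maps with the same fibres -/

section SameSigma

variable {Ω F F' A : Type*} [mΩ : MeasurableSpace Ω] [mF : MeasurableSpace F]
  [mF' : MeasurableSpace F'] {m : Measure Ω} [IsProbabilityMeasure m]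
  [Fintype A] [MeasurableSpace A] [MeasurableSingletonClass A] {P : Ω → A} {T : Ω → Ω}

/-- Information depends only on the generated `σ`-algebra. This allows passage between pairs, tuples
completed by zeros, and coding maps of sub-products. -/
theorem atomInfo_ae_eq_of_comap_eq {p : Ω → F} {p' : Ω → F'} (hp : Measurable p)
    (hp' : Measurable p') (hP : Measurable P) (h : mF.comap p = mF'.comap p') :
    atomInfo m p P =ᵐ[m] atomInfo m p' P := by
  have h1 := ae_all_iff.2 fun a => condExp_indicator_atom (m := m) hp hP a
  have h2 := ae_all_iff.2 fun a => condExp_indicator_atom (m := m) hp' hP a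
  rw [h] at h1
  filter_upwards [h1, h2] with x h1 h2
  have := (h1 (P x)).symm.trans (h2 (P x))
  simp only [atomInfo, atomProb, this]

theorem projInfo_ae_eq_of_comap_eq (hT : Measurable T) {p : Ω → F} {p' : Ω → F'}
    (hp : Measurable p) (hp' : Measurable p') (hP : Measurable P)
    (h : mF.comap p = mF'.comap p') : projInfo m T P p =ᵐ[m] projInfo m T P p' := by
  have h1 : mF.comap (p ∘ T) = mF'.comap (p' ∘ T) := by
    rw [← MeasurableSpace.comap_comp, h, MeasurableSpace.comap_comp]
  filter_upwards [atomInfo_ae_eq_of_comap_eq (m := m) hp hp' hP h,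
    atomInfo_ae_eq_of_comap_eq (m := m) (hp.comp hT) (hp'.comp hT) hP h1] with x h1 h2
  simp only [projInfo, h1, h2]

end SameSigma

/-! ### Upper bounds for the measures of boxes -/

section LowerBound

variable {ℓ : ℕ} {ι : Type*} [Fintype ι] [DecidableEq ι] {q : ι → ℕ}

/-- The tuple of the coding maps of the systems with index in `J`, completed by zeros. -/
def maskedCoding (X : ∀ b, Set (EuclideanSpace ℝ (Fin (q b))))
    (S : ∀ b, Fin ℓ → EuclideanSpace ℝ (Fin (q b)) → EuclideanSpace ℝ (Fin (q b))) (J : Finset ι)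
    (x : ShiftSpace ℓ) : ∀ b, EuclideanSpace ℝ (Fin (q b)) :=
  fun b => if b ∈ J then codingMap (X b) (S b) x else 0

/-- The conditional expectation of the projection information of the systems with index in `J`
given the invariant sets. -/
def infoRate (m : Measure (ShiftSpace ℓ)) (X : ∀ b, Set (EuclideanSpace ℝ (Fin (q b))))
    (S : ∀ b, Fin ℓ → EuclideanSpace ℝ (Fin (q b)) → EuclideanSpace ℝ (Fin (q b))) (J : Finset ι) :
    ShiftSpace ℓ → ℝ :=
  m[projInfo m (shift ℓ) (fun x => x 0) (maskedCoding X S J) | MeasurableSpace.invariants (shift ℓ)]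

/-- The measure of the box of radii `r` about the tuple of the coding maps with index in `J`. -/
def boxMeasure (m : Measure (ShiftSpace ℓ)) (X : ∀ b, Set (EuclideanSpace ℝ (Fin (q b))))
    (S : ∀ b, Fin ℓ → EuclideanSpace ℝ (Fin (q b)) → EuclideanSpace ℝ (Fin (q b))) (J : Finset ι)
    (r : ι → ℝ) (x : ShiftSpace ℓ) : ℝ≥0∞ :=
  m {x' | maskedCoding X S J x' ∈ box r (maskedCoding X S J x)}

variable {X U : ∀ b, Set (EuclideanSpace ℝ (Fin (q b)))}
  {S : ∀ b, Fin ℓ → EuclideanSpace ℝ (Fin (q b)) → EuclideanSpace ℝ (Fin (q b))} {c : ι → ℝ≥0}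

theorem comap_le_comap_of_eq_comp {Ω G G' : Type*} [mG : MeasurableSpace G]
    [mG' : MeasurableSpace G'] {p : Ω → G} {p' : Ω → G'} {e : G → G'} (he : Measurable e)
    (h : ∀ x, p' x = e (p x)) : mG'.comap p' ≤ mG.comap p := by
  have : p' = e ∘ p := funext h
  rw [this, ← MeasurableSpace.comap_comp]
  exact MeasurableSpace.comap_mono he.comap_le

theorem measurable_maskedCoding (h : ∀ b, IsSmoothIFS (X b) (U b) (S b) (c b)) (J : Finset ι) :
    Measurable (maskedCoding X S J) := by
  refine measurable_pi_lambda _ fun b => ?_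
  by_cases hb : b ∈ J
  · simp only [maskedCoding, if_pos hb]
    exact (h b).continuous_codingMap.measurable
  · simp only [maskedCoding, if_neg hb]
    exact measurable_const

theorem exists_maskedCoding_maps (h : ∀ b, IsSmoothIFS (X b) (U b) (S b) (c b)) (J : Finset ι) :
    ∃ φ ψ : Fin ℓ → (∀ b, EuclideanSpace ℝ (Fin (q b))) → ∀ b, EuclideanSpace ℝ (Fin (q b)),
      (∀ a, Measurable (φ a)) ∧ (∀ a, Measurable (ψ a)) ∧
      (∀ x, maskedCoding X S J x = φ (x 0) (maskedCoding X S J (shift ℓ x))) ∧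
      (∀ x, maskedCoding X S J (shift ℓ x) = ψ (x 0) (maskedCoding X S J x)) := by
  have hScont : ∀ b a, ContinuousOn (S b a) (X b) := fun b a => ((h b).lipschitz a).continuousOn
  choose ζ hζ hζS using fun b a => exists_measurable_leftInverse (h b).isCompact (hScont b a)
    (((h b).injOn a).mono (h b).subset)
  refine ⟨fun a z b => if b ∈ J then (X b).indicator (S b a) (z b) else 0,
    fun a z b => if b ∈ J then ζ b a (z b) else 0, fun a => ?_, fun a => ?_, fun x => ?_,
    fun x => ?_⟩
  · refine measurable_pi_lambda _ fun b => ?_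
    by_cases hb : b ∈ J
    · simp only [if_pos hb]
      exact (measurable_indicator_of_continuousOn (h b).isCompact (hScont b a)).comp
        (measurable_pi_apply b)
    · simp only [if_neg hb]
      exact measurable_const
  · refine measurable_pi_lambda _ fun b => ?_
    by_cases hb : b ∈ J
    · simp only [if_pos hb]
      exact (hζ b a).comp (measurable_pi_apply b)
    · simp only [if_neg hb]
      exact measurable_const
  · funext b
    by_cases hb : b ∈ J
    · simp only [maskedCoding, if_pos hb]
      rw [Set.indicator_of_mem ((h b).codingMap_mem _)]
      exact (h b).codingMap_eq x
    · simp only [maskedCoding, if_neg hb]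
  · funext b
    by_cases hb : b ∈ J
    · simp only [maskedCoding, if_pos hb]
      rw [(h b).codingMap_eq x, hζS _ _ _ ((h b).codingMap_mem _)]
    · simp only [maskedCoding, if_neg hb]

theorem comap_maskedCoding_insert {J : Finset ι} {b : ι} (hb : b ∉ J) :
    MeasurableSpace.comap (fun x => (maskedCoding X S J x, codingMap (X b) (S b) x)) inferInstance =
      MeasurableSpace.comap (maskedCoding X S (insert b J)) inferInstance := by
  refine le_antisymm ?_ ?_
  · refine comap_le_comap_of_eq_comp
      (e := fun z => ((fun a => if a ∈ J then z a else 0), z b)) ?_ fun x => ?_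
    · refine Measurable.prodMk (measurable_pi_lambda _ fun a => ?_) (measurable_pi_apply b)
      by_cases ha : a ∈ J
      · simp only [if_pos ha]; exact measurable_pi_apply a
      · simp only [if_neg ha]; exact measurable_const
    · refine Prod.ext (funext fun a => ?_) ?_
      · by_cases ha : a ∈ J <;> simp [maskedCoding, ha]
      · simp [maskedCoding]
  · refine comap_le_comap_of_eq_comp
      (e := fun z : (∀ b, EuclideanSpace ℝ (Fin (q b))) × EuclideanSpace ℝ (Fin (q b)) =>
        Function.update z.1 b z.2) ?_ fun x => ?_
    · refine measurable_pi_lambda _ fun a => ?_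
      by_cases ha : a = b
      · subst ha
        simpa using measurable_snd
      · simp only [Function.update_of_ne ha]
        exact (measurable_pi_apply a).comp measurable_fst
    · funext a
      by_cases ha : a = b
      · subst ha
        simp [maskedCoding]
      · simp [maskedCoding, ha]

variable {m : Measure (ShiftSpace ℓ)} [IsProbabilityMeasure m]

theorem infoRate_empty : infoRate m X S ∅ = 0 := by
  have : projInfo m (shift ℓ) (fun x => x 0) (maskedCoding X S ∅) = 0 := by
    have h1 : maskedCoding X S ∅ ∘ shift ℓ = maskedCoding X S ∅ := by
      funext x b
      simp [maskedCoding]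
    funext x
    simp only [projInfo, h1, sub_self, Pi.zero_apply]
  rw [infoRate, this]
  exact condExp_zero

theorem boxMeasure_empty {r : ι → ℝ} (hr : ∀ b, 0 ≤ r b) (x : ShiftSpace ℓ) :
    boxMeasure m X S ∅ r x = 1 := by
  have : {x' | maskedCoding X S ∅ x' ∈ box r (maskedCoding X S ∅ x)} = Set.univ := by
    ext x'
    simp [box, maskedCoding, hr]
  rw [boxMeasure, this, measure_univ]

theorem measurable_boxMeasure (h : ∀ b, IsSmoothIFS (X b) (U b) (S b) (c b)) (J : Finset ι)
    (r : ι → ℝ) : Measurable (boxMeasure m X S J r) := by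
  have hp := measurable_maskedCoding h J
  exact measurable_measure_rel (s := {p : ShiftSpace ℓ × ShiftSpace ℓ |
    maskedCoding X S J p.2 ∈ box r (maskedCoding X S J p.1)})
    (((hp.comp measurable_fst).prodMk (hp.comp measurable_snd)) (measurableSet_box r))

theorem boxMeasure_insert {J : Finset ι} {b : ι} (hb : b ∉ J) {r : ι → ℝ} (hr : ∀ b, 0 ≤ r b)
    (x : ShiftSpace ℓ) : boxMeasure m X S (insert b J) r x =
      m {x' | maskedCoding X S J x' ∈ box r (maskedCoding X S J x) ∧
        codingMap (X b) (S b) x' ∈ Metric.closedBall (codingMap (X b) (S b) x) (r b)} := by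
  rw [boxMeasure]
  congr 1
  ext x'
  simp only [Set.mem_ofPred_eq, box, maskedCoding, Metric.mem_closedBall]
  constructor
  · intro hx
    refine ⟨fun a => ?_, by simpa using hx b⟩
    by_cases ha : a ∈ J
    · simpa [ha] using hx a
    · simpa [ha] using hr a
  · rintro ⟨h1, h2⟩ a
    by_cases hab : a = b
    · subst hab; simpa using h2
    · simpa [hab] using h1 a

/-- The mean of the quotient is bounded uniformly in `L`, hence almost surely the quotient grows
subexponentially. -/
theorem ae_boxMeasure_insert_le (h : ∀ b, IsSmoothIFS (X b) (U b) (S b) (c b)) {J : Finset ι}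
    {b : ι} (hb : b ∉ J) : ∀ᵐ x ∂m, ∀ η : ℝ, 0 < η → ∀ᶠ L : ℕ in atTop,
      boxMeasure m X S (insert b J) (fun _ => Real.exp (-(L : ℝ))) x ≤
        ENNReal.ofReal (Real.exp (η * L)) *
          (boxMeasure m X S J (fun _ => Real.exp (-(L : ℝ))) x *
          fibreKernel m (maskedCoding X S J) (codingMap (X b) (S b)) (maskedCoding X S J x)
            (Metric.closedBall (codingMap (X b) (S b) x) (Real.exp (-(L : ℝ))))) := by
  obtain ⟨C, hC⟩ := exists_isGrid_closedBall (q b)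
  have hp := measurable_maskedCoding h J
  have hy : Measurable (codingMap (X b) (S b)) := (h b).continuous_codingMap.measurable
  have hint : ∀ L : ℕ, ∫⁻ x, boxMeasure m X S (insert b J) (fun _ => Real.exp (-(L : ℝ))) x *
      (boxMeasure m X S J (fun _ => Real.exp (-(L : ℝ))) x)⁻¹ *
      (fibreKernel m (maskedCoding X S J) (codingMap (X b) (S b)) (maskedCoding X S J x)
        (Metric.closedBall (codingMap (X b) (S b) x) (Real.exp (-(L : ℝ)))))⁻¹ ∂m ≤ C := by
    intro L
    obtain ⟨κ, adj, hκ, hg⟩ := hC (Real.exp (-(L : ℝ))) (Real.exp_pos _)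
    have := lintegral_measure_inter_mul_inv_le (m := m) hp hy
      (measurableSet_box fun _ => Real.exp (-(L : ℝ))) hκ hg
    simp_rw [boxMeasure_insert hb fun _ => (Real.exp_pos _).le]
    exact this
  have hmeas : ∀ L : ℕ, Measurable fun x =>
      boxMeasure m X S (insert b J) (fun _ => Real.exp (-(L : ℝ))) x *
      (boxMeasure m X S J (fun _ => Real.exp (-(L : ℝ))) x)⁻¹ *
      (fibreKernel m (maskedCoding X S J) (codingMap (X b) (S b)) (maskedCoding X S J x)
        (Metric.closedBall (codingMap (X b) (S b) x) (Real.exp (-(L : ℝ)))))⁻¹ := by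
    intro L
    refine ((measurable_boxMeasure h _ _).mul (measurable_boxMeasure h _ _).inv).mul
      (Measurable.inv ?_)
    exact (measurable_kernel_closedBall (fibreKernel m (maskedCoding X S J) (codingMap (X b) (S b)))
      (Real.exp (-(L : ℝ)))).comp (hp.prodMk hy)
  filter_upwards [ae_eventually_le_exp hmeas (ENNReal.natCast_ne_top C) hint] with x hx η hη
  filter_upwards [hx η hη] with L hL
  have hne : boxMeasure m X S J (fun _ => Real.exp (-(L : ℝ))) x ≠ ∞ := measure_ne_top _ _
  rw [← div_eq_mul_inv, ← div_eq_mul_inv, ENNReal.div_le_iff_le_mul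
    (Or.inr ENNReal.ofReal_ne_top) (Or.inl (measure_ne_top _ _)), ENNReal.div_le_iff_le_mul
    (Or.inr (ENNReal.mul_ne_top ENNReal.ofReal_ne_top (measure_ne_top _ _))) (Or.inl hne)] at hL
  refine hL.trans_eq ?_
  ring

theorem ae_fibreKernel_maskedCoding_le [∀ b, NeZero (q b)]
    (h : ∀ b, IsSmoothIFS (X b) (U b) (S b) (c b)) (hm : MeasurePreserving (shift ℓ) m m)
    (hconf : ∀ b, IsConformalFor m (X b) (S b)) {J : Finset ι} {b : ι} (hb : b ∉ J) :
    ∀ᵐ x ∂m, ∀ ε : ℝ, 0 < ε → ∀ᶠ L : ℕ in atTop,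
      fibreKernel m (maskedCoding X S J) (codingMap (X b) (S b)) (maskedCoding X S J x)
        (Metric.closedBall (codingMap (X b) (S b) x) (Real.exp (-(L : ℝ)))) ≤
      ENNReal.ofReal (Real.exp (-(L * ((infoRate m X S (insert b J) x - infoRate m X S J x) /
        upperLyapunov (X b) (S b) x - ε)))) := by
  obtain ⟨φ, ψ, hφ, hψ, hpφ, hpψ⟩ := exists_maskedCoding_maps h J
  have hp := measurable_maskedCoding h J
  have hy : Measurable (codingMap (X b) (S b)) := (h b).continuous_codingMap.measurable
  have h1 := (h b).ae_fibreKernel_closedBall_le hm (hconf b) hp hφ hψ hpφ hpψ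
  have h2 := condExp_congr_ae (m := MeasurableSpace.invariants (shift ℓ))
    (projInfo_ae_eq_of_comap_eq (m := m) (P := fun x : ShiftSpace ℓ => x 0) hm.measurable
      (hp.prodMk hy) (measurable_maskedCoding h (insert b J)) (measurable_pi_apply 0)
      (comap_maskedCoding_insert hb))
  filter_upwards [h1, h2] with x h1 h2
  rw [h2] at h1
  exact h1

/-- The measures of boxes decay at least at the rate predicted by the dimension formula. -/
theorem ae_boxMeasure_le [∀ b, NeZero (q b)]
    (h : ∀ b, IsSmoothIFS (X b) (U b) (S b) (c b)) (hm : MeasurePreserving (shift ℓ) m m)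
    (hconf : ∀ b, IsConformalFor m (X b) (S b)) (J : ℕ → Finset ι) (b : ℕ → ι) (k : ℕ)
    (hJ0 : J 0 = ∅) (hJ : ∀ j < k, J (j + 1) = insert (b j) (J j)) (hb : ∀ j < k, b j ∉ J j) :
    ∀ᵐ x ∂m, ∀ ε : ℝ, 0 < ε → ∀ᶠ L : ℕ in atTop,
      boxMeasure m X S (J k) (fun _ => Real.exp (-(L : ℝ))) x ≤
      ENNReal.ofReal (Real.exp (-(L * (∑ j ∈ Finset.range k,
        (infoRate m X S (J (j + 1)) x - infoRate m X S (J j) x) /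
        upperLyapunov (X (b j)) (S (b j)) x - ε)))) := by
  -- Factors are added one at a time; no order of the exponents is needed for this bound.
  induction k with
  | zero =>
    refine Eventually.of_forall fun x ε hε => Eventually.of_forall fun L => ?_
    rw [hJ0, boxMeasure_empty fun _ => (Real.exp_pos _).le]
    simp only [Finset.range_zero, Finset.sum_empty, zero_sub, mul_neg, neg_neg]
    rw [ENNReal.one_le_ofReal]
    exact Real.one_le_exp (by positivity)
  | succ k ih =>
    have h1 := ae_boxMeasure_insert_le (m := m) h (hb k (by omega))
    have h2 := ae_fibreKernel_maskedCoding_le h hm hconf (hb k (by omega))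
    filter_upwards [ih (fun j hj => hJ j (by omega)) fun j hj => hb j (by omega), h1, h2]
      with x ih h1 h2 ε hε
    filter_upwards [ih (ε / 3) (by positivity), h1 (ε / 3) (by positivity),
      h2 (ε / 3) (by positivity)] with L ih h1 h2
    rw [hJ k (by omega)]
    refine (h1.trans (mul_le_mul' le_rfl (mul_le_mul' ih h2))).trans_eq ?_
    rw [← ENNReal.ofReal_mul (Real.exp_pos _).le, ← Real.exp_add,
      ← ENNReal.ofReal_mul (Real.exp_pos _).le, ← Real.exp_add, Finset.sum_range_succ,
      hJ k (by omega)]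
    congr 2
    ring

end LowerBound

/-! ### Comparison of the measures of neighbourhoods along orbits -/

section OrbitStep

variable {Ω F A : Type*} [mΩ : MeasurableSpace Ω] [mF : MeasurableSpace F]
variable {m : Measure Ω} [IsProbabilityMeasure m] {T : Ω → Ω} {p : Ω → F} {P : Ω → A}
variable [Fintype A] [MeasurableSpace A] [MeasurableSingletonClass A]

/-- The information lost when the future is replaced by `N` symbols. -/
def markovError (m : Measure Ω) (T : Ω → Ω) (P : Ω → A) (N : ℕ) (x : Ω) : ℝ :=
  atomInfo m (itinerary T P N ∘ T) P x - atomInfo m T P x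

theorem measurable_markovError (hT : Measurable T) (hP : Measurable P) (N : ℕ) :
    Measurable (markovError m T P N) :=
  (measurable_atomInfo ((measurable_itinerary hT hP N).comp hT) hP).sub (measurable_atomInfo hT hP)

theorem integrable_markovError (hT : Measurable T) (hP : Measurable P) (N : ℕ) :
    Integrable (markovError m T P N) m :=
  (integrable_atomInfo ((measurable_itinerary hT hP N).comp hT) hP).sub (integrable_atomInfo hT hP)

theorem atomProb_eq_ofReal_exp {G : Type*} [MeasurableSpace G] {q : Ω → G} {x : Ω}
    (h : 0 < atomProb m q P x) : atomProb m q P x = ENNReal.ofReal (Real.exp (-atomInfo m q P x)) := by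
  have h1 := atomProb_ne_top (m := m) (p := q) (P := P) x
  rw [atomInfo, neg_neg, Real.exp_log (ENNReal.toReal_pos h.ne' h1), ENNReal.ofReal_toReal h1]

theorem ofReal_exp_inv (a : ℝ) :
    (ENNReal.ofReal (Real.exp a))⁻¹ = ENNReal.ofReal (Real.exp (-a)) := by
  rw [Real.exp_neg, ENNReal.ofReal_inv_of_pos (Real.exp_pos _)]

theorem ofReal_exp_mul (a b : ℝ) : ENNReal.ofReal (Real.exp a) * ENNReal.ofReal (Real.exp b) =
    ENNReal.ofReal (Real.exp (a + b)) := by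
  rw [← ENNReal.ofReal_mul (Real.exp_pos _).le, ← Real.exp_add]

/-- In the product `m(P | T)` is compared with the probability given `N` symbols, which leaves
`markovError`; the quotient `m(P | p ∘ T) / m(P | p)` is `exp (-projInfo)`. -/
theorem ae_markovProb_mul_stepWeight (hT : Measurable T) (hp : Measurable p) (hP : Measurable P)
    (N : ℕ) : ∀ᵐ x ∂m, markovProb m T P N x * stepWeight m T p P x =
      ENNReal.ofReal (Real.exp (-(projInfo m T P p x + markovError m T P N x))) := by
  have hi := (measurable_itinerary hT hP N).comp hT
  filter_upwards [ae_markovProb_eq (m := m) hT hP N, ae_atomProb_pos (m := m) hi hP,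
    ae_atomProb_pos (m := m) hT hP, ae_atomProb_pos (m := m) hp hP,
    ae_atomProb_pos (m := m) (hp.comp hT) hP] with x h0 h1 h2 h3 h4
  rw [h0, stepWeight, atomProb_eq_ofReal_exp h1, atomProb_eq_ofReal_exp h2,
    atomProb_eq_ofReal_exp h3, atomProb_eq_ofReal_exp h4, ofReal_exp_inv, ofReal_exp_inv,
    ofReal_exp_mul, ofReal_exp_mul, ofReal_exp_mul]
  congr 2
  simp only [projInfo, markovError]
  ring

variable {K : Type*} [Countable K] [MeasurableSpace K] [MeasurableSingletonClass K]

/-- The conditional probabilities of the words given `p ∈ R` sum to at most `1`, and they are the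
test function in `lintegral_word_mul_prod_le`. -/
theorem lintegral_word_ratio_le (hT : MeasurePreserving T m m) (hp : Measurable p)
    (hP : Measurable P) {φ : A → F → F} (hφ : ∀ a, Measurable (φ a))
    (hpφ : ∀ x, p x = φ (P x) (p (T x))) {R : F → Set F}
    (hR : MeasurableSet {q : F × F | q.2 ∈ R q.1}) (n : ℕ) :
    ∫⁻ x, m (itinerary T P n ⁻¹' {itinerary T P n x} ∩ {x' | p x' ∈ R (p x)}) *
      (m {x' | p x' ∈ R (p x)})⁻¹ * ∏ i ∈ Finset.range n, stepWeight m T p P (T^[i] x) ∂m ≤ 1 := by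
  have hin := measurable_itinerary hT.measurable hP n
  have hRp : MeasurableSet {q : F × Ω | p q.2 ∈ R q.1} :=
    (measurable_fst.prodMk (hp.comp measurable_snd)) hR
  let k : (Fin n → A) → F → ℝ≥0∞ := fun w z =>
    m (itinerary T P n ⁻¹' {w} ∩ {x' | p x' ∈ R z}) * (m {x' | p x' ∈ R z})⁻¹
  have hk : ∀ w, Measurable (k w) := fun w => by
    refine Measurable.mul ?_ (measurable_measure_rel hRp).inv
    exact measurable_measure_rel (s := {q : F × Ω | itinerary T P n q.2 = w ∧ p q.2 ∈ R q.1})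
      (((hin.comp measurable_snd) (measurableSet_singleton w)).inter hRp)
  refine (lintegral_word_mul_prod_le hT hp hP hφ hpφ n hk).trans ?_
  have h1 : ∀ z, MeasurableSet {x' | p x' ∈ R z} := fun z =>
    (measurable_prodMk_left (x := z)) hRp
  calc ∫⁻ x, ∑ w, k w (p x) ∂m ≤ ∫⁻ _, 1 ∂m := by
        refine lintegral_mono fun x => ?_
        simp only [k]
        rw [← Finset.sum_mul, sum_measure_inter_atom hin (h1 (p x))]
        exact ENNReal.mul_inv_le_one _
    _ = 1 := by simp

/-- The mass of `V` at time `t`, times the Markov probabilities of the word from `s` to `t`, is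
bounded by the mass of the word followed by `V`. By the assumed inclusion this is at most the mass
of the word inside `R`, and with the step weights this is bounded by the mass of `R`. Both bounds
hold up to `e^{ηL/2}`, by invariance and the two integral estimates. -/
theorem ae_eventually_measure_le_exp_mul (hT : MeasurePreserving T m m) (hp : Measurable p)
    (hP : Measurable P) {φ : A → F → F} (hφ : ∀ a, Measurable (φ a))
    (hpφ : ∀ x, p x = φ (P x) (p (T x))) {R : ℕ → F → Set F}
    (hR : ∀ L, MeasurableSet {q : F × F | q.2 ∈ R L q.1}) {V : ℕ → Ω → Set Ω}
    (hV : ∀ L, MeasurableSet {q : Ω × Ω | q.2 ∈ V L q.1}) {κ : ℕ → Ω → K}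
    (hκ : ∀ L, Measurable (κ L)) {adj : ℕ → K → K → Prop} {C : ℕ}
    (hg : ∀ L, IsGrid (V L) (κ L) (adj L) C) (N : ℕ) {s t : ℕ → ℕ} (hst : ∀ L, s L ≤ t L) :
    ∀ᵐ x ∂m, ∀ η : ℝ, 0 < η → ∀ᶠ L : ℕ in atTop,
      (∀ x', itinerary T P (t L - s L) x' = itinerary T P (t L - s L) (T^[s L] x) →
        T^[t L - s L] x' ∈ V L (T^[t L] x) → p x' ∈ R L (p (T^[s L] x))) →
      m (V L (T^[t L] x)) ≤ ENNReal.ofReal (Real.exp (η * L + ∑ i ∈ Finset.Ico (s L) (t L),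
          (projInfo m T P p (T^[i] x) + markovError m T P N (T^[i] x)))) *
        m {x' | p x' ∈ R L (p (T^[s L] x))} := by
  have hTn : ∀ n, Measurable T^[n] := fun n => hT.measurable.iterate n
  have hin := fun n => measurable_itinerary hT.measurable hP n
  let f₁ : ℕ → Ω → ℝ≥0∞ := fun L x =>
    m (itinerary T P (t L - s L) ⁻¹' {itinerary T P (t L - s L) x} ∩ {x' | p x' ∈ R L (p x)}) *
      (m {x' | p x' ∈ R L (p x)})⁻¹ *
        ∏ i ∈ Finset.range (t L - s L), stepWeight m T p P (T^[i] x)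
  let f₂ : ℕ → Ω → ℝ≥0∞ := fun L x =>
    (∏ i ∈ Finset.range (t L - s L), markovProb m T P N (T^[i] x)) *
      m (V L (T^[t L - s L] x)) * (m (itinerary T P (t L - s L) ⁻¹' {itinerary T P (t L - s L) x} ∩
        T^[t L - s L] ⁻¹' V L (T^[t L - s L] x)))⁻¹
  have hRp : ∀ L, MeasurableSet {q : Ω × Ω | p q.2 ∈ R L (p q.1)} := fun L =>
    ((hp.comp measurable_fst).prodMk (hp.comp measurable_snd)) (hR L)
  have hitin : ∀ n, MeasurableSet {q : Ω × Ω | itinerary T P n q.2 = itinerary T P n q.1} :=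
    fun n => measurableSet_eq_fun ((hin n).comp measurable_snd) ((hin n).comp measurable_fst)
  have hf₁m : ∀ L, Measurable (f₁ L) := fun L => by
    refine Measurable.mul (Measurable.mul ?_ (measurable_measure_rel (hRp L)).inv)
      (measurable_prod_iterate hT.measurable (measurable_stepWeight hT.measurable hp hP) _)
    exact measurable_measure_rel (s := {q : Ω × Ω |
      itinerary T P (t L - s L) q.2 = itinerary T P (t L - s L) q.1 ∧ p q.2 ∈ R L (p q.1)})
      ((hitin _).inter (hRp L))
  have hf₂m : ∀ L, Measurable (f₂ L) := fun L => by
    have hmp : Measurable (markovProb m T P N) := by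
      have : Measurable fun q : A × (Fin N → A) => markovKernel m T P N q.1 q.2 :=
        Measurable.of_discrete
      exact this.comp (hP.prodMk ((hin N).comp hT.measurable))
    refine Measurable.mul (Measurable.mul (measurable_prod_iterate hT.measurable hmp _) ?_)
      (Measurable.inv ?_)
    · exact (measurable_measure_rel (hV L)).comp (hTn _)
    · exact measurable_measure_rel (s := {q : Ω × Ω |
        itinerary T P (t L - s L) q.2 = itinerary T P (t L - s L) q.1 ∧
        T^[t L - s L] q.2 ∈ V L (T^[t L - s L] q.1)})
        ((hitin _).inter ((((hTn _).comp measurable_fst).prodMk ((hTn _).comp measurable_snd))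
          (hV L)))
  have hf₁ : ∀ L, ∫⁻ x, f₁ L (T^[s L] x) ∂m ≤ 1 := fun L => by
    rw [(hT.iterate (s L)).lintegral_comp (hf₁m L)]
    exact lintegral_word_ratio_le hT hp hP hφ hpφ (hR L) _
  have hf₂ : ∀ L, ∫⁻ x, f₂ L (T^[s L] x) ∂m ≤ (Fintype.card A : ℝ≥0∞) ^ N * C := fun L => by
    rw [(hT.iterate (s L)).lintegral_comp (hf₂m L)]
    exact lintegral_prod_markovProb_le hT hP (hκ L) (hg L).encard_le (hg L).mem_of_eq
      (hg L).adj_of_mem N _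
  filter_upwards [ae_eventually_le_exp (fun L => (hf₁m L).comp (hTn _)) ENNReal.one_ne_top hf₁,
    ae_eventually_le_exp (fun L => (hf₂m L).comp (hTn _))
      (ENNReal.mul_ne_top (ENNReal.pow_ne_top (ENNReal.natCast_ne_top _))
        (ENNReal.natCast_ne_top C)) hf₂,
    ae_iterate_of_ae hT (ae_markovProb_mul_stepWeight (m := m) hT.measurable hp hP N)]
    with x h1 h2 h3 η hη
  filter_upwards [h1 (η / 2) (by positivity), h2 (η / 2) (by positivity)] with L h1 h2 hincl
  simp only [Function.comp_apply, f₁] at h1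
  simp only [Function.comp_apply, f₂] at h2
  have hts : T^[t L - s L] (T^[s L] x) = T^[t L] x := by
    rw [← Function.iterate_add_apply, Nat.sub_add_cancel (hst L)]
  rw [hts] at h2
  set n := t L - s L
  set z := T^[s L] x
  set B := m {x' | p x' ∈ R L (p z)}
  set D := m (itinerary T P n ⁻¹' {itinerary T P n z} ∩ {x' | p x' ∈ R L (p z)})
  set D' := m (itinerary T P n ⁻¹' {itinerary T P n z} ∩ T^[n] ⁻¹' V L (T^[t L] x))
  set W := ∏ i ∈ Finset.range n, stepWeight m T p P (T^[i] z)
  set M := ∏ i ∈ Finset.range n, markovProb m T P N (T^[i] z)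
  have hD : D' ≤ D := measure_mono fun x' hx' => ⟨hx'.1, hincl x' hx'.1 hx'.2⟩
  have hB : B ≠ ∞ := measure_ne_top _ _
  have hD' : D' ≠ ∞ := measure_ne_top _ _
  have hMW : M * W = (ENNReal.ofReal (Real.exp (∑ i ∈ Finset.Ico (s L) (t L),
      (projInfo m T P p (T^[i] x) + markovError m T P N (T^[i] x)))))⁻¹ := by
    simp only [M, W]
    rw [← Finset.prod_mul_distrib, ofReal_exp_inv, ← Finset.sum_neg_distrib, Real.exp_sum,
      ENNReal.ofReal_prod_of_nonneg fun _ _ => (Real.exp_pos _).le,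
      Finset.prod_Ico_eq_prod_range]
    refine Finset.prod_congr rfl fun i _ => ?_
    simp only [z]
    rw [← Function.iterate_add_apply, add_comm i, h3 (s L + i)]
  have e2 : M * m (V L (T^[t L] x)) ≤ ENNReal.ofReal (Real.exp (η / 2 * L)) * D' := by
    rw [← div_eq_mul_inv, ENNReal.div_le_iff_le_mul (Or.inr ENNReal.ofReal_ne_top)
      (Or.inl hD')] at h2
    exact h2
  have e1 : D * W ≤ ENNReal.ofReal (Real.exp (η / 2 * L)) * B := by
    rw [mul_right_comm, ← div_eq_mul_inv, ENNReal.div_le_iff_le_mul (Or.inr ENNReal.ofReal_ne_top)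
      (Or.inl hB)] at h1
    exact h1
  have e3 : m (V L (T^[t L] x)) * (M * W) ≤ ENNReal.ofReal (Real.exp (η * L)) * B := by
    calc m (V L (T^[t L] x)) * (M * W) = M * m (V L (T^[t L] x)) * W := by ring
      _ ≤ ENNReal.ofReal (Real.exp (η / 2 * L)) * D * W := 
          mul_le_mul' (e2.trans (mul_le_mul' le_rfl hD)) le_rfl
      _ = ENNReal.ofReal (Real.exp (η / 2 * L)) * (D * W) := by ring
      _ ≤ ENNReal.ofReal (Real.exp (η / 2 * L)) * (ENNReal.ofReal (Real.exp (η / 2 * L)) * B) := by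
          gcongr
      _ = _ := by
          rw [← mul_assoc, ofReal_exp_mul]
          congr 3
          ring
  rw [hMW, ← div_eq_mul_inv, ENNReal.div_le_iff_le_mul
    (Or.inl (ENNReal.ofReal_pos.2 (Real.exp_pos _)).ne') (Or.inl ENNReal.ofReal_ne_top)] at e3
  refine e3.trans_eq ?_
  rw [← ofReal_exp_mul]
  ring

end OrbitStep

/-! ### Lower bounds for the measures of boxes -/

section UpperBound

theorem iSup_comap_itinerary_shift (ℓ : ℕ) :
    ⨆ N, MeasurableSpace.comap (itinerary (shift ℓ) (fun x => x 0) N) inferInstance =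
      (inferInstance : MeasurableSpace (ShiftSpace ℓ)) := by
  refine le_antisymm (iSup_le fun N => (measurable_itinerary
    (continuous_shift ℓ).measurable (measurable_pi_apply 0) N).comap_le) ?_
  refine iSup_le fun n => le_trans ?_ (le_iSup _ (n + 1))
  refine comap_le_comap_of_eq_comp (e := fun w : Fin (n + 1) → Fin ℓ => w (Fin.last n))
    (measurable_pi_apply _) fun x => ?_
  change x n = (shift ℓ)^[n] x 0
  rw [shift_iterate_apply, zero_add]

theorem tendsto_birkhoffSum_floor_div {Ω : Type*} {T : Ω → Ω} {f : Ω → ℝ} {x : Ω} {g d : ℝ}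
    (h : Tendsto (fun n => birkhoffAverage ℝ T f n x) atTop (𝓝 g)) (hd : 0 ≤ d) :
    Tendsto (fun L : ℕ => birkhoffSum T f ⌊d * L⌋₊ x / L) atTop (𝓝 (d * g)) := by
  rcases hd.eq_or_lt with rfl | hd
  · simp
  have h1 : Tendsto (fun L : ℕ => (⌊d * (L : ℝ)⌋₊ : ℝ) / L) atTop (𝓝 d) :=
    (tendsto_nat_floor_mul_div_atTop hd.le).comp tendsto_natCast_atTop_atTop
  have h2 : Tendsto (fun L : ℕ => ⌊d * (L : ℝ)⌋₊) atTop atTop :=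
    tendsto_nat_floor_atTop.comp (tendsto_natCast_atTop_atTop.const_mul_atTop hd)
  refine (h1.mul (h.comp h2)).congr fun L => ?_
  simp only [Function.comp_apply, birkhoffAverage, smul_eq_mul]
  rcases Nat.eq_zero_or_pos ⌊d * (L : ℝ)⌋₊ with h0 | h0
  · rw [h0]; simp
  · have : (⌊d * (L : ℝ)⌋₊ : ℝ) ≠ 0 := by exact_mod_cast h0.ne'
    field_simp

/-- Abel summation: rates weighted by the lengths of time intervals become increments of rates
weighted by their end times. -/
theorem sum_mul_sub_succ (G d : ℕ → ℝ) (k : ℕ) :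
    ∑ j ∈ Finset.range k, G (j + 1) * (d j - d (j + 1)) =
      ∑ j ∈ Finset.range k, (G (j + 1) - G j) * d j + G 0 * d 0 - G k * d k := by
  induction k with
  | zero => simp
  | succ k ih =>
    rw [Finset.sum_range_succ, Finset.sum_range_succ, ih]
    ring

variable {ℓ : ℕ} {ι : Type*} [Fintype ι] [DecidableEq ι] {q : ι → ℕ}
variable {X U : ∀ b, Set (EuclideanSpace ℝ (Fin (q b)))}
  {S : ∀ b, Fin ℓ → EuclideanSpace ℝ (Fin (q b)) → EuclideanSpace ℝ (Fin (q b))} {c : ι → ℝ≥0}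

/-- Coordinates in `J` shrink from the box at time `t`. The new coordinate `b` needs no condition at
time `t`: the contraction of all of `X b` along the common word is enough. -/
theorem maskedCoding_mem_box_of_itinerary_eq (h : ∀ b, IsSmoothIFS (X b) (U b) (S b) (c b))
    {x : ShiftSpace ℓ} {s t : ℕ} {J : Finset ι} {b : ι} {r r' E : ι → ℝ}
    (hE : ∀ a, 0 ≤ E a) (hr : ∀ a, 0 ≤ r a)
    (hdist : ∀ a, ∀ u ∈ X a, dist (wordMap (S a) ((shift ℓ)^[s] x) (t - s) u)
      (codingMap (X a) (S a) ((shift ℓ)^[s] x)) ≤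
        E a * dist u (codingMap (X a) (S a) ((shift ℓ)^[t] x)))
    (hJ : ∀ a ∈ J, E a * r' a ≤ r a) (hb : E b * Metric.diam (X b) ≤ r b) {x' : ShiftSpace ℓ}
    (hx' : itinerary (shift ℓ) (fun x => x 0) (t - s) x' =
      itinerary (shift ℓ) (fun x => x 0) (t - s) ((shift ℓ)^[s] x))
    (hbox : maskedCoding X S J ((shift ℓ)^[t - s] x') ∈ box r' (maskedCoding X S J ((shift ℓ)^[t] x))) :
    maskedCoding X S (insert b J) x' ∈ box r (maskedCoding X S (insert b J) ((shift ℓ)^[s] x)) := by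
  have hword : ∀ i < t - s, x' i = (shift ℓ)^[s] x i := by
    intro i hi
    have := congrFun hx' ⟨i, hi⟩
    simp only [itinerary, shift_iterate_apply] at this
    rw [shift_iterate_apply]
    simpa using this
  have hle : ∀ a, dist (codingMap (X a) (S a) x') (codingMap (X a) (S a) ((shift ℓ)^[s] x)) ≤
      E a * dist (codingMap (X a) (S a) ((shift ℓ)^[t - s] x'))
        (codingMap (X a) (S a) ((shift ℓ)^[t] x)) := by
    intro a
    rw [← (h a).wordMap_codingMap x' (t - s), wordMap_congr (S a) hword]
    exact hdist a _ ((h a).codingMap_mem _)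
  intro a
  by_cases haJ : a ∈ J
  · have h1 := hbox a
    simp only [maskedCoding, if_pos haJ] at h1
    simp only [maskedCoding, if_pos (Finset.mem_insert_of_mem haJ)]
    exact (hle a).trans ((mul_le_mul_of_nonneg_left h1 (hE a)).trans (hJ a haJ))
  · by_cases hab : a = b
    · subst hab
      simp only [maskedCoding, if_pos (Finset.mem_insert_self _ _)]
      exact (hle a).trans ((mul_le_mul_of_nonneg_left (Metric.dist_le_diam_of_mem
        (h a).isCompact.isBounded ((h a).codingMap_mem _) ((h a).codingMap_mem _)) (hE a)).trans hb)
    · have : a ∉ insert b J := by simp [hab, haJ]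
      simp only [maskedCoding, if_neg this, dist_self]
      exact hr a

variable {m : Measure (ShiftSpace ℓ)} [IsProbabilityMeasure m]

/-- The radii grow from `e^{-KL}` at rate `α a`, so `d = K / α b` is the time, in units of `L`, at
which the radius of `b` reaches size one. Each step widens the radii by a further `e^{ηL}`, counted
by `j`, to absorb the deviation from exact contraction. -/
theorem ae_boxMeasure_step [∀ b, NeZero (q b)]
    (h : ∀ b, IsSmoothIFS (X b) (U b) (S b) (c b)) (hm : MeasurePreserving (shift ℓ) m m)
    (hconf : ∀ b, IsConformalFor m (X b) (S b)) {J J' : Finset ι} {b : ι}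
    (hJ' : J' = insert b J) (α : ι → ℝ) (hα : ∀ a, 0 < α a) {η K d d' : ℝ} (hη : 0 < η) (hK : 0 < K) (hd : d = K / α b)
    (hd' : d' ≤ d) (j : ℕ) (N : ℕ) :
    ∀ᵐ x ∂m, (∀ a, α a ≤ upperLyapunov (X a) (S a) x) → ∀ᶠ L : ℕ in atTop,
      boxMeasure m X S J (fun a => Real.exp (-(K * L - ⌊d * L⌋₊ * α a) + j * η * L))
          ((shift ℓ)^[⌊d * L⌋₊] x) ≤
        ENNReal.ofReal (Real.exp (η * L + ∑ i ∈ Finset.Ico ⌊d' * L⌋₊ ⌊d * L⌋₊,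
          (projInfo m (shift ℓ) (fun x => x 0) (maskedCoding X S J') ((shift ℓ)^[i] x) +
            markovError m (shift ℓ) (fun x => x 0) N ((shift ℓ)^[i] x)))) *
        boxMeasure m X S J'
          (fun a => Real.exp (-(K * L - ⌊d' * L⌋₊ * α a) + (j + 1) * η * L))
          ((shift ℓ)^[⌊d' * L⌋₊] x) := by
  subst hJ'
  obtain ⟨φ, ψ, hφ, hψ, hpφ, hpψ⟩ := exists_maskedCoding_maps h (insert b J)
  have hp := measurable_maskedCoding h (insert b J)
  have hp' := measurable_maskedCoding h J
  obtain ⟨C, hC⟩ := exists_isGrid_box q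
  have hst : ∀ L : ℕ, ⌊d' * L⌋₊ ≤ ⌊d * L⌋₊ := fun L => Nat.floor_le_floor (by gcongr)
  choose κ adj hκ hg using fun L : ℕ => hC
    (fun a => Real.exp (-(K * L - ⌊d * L⌋₊ * α a) + j * η * L)) fun a => Real.exp_pos _
  have hstep := ae_eventually_measure_le_exp_mul hm hp (measurable_pi_apply 0) hφ hpφ
    (R := fun L : ℕ => box fun a => Real.exp (-(K * L - ⌊d' * L⌋₊ * α a) + (j + 1) * η * L))
    (fun L => measurableSet_box _)
    (V := fun L y => {x' | maskedCoding X S J x' ∈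
      box (fun a => Real.exp (-(K * L - ⌊d * L⌋₊ * α a) + j * η * L)) (maskedCoding X S J y)})
    (fun L => ((hp'.comp measurable_fst).prodMk (hp'.comp measurable_snd)) (measurableSet_box _))
    (κ := fun L => κ L ∘ maskedCoding X S J) (fun L => (hκ L).comp hp') (adj := adj) (C := C)
    (fun L => ⟨(hg L).encard_le, fun z z' he => (hg L).mem_of_eq _ _ he,
      fun z z' hz => (hg L).adj_of_mem _ _ hz⟩) N hst
  have hdist := ae_all_iff.2 fun a => (h a).ae_exists_dist_wordMap_le hm (hconf a)
  filter_upwards [hstep, hdist] with x hstep hdist hαx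
  have hd0 : 0 < d := by rw [hd]; exact div_pos hK (hα b)
  -- The exponential error up to time `t ≤ d L` is then at most `η L / 2`; the other half of `η L`
  -- is for the constants.
  have hε : 0 < η / (2 * d) := by positivity
  choose E hE0 hE using fun a => hdist a _ hε
  have hev : ∀ᶠ L : ℕ in atTop, ∀ a, E a + Metric.diam (X a) + α a ≤ η / 2 * L :=
    eventually_all.2 fun a =>
      (tendsto_natCast_atTop_atTop.const_mul_atTop (half_pos hη)).eventually_ge_atTop _
  filter_upwards [hstep η hη, hev] with L hL hev
  refine hL fun x' hx' hbox => ?_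
  set t := ⌊d * L⌋₊ with ht
  set s := ⌊d' * L⌋₊ with hs
  have hst' : (s : ℝ) ≤ t := by exact_mod_cast hst L
  have ht1 : (t : ℝ) ≤ d * L := Nat.floor_le (by positivity)
  have ht2 : d * L - 1 < t := Nat.sub_one_lt_floor _
  have hεt : η / (2 * d) * t ≤ η / 2 * L := by
    refine (mul_le_mul_of_nonneg_left ht1 hε.le).trans_eq ?_
    field_simp
  have hslope : ∀ a, ((t : ℝ) - s) * α a ≤ (t - s) * upperLyapunov (X a) (S a) x := fun a =>
    mul_le_mul_of_nonneg_left (hαx a) (by linarith)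
  have hjη : 0 ≤ (j : ℝ) * η * L := by positivity
  refine maskedCoding_mem_box_of_itinerary_eq h (fun a => (Real.exp_pos _).le)
    (fun a => (Real.exp_pos _).le) (fun a u hu => hE a s t (hst L) u hu) (fun a _ => ?_) ?_ hx' hbox
  · rw [← Real.exp_add, Real.exp_le_exp]
    have h1 := hslope a
    have h2 := hev a
    have h3 : 0 ≤ Metric.diam (X a) := Metric.diam_nonneg
    have h4 := (hα a).le
    linarith
  · have h3 : Metric.diam (X b) ≤ Real.exp (Metric.diam (X b)) :=
      (le_add_of_nonneg_right zero_le_one).trans (Real.add_one_le_exp _)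
    refine (mul_le_mul_of_nonneg_left h3 (Real.exp_pos _).le).trans ?_
    rw [← Real.exp_add, Real.exp_le_exp]
    have h1 := hslope b
    have h2 := hev b
    have h5 : K * L - α b ≤ t * α b := by
      have h6 : d * L * α b = K * L := by
        rw [hd]
        field_simp [(hα b).ne']
      have := mul_le_mul_of_nonneg_right ht2.le (hα b).le
      rw [sub_mul, h6, one_mul] at this
      exact this
    linarith

/-- The chain starts at time `d 0 * L` with the empty index set, whose box has full measure, and
ends at time `0`. The choice `1 + kη` makes the final radius exactly `e^{-L}` after `k` widenings by
`e^{ηL}`. -/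
theorem ae_one_le_exp_mul_boxMeasure [∀ b, NeZero (q b)]
    (h : ∀ b, IsSmoothIFS (X b) (U b) (S b) (c b)) (hm : MeasurePreserving (shift ℓ) m m)
    (hconf : ∀ b, IsConformalFor m (X b) (S b)) (J : ℕ → Finset ι) (b : ℕ → ι) (k : ℕ)
    (hJ0 : J 0 = ∅) (hJ : ∀ j < k, J (j + 1) = insert (b j) (J j)) (α : ι → ℝ)
    (hα : ∀ a, 0 < α a) (hmono : ∀ j, j + 1 < k → α (b j) ≤ α (b (j + 1))) {η : ℝ} (hη : 0 < η)
    {d : ℕ → ℝ} (hd : ∀ j < k, d j = (1 + k * η) / α (b j)) (hdk : d k = 0) (N : ℕ) :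
    ∀ᵐ x ∂m, (∀ a, α a ≤ upperLyapunov (X a) (S a) x) → ∀ᶠ L : ℕ in atTop,
      1 ≤ ENNReal.ofReal (Real.exp (∑ j ∈ Finset.range k,
          (η * L + ∑ i ∈ Finset.Ico ⌊d (j + 1) * L⌋₊ ⌊d j * L⌋₊,
          (projInfo m (shift ℓ) (fun x => x 0) (maskedCoding X S (J (j + 1))) ((shift ℓ)^[i] x) +
            markovError m (shift ℓ) (fun x => x 0) N ((shift ℓ)^[i] x))))) *
        boxMeasure m X S (J k) (fun _ => Real.exp (-(L : ℝ))) x := by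
  have hK : 0 < 1 + (k : ℝ) * η := by positivity
  have hd' : ∀ j < k, d (j + 1) ≤ d j := by
    intro j hj
    rcases eq_or_lt_of_le (Nat.succ_le_of_lt hj) with he | hlt
    · rw [Nat.succ_eq_add_one] at he
      rw [he, hdk, hd j hj]
      exact (div_pos hK (hα _)).le
    · rw [hd j hj, hd (j + 1) hlt]
      exact div_le_div_of_nonneg_left hK.le (hα _) (hmono j hlt)
  have hall := ae_all_iff.2 fun j => eventually_imp_distrib_left.2 fun hj : j < k =>
    ae_boxMeasure_step h hm hconf (hJ j hj) α hα hη hK (hd j hj) (hd' j hj) j N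
  filter_upwards [hall] with x hx hαx
  have key : ∀ i ≤ k, ∀ᶠ L : ℕ in atTop,
      1 ≤ ENNReal.ofReal (Real.exp (∑ j ∈ Finset.range i,
          (η * L + ∑ i ∈ Finset.Ico ⌊d (j + 1) * L⌋₊ ⌊d j * L⌋₊,
          (projInfo m (shift ℓ) (fun x => x 0) (maskedCoding X S (J (j + 1))) ((shift ℓ)^[i] x) +
            markovError m (shift ℓ) (fun x => x 0) N ((shift ℓ)^[i] x))))) *
        boxMeasure m X S (J i)
          (fun a => Real.exp (-((1 + k * η) * L - ⌊d i * L⌋₊ * α a) + i * η * L))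
          ((shift ℓ)^[⌊d i * L⌋₊] x) := by
    intro i
    induction i with
    | zero =>
      intro _
      refine Eventually.of_forall fun L => ?_
      rw [hJ0, boxMeasure_empty fun _ => (Real.exp_pos _).le]
      simp
    | succ i ih =>
      intro hi
      filter_upwards [ih (by omega), hx i (by omega) hαx] with L h1 h2
      refine h1.trans ((mul_le_mul' le_rfl h2).trans_eq ?_)
      rw [← mul_assoc, ofReal_exp_mul, Finset.sum_range_succ]
      push_cast
      rfl
  filter_upwards [key k le_rfl] with L hL
  rw [hdk, zero_mul, Nat.floor_zero] at hL
  refine hL.trans_eq ?_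
  congr 2
  funext a
  congr 1
  push_cast
  ring

theorem ae_exp_le_boxMeasure_of_le [∀ b, NeZero (q b)]
    (h : ∀ b, IsSmoothIFS (X b) (U b) (S b) (c b)) (hm : MeasurePreserving (shift ℓ) m m)
    (hconf : ∀ b, IsConformalFor m (X b) (S b)) (J : ℕ → Finset ι) (b : ℕ → ι) (k : ℕ)
    (hJ0 : J 0 = ∅) (hJ : ∀ j < k, J (j + 1) = insert (b j) (J j)) (α : ι → ℝ)
    (hα : ∀ a, 0 < α a) (hmono : ∀ j, j + 1 < k → α (b j) ≤ α (b (j + 1))) {η : ℝ} (hη : 0 < η)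
    {d : ℕ → ℝ} (hd : ∀ j < k, d j = (1 + k * η) / α (b j)) (hdk : d k = 0) :
    ∀ᵐ x ∂m, (∀ a, α a ≤ upperLyapunov (X a) (S a) x) → ∀ᶠ L : ℕ in atTop,
      ENNReal.ofReal (Real.exp (-(L * (∑ j ∈ Finset.range k,
          (infoRate m X S (J (j + 1)) x - infoRate m X S (J j) x) * d j +
          (k * η + η * d 0 + η))))) ≤
        boxMeasure m X S (J k) (fun _ => Real.exp (-(L : ℝ))) x := by
  have hP : Measurable fun x : ShiftSpace ℓ => x 0 := measurable_pi_apply 0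
  have hd0 : ∀ j ≤ k, 0 ≤ d j := by
    intro j hj
    rcases eq_or_lt_of_le hj with rfl | hlt
    · exact hdk.ge
    · rw [hd j hlt]
      exact div_nonneg (by positivity) (hα _).le
  have b1 := ae_all_iff.2 fun N => ae_one_le_exp_mul_boxMeasure h hm hconf J b k hJ0 hJ α hα hmono
    hη hd hdk N
  have b2 := ae_frequently_abs_condExp_lt (m := m)
    (I := fun _ => MeasurableSpace.invariants (shift ℓ))
    (tendsto_integral_abs_atomInfo_sub (m := m) hm.measurable hP (iSup_comap_itinerary_shift ℓ))
  have b3 := ae_all_iff.2 fun j => ae_tendsto_birkhoffAverage hm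
    (measurable_projInfo (m := m) hm.measurable hP (measurable_maskedCoding h (J j)))
    (integrable_projInfo hm.measurable hP (measurable_maskedCoding h (J j)))
  have b4 := ae_all_iff.2 fun N => ae_tendsto_birkhoffAverage hm
    (measurable_markovError (m := m) hm.measurable hP N)
    (integrable_markovError hm.measurable hP N)
  filter_upwards [b1, b2, b3, b4] with x b1 b2 b3 b4 hαx
  obtain ⟨N, hN⟩ := (b2 η hη).exists
  change |(m[markovError m (shift ℓ) (fun x => x 0) N | MeasurableSpace.invariants (shift ℓ)]) x| < η
    at hN
  set e := (m[markovError m (shift ℓ) (fun x => x 0) N | MeasurableSpace.invariants (shift ℓ)]) x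
  set G : ℕ → ℝ := fun j => infoRate m X S (J j) x with hG
  have hG0 : G 0 = 0 := by simp [hG, hJ0, infoRate_empty]
  let W : ℕ → ℕ → ℝ := fun j L => ∑ i ∈ Finset.Ico ⌊d (j + 1) * L⌋₊ ⌊d j * L⌋₊,
    (projInfo m (shift ℓ) (fun x => x 0) (maskedCoding X S (J (j + 1))) ((shift ℓ)^[i] x) +
      markovError m (shift ℓ) (fun x => x 0) N ((shift ℓ)^[i] x))
  have hd' : ∀ j < k, d (j + 1) ≤ d j := by
    intro j hj
    rcases eq_or_lt_of_le (Nat.succ_le_of_lt hj) with he | hlt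
    · rw [Nat.succ_eq_add_one] at he
      rw [he, hdk]
      exact hd0 j hj.le
    · rw [hd j hj, hd (j + 1) hlt]
      exact div_le_div_of_nonneg_left (by positivity) (hα _) (hmono j hlt)
  have hW : ∀ j < k, Tendsto (fun L : ℕ => W j L / L) atTop
      (𝓝 (G (j + 1) * (d j - d (j + 1)) + e * (d j - d (j + 1)))) := by
    intro j hj
    have t1 := (tendsto_birkhoffSum_floor_div (b3 (j + 1)) (hd0 j hj.le)).sub
      (tendsto_birkhoffSum_floor_div (b3 (j + 1)) (hd0 (j + 1) hj))
    have t2 := (tendsto_birkhoffSum_floor_div (b4 N) (hd0 j hj.le)).sub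
      (tendsto_birkhoffSum_floor_div (b4 N) (hd0 (j + 1) hj))
    have t3 := t1.add t2
    have e3 : d j * G (j + 1) - d (j + 1) * G (j + 1) + (d j * e - d (j + 1) * e) =
      G (j + 1) * (d j - d (j + 1)) + e * (d j - d (j + 1)) := by ring
    rw [← e3]
    refine t3.congr fun L => ?_
    have hle : ⌊d (j + 1) * (L : ℝ)⌋₊ ≤ ⌊d j * (L : ℝ)⌋₊ :=
      Nat.floor_le_floor (by have := hd' j hj; gcongr)
    simp only [W]
    rw [Finset.sum_Ico_eq_sub _ hle, Finset.sum_add_distrib, Finset.sum_add_distrib]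
    simp only [birkhoffSum]
    ring
  have hsum : Tendsto (fun L : ℕ => ∑ j ∈ Finset.range k, (η + W j L / L)) atTop
      (𝓝 (∑ j ∈ Finset.range k, (η + (G (j + 1) * (d j - d (j + 1)) +
        e * (d j - d (j + 1)))))) :=
    tendsto_finsetSum _ fun j hj => tendsto_const_nhds.add (hW j (Finset.mem_range.1 hj))
  -- The Markov error is less than `η` per unit of time and acts for total time `d 0`; the last `η`
  -- makes the inequality strict.
  have hlim : ∑ j ∈ Finset.range k, (η + (G (j + 1) * (d j - d (j + 1)) +
      e * (d j - d (j + 1)))) < ∑ j ∈ Finset.range k, (G (j + 1) - G j) * d j +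
        (k * η + η * d 0 + η) := by
    rw [Finset.sum_add_distrib, Finset.sum_add_distrib, sum_mul_sub_succ, ← Finset.mul_sum,
      Finset.sum_range_sub', hG0, hdk, Finset.sum_const, Finset.card_range, nsmul_eq_mul]
    have := mul_le_mul_of_nonneg_right (abs_lt.1 hN).2.le (hd0 0 (Nat.zero_le _))
    linarith
  filter_upwards [b1 N hαx, hsum.eventually_lt_const hlim, eventually_gt_atTop 0] with L h1 h2 hL
  have hL' : (0 : ℝ) < L := by exact_mod_cast hL
  have h3 : ∑ j ∈ Finset.range k, (η * L + W j L) =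
      L * ∑ j ∈ Finset.range k, (η + W j L / L) := by
    rw [Finset.mul_sum]
    refine Finset.sum_congr rfl fun j _ => ?_
    field_simp
  have h4 : ∑ j ∈ Finset.range k, (η * L + W j L) ≤ L * (∑ j ∈ Finset.range k,
      (G (j + 1) - G j) * d j + (k * η + η * d 0 + η)) := by
    rw [h3]
    exact mul_le_mul_of_nonneg_left h2.le hL'.le
  rw [← ofReal_exp_inv, ENNReal.inv_le_iff_le_mul
    (fun _ => (ENNReal.ofReal_pos.2 (Real.exp_pos _)).ne') (fun h0 => absurd h0 ENNReal.ofReal_ne_top)]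
  refine h1.trans ?_
  exact mul_le_mul' (ENNReal.ofReal_le_ofReal (Real.exp_le_exp.2 h4)) le_rfl

/-- The measures of boxes decay at most at the rate predicted by the dimension formula, for
exponents in increasing order. -/
theorem ae_exp_le_boxMeasure [∀ b, NeZero (q b)]
    (h : ∀ b, IsSmoothIFS (X b) (U b) (S b) (c b)) (hm : MeasurePreserving (shift ℓ) m m)
    (hconf : ∀ b, IsConformalFor m (X b) (S b)) (J : ℕ → Finset ι) (b : ℕ → ι) (k : ℕ)
    (hJ0 : J 0 = ∅) (hJ : ∀ j < k, J (j + 1) = insert (b j) (J j)) :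
    ∀ᵐ x ∂m, (∀ j, j + 1 < k → upperLyapunov (X (b j)) (S (b j)) x ≤
        upperLyapunov (X (b (j + 1))) (S (b (j + 1))) x) →
      ∀ ε : ℝ, 0 < ε → ∀ᶠ L : ℕ in atTop,
      ENNReal.ofReal (Real.exp (-(L * (∑ j ∈ Finset.range k,
        (infoRate m X S (J (j + 1)) x - infoRate m X S (J j) x) /
        upperLyapunov (X (b j)) (S (b j)) x + ε)))) ≤
      boxMeasure m X S (J k) (fun _ => Real.exp (-(L : ℝ))) x := by
  -- The scales require constant rates `α`, whereas the exponents depend on the point. Countably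
  -- many rational vectors are treated at once; rounding the exponents down to multiples of
  -- `1/(M+1)` keeps their order and stays below them.
  have hall := ae_all_iff.2 fun M : ℕ => ae_all_iff.2 fun v : ι → ℕ =>
    eventually_imp_distrib_left.2 fun hv : (∀ a, 0 < v a) ∧ ∀ j, j + 1 < k → v (b j) ≤ v (b (j + 1)) =>
    ae_exp_le_boxMeasure_of_le h hm hconf J b k hJ0 hJ
      (fun a => (v a : ℝ) / ((M : ℝ) + 1))
      (fun a => div_pos (by exact_mod_cast hv.1 a) (by positivity))
      (fun j hj => div_le_div_of_nonneg_right (by exact_mod_cast hv.2 j hj) (by positivity))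
      (η := 1 / ((M : ℝ) + 1)) (by positivity)
      (d := fun j => if j < k then (1 + k * (1 / ((M : ℝ) + 1))) / (v (b j) / ((M : ℝ) + 1)) else 0)
      (fun j hj => if_pos hj) (if_neg (lt_irrefl k))
  choose l₀ l₁ hl₀ hl₁ using fun a => (h a).exists_upperLyapunov_bounds
  filter_upwards [hall, ae_all_iff.2 hconf] with x hx hc hsort ε hε
  set lam : ι → ℝ := fun a => upperLyapunov (X a) (S a) x with hlam_def
  have hlam : ∀ a, 0 < lam a := fun a => (hl₀ a).trans_le (hl₁ a x (hc a)).1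
  set G : ℕ → ℝ := fun j => infoRate m X S (J j) x
  let v : ℕ → ι → ℕ := fun M a => ⌊lam a * (M + 1)⌋₊
  have hM : Tendsto (fun M : ℕ => (M : ℝ) + 1) atTop atTop :=
    tendsto_atTop_add_const_right _ _ tendsto_natCast_atTop_atTop
  have hv : ∀ a, Tendsto (fun M => (v M a : ℝ) / ((M : ℝ) + 1)) atTop (𝓝 (lam a)) := fun a =>
    (tendsto_nat_floor_mul_div_atTop (hlam a).le).comp hM
  have hη : Tendsto (fun M : ℕ => 1 / ((M : ℝ) + 1)) atTop (𝓝 0) :=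
    tendsto_one_div_add_atTop_nhds_zero_nat
  let d : ℕ → ℕ → ℝ := fun M j =>
    if j < k then (1 + k * (1 / ((M : ℝ) + 1))) / (v M (b j) / ((M : ℝ) + 1)) else 0
  let d₀ : ℕ → ℝ := fun j => if j < k then 1 / lam (b j) else 0
  have hd : ∀ j, Tendsto (fun M => d M j) atTop (𝓝 (d₀ j)) := by
    intro j
    by_cases hj : j < k
    · simp only [d, d₀, if_pos hj]
      have := (tendsto_const_nhds (x := (1 : ℝ)).add (hη.const_mul (k : ℝ))).div (hv (b j))
        (hlam (b j)).ne'
      rw [mul_zero, add_zero] at this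
      exact this
    · simp only [d, d₀, if_neg hj]
      exact tendsto_const_nhds
  have hlim : Tendsto (fun M : ℕ => ∑ j ∈ Finset.range k, (G (j + 1) - G j) * d M j +
      (k * (1 / ((M : ℝ) + 1)) + 1 / ((M : ℝ) + 1) * d M 0 + 1 / ((M : ℝ) + 1))) atTop
      (𝓝 (∑ j ∈ Finset.range k, (G (j + 1) - G j) * d₀ j + (k * 0 + 0 * d₀ 0 + 0))) :=
    (tendsto_finsetSum _ fun j _ => (hd j).const_mul _).add
      (((hη.const_mul _).add (hη.mul (hd 0))).add hη)
  have heq : ∑ j ∈ Finset.range k, (G (j + 1) - G j) * d₀ j + (k * 0 + 0 * d₀ 0 + 0) =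
      ∑ j ∈ Finset.range k, (G (j + 1) - G j) / lam (b j) := by
    simp only [mul_zero, zero_mul, add_zero]
    refine Finset.sum_congr rfl fun j hj => ?_
    simp only [d₀, if_pos (Finset.mem_range.1 hj)]
    ring
  rw [heq] at hlim
  have hpos : ∀ᶠ M : ℕ in atTop, ∀ a, 0 < v M a := eventually_all.2 fun a => by
    filter_upwards [(hv a).eventually_const_lt (hlam a)] with M hM0
    by_contra h0
    have : v M a = 0 := by omega
    rw [this] at hM0
    simp at hM0
  obtain ⟨M, hMlt, hMpos⟩ := ((hlim.eventually_lt_const (lt_add_of_pos_right _ hε)).and hpos).exists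
  filter_upwards [hx M (v M) ⟨hMpos, fun j hj => Nat.floor_le_floor
      (mul_le_mul_of_nonneg_right (hsort j hj) (by positivity))⟩ fun a => by
      rw [div_le_iff₀ (by positivity)]
      exact Nat.floor_le (mul_nonneg (hlam a).le (by positivity))] with L hL
  refine le_trans (ENNReal.ofReal_le_ofReal (Real.exp_le_exp.2 (neg_le_neg ?_))) hL
  exact mul_le_mul_of_nonneg_left hMlt.le L.cast_nonneg

end UpperBound

/-! ### Local dimensions -/

section LocalDimension

theorem hasLocalDim_of_tendsto {F : Type*} [PseudoMetricSpace F] [MeasurableSpace F]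
    {μ : Measure F} {z : F} {d : ℝ}
    (h : Tendsto (fun r : ℝ => ENNReal.log (μ (Metric.closedBall z r)) / (Real.log r : EReal))
      (𝓝[>] 0) (𝓝 (d : EReal))) : HasLocalDim μ z d :=
  ⟨h.limsup_eq, h.liminf_eq⟩

/-- A radius `r` lies between consecutive scales `e^{-L}`, and this shift of scale is negligible
against `-log r`. The constant `C` absorbs the comparison of boxes with balls. -/
theorem hasLocalDim_of_eventually {F : Type*} [PseudoMetricSpace F] [MeasurableSpace F]
    {μ : Measure F} [IsFiniteMeasure μ] {z : F} {d : ℝ} (C : ℝ)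
    (hle : ∀ ε : ℝ, 0 < ε → ∀ᶠ L : ℕ in atTop,
      μ (Metric.closedBall z (Real.exp (-(L : ℝ)))) ≤ ENNReal.ofReal (Real.exp (-(L * (d - ε)))))
    (hge : ∀ ε : ℝ, 0 < ε → ∀ᶠ L : ℕ in atTop,
      ENNReal.ofReal (Real.exp (-(L * (d + ε)))) ≤
        μ (Metric.closedBall z (Real.exp (C - (L : ℝ))))) : HasLocalDim μ z d := by
  have hu : Tendsto (fun r : ℝ => -Real.log r) (𝓝[>] 0) atTop :=
    tendsto_neg_atBot_atTop.comp Real.tendsto_log_nhdsGT_zero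
  have hreal : ∀ ε : ℝ, 0 < ε → ∀ᶠ r : ℝ in 𝓝[>] 0, 0 < μ (Metric.closedBall z r) ∧
      |Real.log (μ (Metric.closedBall z r)).toReal / Real.log r - d| < ε := by
    intro ε hε
    have h1 := (tendsto_nat_floor_atTop.comp hu).eventually (hle (ε / 2) (by positivity))
    have h2 := (tendsto_nat_ceil_atTop.comp
      (tendsto_atTop_add_const_right _ |C| hu)).eventually (hge (ε / 2) (by positivity))
    have h3 := hu.eventually_gt_atTop 0
    have h4 := (hu.const_mul_atTop (half_pos hε)).eventually_gt_atTop
      ((|C| + 1) * (|d - ε / 2| + |d + ε / 2|))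
    filter_upwards [h1, h2, h3, h4, self_mem_nhdsWithin] with r h1 h2 h3 h4 hr
    have hr0 : (0 : ℝ) < r := hr
    set u := -Real.log r with hu_def
    have hru : r = Real.exp (-u) := by rw [hu_def, neg_neg, Real.exp_log hr0]
    simp only [Function.comp_apply] at h1 h2
    have f1 : (⌊u⌋₊ : ℝ) ≤ u := Nat.floor_le h3.le
    have f2 : u - 1 < ⌊u⌋₊ := Nat.sub_one_lt_floor u
    have f3 : u + |C| ≤ ⌈u + |C|⌉₊ := Nat.le_ceil _
    have f4 : (⌈u + |C|⌉₊ : ℝ) < u + |C| + 1 := Nat.ceil_lt_add_one (by positivity)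
    have g1 : μ (Metric.closedBall z r) ≤ ENNReal.ofReal (Real.exp (-(⌊u⌋₊ * (d - ε / 2)))) := by
      refine (measure_mono (Metric.closedBall_subset_closedBall ?_)).trans h1
      refine hru.le.trans (Real.exp_le_exp.2 ?_)
      linarith
    have g2 : ENNReal.ofReal (Real.exp (-(⌈u + |C|⌉₊ * (d + ε / 2)))) ≤
        μ (Metric.closedBall z r) := by
      refine h2.trans (measure_mono (Metric.closedBall_subset_closedBall ?_))
      refine (Real.exp_le_exp.2 ?_).trans hru.ge
      have := le_abs_self C
      linarith
    have hpos : 0 < μ (Metric.closedBall z r) :=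
      (ENNReal.ofReal_pos.2 (Real.exp_pos _)).trans_le g2
    have htop : μ (Metric.closedBall z r) ≠ ∞ := measure_ne_top _ _
    have hpos' := ENNReal.toReal_pos hpos.ne' htop
    refine ⟨hpos, ?_⟩
    have k1 : Real.log (μ (Metric.closedBall z r)).toReal ≤ -(⌊u⌋₊ * (d - ε / 2)) := by
      rw [Real.log_le_iff_le_exp hpos']
      exact ENNReal.toReal_le_of_le_ofReal (Real.exp_pos _).le g1
    have k2 : -(⌈u + |C|⌉₊ * (d + ε / 2)) ≤ Real.log (μ (Metric.closedBall z r)).toReal := by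
      rw [Real.le_log_iff_exp_le hpos']
      exact (ENNReal.ofReal_le_iff_le_toReal htop).1 g2
    set w := Real.log (μ (Metric.closedBall z r)).toReal
    have hw : w / Real.log r - d = (-w - u * d) / u := by
      have : Real.log r = -u := by rw [hu_def, neg_neg]
      rw [this]
      field_simp
    have e1 : |((⌊u⌋₊ : ℝ) - u) * (d - ε / 2)| ≤ 1 * |d - ε / 2| := by
      rw [abs_mul]
      refine mul_le_mul_of_nonneg_right ?_ (abs_nonneg _)
      rw [abs_le]
      constructor <;> linarith
    have e2 : |((⌈u + |C|⌉₊ : ℝ) - u) * (d + ε / 2)| ≤ (|C| + 1) * |d + ε / 2| := by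
      rw [abs_mul]
      refine mul_le_mul_of_nonneg_right ?_ (abs_nonneg _)
      have := abs_nonneg C
      rw [abs_le]
      constructor <;> linarith
    have e3 : 0 ≤ |C| * |d - ε / 2| := by positivity
    have e4 : 0 ≤ |d + ε / 2| := abs_nonneg _
    have e5 : 0 ≤ |C| * |d + ε / 2| := by positivity
    have e6 : 0 ≤ |d - ε / 2| := abs_nonneg _
    rw [hw, abs_lt, lt_div_iff₀ h3, div_lt_iff₀ h3]
    have a1 := (abs_le.1 e1).1
    have a2 := (abs_le.1 e2).2
    constructor <;> nlinarith
  refine hasLocalDim_of_tendsto ?_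
  have hr : Tendsto (fun r : ℝ => Real.log (μ (Metric.closedBall z r)).toReal / Real.log r)
      (𝓝[>] 0) (𝓝 d) := by
    rw [Metric.tendsto_nhds]
    intro ε hε
    filter_upwards [hreal ε hε] with r hr
    exact hr.2
  refine ((continuous_coe_real_ereal.tendsto d).comp hr).congr' ?_
  filter_upwards [hreal 1 one_pos] with r hr
  simp only [Function.comp_apply]
  have htop : μ (Metric.closedBall z r) ≠ ∞ := measure_ne_top _ _
  rw [EReal.coe_div, ← ENNReal.log_ofReal_of_pos (ENNReal.toReal_pos hr.1.ne' htop),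
    ENNReal.ofReal_toReal htop]

/-- A property that holds at `f x` for almost every `x` holds almost everywhere for the image
measure, whether or not it is measurable. -/
theorem ae_map_of_ae_comp {Ω F : Type*} [MeasurableSpace Ω] [TopologicalSpace Ω] [T2Space Ω]
    [OpensMeasurableSpace Ω] [TopologicalSpace F] [T2Space F] [MeasurableSpace F] [BorelSpace F]
    {m : Measure Ω} [IsFiniteMeasure m] [m.InnerRegularCompactLTTop] {f : Ω → F}
    (hf : Continuous f) (hfm : Measurable f) {p : F → Prop} (h : ∀ᵐ x ∂m, p (f x)) :
    ∀ᵐ z ∂(m.map f), p z := by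
  -- A compact set `K` of nearly full measure is chosen inside the good set. Its image is compact,
  -- hence measurable, and the property holds on it.
  obtain ⟨t, ht, htm, ht0⟩ := exists_measurable_superset_of_null (ae_iff.1 h)
  rw [ae_iff]
  refine le_antisymm (ENNReal.le_of_forall_pos_le_add fun ε hε _ => ?_) bot_le
  obtain ⟨K, hKt, hK, hlt⟩ := htm.compl.exists_isCompact_lt_add (measure_ne_top m _)
    (ENNReal.coe_ne_zero.2 hε.ne')
  have hKc : m Kᶜ ≤ ε := by
    have h1 : m Kᶜ = m (tᶜ \ K) := by
      refine measure_congr ?_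
      filter_upwards [measure_eq_zero_iff_ae_notMem.1 ht0] with x hx
      exact propext ⟨fun hxK => ⟨hx, hxK⟩, fun hxK => hxK.2⟩
    rw [h1, measure_sdiff hKt hK.measurableSet.nullMeasurableSet (measure_ne_top m _)]
    exact tsub_le_iff_left.2 hlt.le
  have hfK : MeasurableSet (f '' K) := (hK.image hf).measurableSet
  rw [zero_add]
  calc m.map f {z | ¬p z} ≤ m.map f (f '' K)ᶜ := by
        refine measure_mono ?_
        rintro z hz ⟨x, hx, rfl⟩
        exact hKt hx (ht hz)
    _ = m (f ⁻¹' (f '' K)ᶜ) := Measure.map_apply hfm hfK.compl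
    _ ≤ m Kᶜ := measure_mono (Set.compl_subset_compl.2 (Set.subset_preimage_image f K))
    _ ≤ ε := hKc

end LocalDimension

/-! ### Local dimensions of the projected measure -/

section ProductMeasure

theorem IsContractive.mono {ℓ : ℕ} {E : Type*} [NormedAddCommGroup E] {X : Set E}
    {S : Fin ℓ → E → E} {c c' : ℝ≥0} (h : IsContractive X S c) (hc : c ≤ c') (hc' : c' < 1) :
    IsContractive X S c' :=
  ⟨h.isCompact, h.nonempty, h.mapsTo, hc', fun i => (h.lipschitz i).weaken hc⟩

section

variable {ℓ : ℕ} {ι : Type*} [Fintype ι] {E : ι → Type*} [∀ a, NormedAddCommGroup (E a)]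
  {X : ∀ a, Set (E a)} {S : ∀ a, Fin ℓ → E a → E a} {c : ι → ℝ≥0}

theorem exists_isContractive_common (h : ∀ a, IsContractive (X a) (S a) (c a)) :
    ∃ c' : ℝ≥0, c' < 1 ∧ ∀ a, IsContractive (X a) (S a) c' := by
  have hlt : Finset.univ.sup c < 1 :=
    (Finset.sup_lt_iff (by simp)).2 fun a _ => (h a).lt_one
  exact ⟨_, hlt, fun a => (h a).mono (Finset.le_sup (Finset.mem_univ a)) hlt⟩

theorem codingMap_prod_apply (h : ∀ a, IsContractive (X a) (S a) (c a)) (x : ShiftSpace ℓ) :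
    codingMap (prodSet X) (prodMaps S) x = WithLp.toLp 2 fun a => codingMap (X a) (S a) x := by
  obtain ⟨c', hc', h'⟩ := exists_isContractive_common h
  exact codingMap_prod hc' h' x

theorem continuous_codingMap_prod (h : ∀ a, IsContractive (X a) (S a) (c a)) :
    Continuous (codingMap (prodSet X) (prodMaps S)) := by
  obtain ⟨c', hc', h'⟩ := exists_isContractive_common h
  exact (IsContractive.prod hc' h').continuous_codingMap

end

variable {ℓ : ℕ} {ι : Type*} [Fintype ι] [DecidableEq ι] {q : ι → ℕ}
  {X U : ∀ b, Set (EuclideanSpace ℝ (Fin (q b)))}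
  {S : ∀ b, Fin ℓ → EuclideanSpace ℝ (Fin (q b)) → EuclideanSpace ℝ (Fin (q b))} {c : ι → ℝ≥0}
  {m : Measure (ShiftSpace ℓ)} [IsProbabilityMeasure m]

theorem map_closedBall_le_boxMeasure (h : ∀ b, IsContractive (X b) (S b) (c b)) (r : ℝ)
    (x : ShiftSpace ℓ) :
    m.map (codingMap (prodSet X) (prodMaps S))
        (Metric.closedBall (codingMap (prodSet X) (prodMaps S) x) r) ≤
      boxMeasure m X S Finset.univ (fun _ => r) x := by
  rw [Measure.map_apply (continuous_codingMap_prod h).measurable measurableSet_closedBall]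
  refine measure_mono fun x' hx' b => ?_
  simp only [Set.mem_preimage, Metric.mem_closedBall, codingMap_prod_apply h] at hx'
  simp only [maskedCoding, Finset.mem_univ, if_true]
  refine le_trans ?_ hx'
  rw [dist_eq_norm, dist_eq_norm]
  exact PiLp.norm_apply_le ((WithLp.toLp 2 fun a => codingMap (X a) (S a) x') -
    WithLp.toLp 2 fun a => codingMap (X a) (S a) x) b

theorem boxMeasure_le_map_closedBall (h : ∀ b, IsContractive (X b) (S b) (c b)) {r : ℝ}
    (hr : 0 ≤ r) (x : ShiftSpace ℓ) :
    boxMeasure m X S Finset.univ (fun _ => r) x ≤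
    m.map (codingMap (prodSet X) (prodMaps S))
        (Metric.closedBall (codingMap (prodSet X) (prodMaps S) x) (√(Fintype.card ι) * r)) := by
  rw [Measure.map_apply (continuous_codingMap_prod h).measurable measurableSet_closedBall]
  refine measure_mono fun x' hx' => ?_
  simp only [Set.mem_preimage, Metric.mem_closedBall, codingMap_prod_apply h]
  have hx : ∀ b, dist (codingMap (X b) (S b) x') (codingMap (X b) (S b) x) ≤ r := fun b => by
    have := hx' b
    simpa only [maskedCoding, Finset.mem_univ, if_true] using this
  rw [PiLp.dist_eq_of_L2, Real.sqrt_le_left (by positivity), mul_pow,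
    Real.sq_sqrt (Nat.cast_nonneg _)]
  calc ∑ b, dist (codingMap (X b) (S b) x') (codingMap (X b) (S b) x) ^ 2
      ≤ ∑ _b : ι, r ^ 2 := Finset.sum_le_sum fun b _ => by
        have := hx b
        gcongr
    _ = Fintype.card ι * r ^ 2 := by simp

theorem projEntropy_eq_integral_projInfo {F : Type*} [MeasurableSpace F] {p : ShiftSpace ℓ → F}
    (hp : Measurable p) :
    projEntropy m p = ∫ x, projInfo m (shift ℓ) (fun x => x 0) p x ∂m := by
  have hP : Measurable fun x : ShiftSpace ℓ => x 0 := measurable_pi_apply 0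
  have hT : Measurable (shift ℓ) := (continuous_shift ℓ).measurable
  have hcyl : cyl ℓ = fun a => (fun x : ShiftSpace ℓ => x 0) ⁻¹' {a} := rfl
  unfold projEntropy projInfo
  rw [integral_sub (integrable_atomInfo (hp.comp hT) hP) (integrable_atomInfo hp hP),
    ← condEntropy_eq_integral_atomInfo (hp.comp hT) hP, ← condEntropy_eq_integral_atomInfo hp hP,
    MeasurableSpace.comap_comp, hcyl]

theorem Ergodic.infoRate_ae_eq (he : Ergodic (shift ℓ) m) (J : Finset ι) :
    ∀ᵐ x ∂m, infoRate m X S J x =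
      ∫ x, projInfo m (shift ℓ) (fun x => x 0) (maskedCoding X S J) x ∂m := by
  obtain ⟨a, ha⟩ := he.quasiErgodic.ae_eq_const_of_ae_eq_comp_ae (g := infoRate m X S J)
    integrable_condExp.aestronglyMeasurable (ae_of_all _ fun x => condExp_invariants_comp _ x)
  have h1 : ∫ x, infoRate m X S J x ∂m = a := by
    rw [integral_congr_ae ha]
    simp
  have h2 : ∫ x, infoRate m X S J x ∂m =
      ∫ x, projInfo m (shift ℓ) (fun x => x 0) (maskedCoding X S J) x ∂m :=
    integral_condExp (MeasurableSpace.invariants_le _)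
  filter_upwards [ha] with x hx
  rw [hx, ← h2, h1]
  rfl

theorem Ergodic.upperLyapunov_ae_eq {E : Type*} [NormedAddCommGroup E] [NormedSpace ℝ E]
    [FiniteDimensional ℝ E] [Nontrivial E]
    [MeasurableSpace E] [BorelSpace E] {X U : Set E} {S : Fin ℓ → E → E} {c : ℝ≥0}
    (he : Ergodic (shift ℓ) m) (h : IsSmoothIFS X U S c) (hconf : IsConformalFor m X S) :
    ∀ᵐ x ∂m, upperLyapunov X S x = lyapunovIntegral m X S := by
  obtain ⟨a, ha⟩ := he.quasiErgodic.ae_eq_const_of_ae_eq_comp_ae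
    (h.integrable_upperLyapunov hconf).aestronglyMeasurable
    (h.ae_upperLyapunov_shift he.toMeasurePreserving hconf)
  have h1 : lyapunovIntegral m X S = a := by
    rw [lyapunovIntegral, integral_congr_ae ha]
    simp
  filter_upwards [ha] with x hx
  rw [hx, h1]
  rfl

end ProductMeasure

/-! ### The dimension formula along an ordering of the factors. -/

section Chain

variable {ℓ n : ℕ} {q : Fin (n + 1) → ℕ}
  {X U : ∀ b, Set (EuclideanSpace ℝ (Fin (q b)))}
  {S : ∀ b, Fin ℓ → EuclideanSpace ℝ (Fin (q b)) → EuclideanSpace ℝ (Fin (q b))}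
  {c : Fin (n + 1) → ℝ≥0} {m : Measure (ShiftSpace ℓ)} [IsProbabilityMeasure m]

/-- The first `j` indices in the order given by `τ`. -/
def initialIndices (τ : Equiv.Perm (Fin (n + 1))) (j : ℕ) : Finset (Fin (n + 1)) :=
  Finset.univ.filter fun a => (τ.symm a : ℕ) < j

/-- The local dimension at the image of `x` when `τ` orders the Lyapunov exponents at `x`. -/
def dimensionSum (m : Measure (ShiftSpace ℓ)) (X : ∀ b, Set (EuclideanSpace ℝ (Fin (q b))))
    (S : ∀ b, Fin ℓ → EuclideanSpace ℝ (Fin (q b)) → EuclideanSpace ℝ (Fin (q b)))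
    (τ : Equiv.Perm (Fin (n + 1))) (x : ShiftSpace ℓ) : ℝ :=
  ∑ j ∈ Finset.range (n + 1),
    (infoRate m X S (initialIndices τ (j + 1)) x - infoRate m X S (initialIndices τ j) x) /
      upperLyapunov (X (τ (Fin.ofNat (n + 1) j))) (S (τ (Fin.ofNat (n + 1) j))) x

theorem initialIndices_zero (τ : Equiv.Perm (Fin (n + 1))) : initialIndices τ 0 = ∅ := by
  simp [initialIndices]

theorem initialIndices_top (τ : Equiv.Perm (Fin (n + 1))) :
    initialIndices τ (n + 1) = Finset.univ := by
  ext a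
  simpa [initialIndices] using (τ.symm a).is_lt

theorem initialIndices_succ (τ : Equiv.Perm (Fin (n + 1))) {j : ℕ} (hj : j < n + 1) :
    initialIndices τ (j + 1) = insert (τ (Fin.ofNat (n + 1) j)) (initialIndices τ j) := by
  ext a
  simp only [initialIndices, Finset.mem_filter, Finset.mem_univ, true_and, Finset.mem_insert,
    ← Equiv.symm_apply_eq, Fin.ext_iff, Fin.ofNat, Nat.mod_eq_of_lt hj]
  omega

theorem notMem_initialIndices (τ : Equiv.Perm (Fin (n + 1))) {j : ℕ} (hj : j < n + 1) :
    τ (Fin.ofNat (n + 1) j) ∉ initialIndices τ j := by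
  simp [initialIndices, Fin.ofNat, Nat.mod_eq_of_lt hj]

/-- The permutation is fixed and the order of the exponents is a condition on the point, so no
measurable choice of an ordering is needed. -/
theorem ae_hasLocalDim_dimensionSum [∀ b, NeZero (q b)]
    (h : ∀ b, IsSmoothIFS (X b) (U b) (S b) (c b)) (hm : MeasurePreserving (shift ℓ) m m)
    (hconf : ∀ b, IsConformalFor m (X b) (S b)) (τ : Equiv.Perm (Fin (n + 1))) :
    ∀ᵐ x ∂m, Monotone (fun j => upperLyapunov (X (τ j)) (S (τ j)) x) →
      HasLocalDim (m.map (codingMap (prodSet X) (prodMaps S)))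
        (codingMap (prodSet X) (prodMaps S) x) (dimensionSum m X S τ x) := by
  have hc := fun b => (h b).toIsContractive
  have : IsProbabilityMeasure (m.map (codingMap (prodSet X) (prodMaps S))) :=
    Measure.isProbabilityMeasure_map (continuous_codingMap_prod hc).measurable.aemeasurable
  filter_upwards [ae_boxMeasure_le h hm hconf (initialIndices τ)
    (fun j => τ (Fin.ofNat (n + 1) j)) (n + 1) (initialIndices_zero τ)
    (fun j hj => initialIndices_succ τ hj) (fun j hj => notMem_initialIndices τ hj),
    ae_exp_le_boxMeasure h hm hconf (initialIndices τ)
    (fun j => τ (Fin.ofNat (n + 1) j)) (n + 1) (initialIndices_zero τ)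
    (fun j hj => initialIndices_succ τ hj)] with x h1 h2 hmono
  have h2 := h2 fun j hj => hmono (by
    rw [Fin.le_def]
    simp only [Fin.ofNat, Nat.mod_eq_of_lt hj, Nat.mod_eq_of_lt (j.lt_succ_self.trans hj)]
    exact j.le_succ)
  rw [initialIndices_top] at h1 h2
  refine hasLocalDim_of_eventually (Real.log √(Fintype.card (Fin (n + 1))))
    (fun ε hε => ?_) fun ε hε => ?_
  · filter_upwards [h1 ε hε] with L hL
    exact (map_closedBall_le_boxMeasure hc _ x).trans hL
  · filter_upwards [h2 ε hε] with L hL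
    refine hL.trans ((boxMeasure_le_map_closedBall hc (Real.exp_pos _).le x).trans_eq ?_)
    rw [sub_eq_add_neg, Real.exp_add, Real.exp_log]
    rw [Fintype.card_fin]
    positivity

theorem comap_maskedCoding_initialIndices (h : ∀ b, IsContractive (X b) (S b) (c b))
    (τ : Equiv.Perm (Fin (n + 1))) (j : Fin (n + 1)) :
    MeasurableSpace.comap (maskedCoding X S (initialIndices τ (j + 1))) inferInstance =
      MeasurableSpace.comap (codingMap (prodSet fun a : {a : Fin (n + 1) // a ≤ j} => X (τ a))
        (prodMaps fun a : {a : Fin (n + 1) // a ≤ j} => S (τ a))) inferInstance := by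
  have hmem : ∀ a, τ a ∈ initialIndices τ (j + 1) ↔ a ≤ j := fun a => by
    simp only [initialIndices, Finset.mem_filter, Finset.mem_univ, true_and,
      Equiv.symm_apply_apply, Fin.le_def, Nat.lt_succ_iff]
  have happ := fun x => codingMap_prod_apply
    (fun a : {a : Fin (n + 1) // a ≤ j} => h (τ a)) x
  refine le_antisymm ?_ ?_
  · have hcoord : ∀ b, ∃ e : (PiLp 2 fun a : {a : Fin (n + 1) // a ≤ j} =>
        EuclideanSpace ℝ (Fin (q (τ a)))) → EuclideanSpace ℝ (Fin (q b)), Measurable e ∧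
        ∀ x, maskedCoding X S (initialIndices τ (j + 1)) x b =
          e (codingMap (prodSet fun a : {a : Fin (n + 1) // a ≤ j} => X (τ a))
            (prodMaps fun a : {a : Fin (n + 1) // a ≤ j} => S (τ a)) x) := by
      intro b
      by_cases hb : b ∈ initialIndices τ (j + 1)
      · obtain ⟨a, rfl⟩ := τ.surjective b
        refine ⟨fun z => z ⟨a, (hmem a).1 hb⟩,
          (measurable_pi_apply (⟨a, (hmem a).1 hb⟩ : {a : Fin (n + 1) // a ≤ j})).comp
            (WithLp.measurable_ofLp _ _), fun x => ?_⟩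
        simp only [maskedCoding, hb, if_true, happ]
      · exact ⟨fun _ => 0, measurable_const, fun x => by simp only [maskedCoding, hb, if_false]⟩
    choose e he hex using hcoord
    exact comap_le_comap_of_eq_comp (measurable_pi_lambda (fun z b => e b z) he)
      fun x => funext fun b => hex b x
  · refine comap_le_comap_of_eq_comp
      (e := fun z => WithLp.toLp 2 fun a : {a : Fin (n + 1) // a ≤ j} => z (τ a)) ?_ fun x => ?_
    · exact (WithLp.measurable_toLp _ _).comp
        (measurable_pi_lambda _ fun a => measurable_pi_apply _)
    · rw [happ]
      congr 1
      funext a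
      simp only [maskedCoding, (hmem a).2 a.2, if_true]

theorem integral_projInfo_initialIndices (h : ∀ b, IsSmoothIFS (X b) (U b) (S b) (c b))
    (τ : Equiv.Perm (Fin (n + 1))) (j : Fin (n + 1)) :
    ∫ x, projInfo m (shift ℓ) (fun x => x 0) (maskedCoding X S (initialIndices τ (j + 1))) x ∂m =
      projEntropy m (codingMap (prodSet fun a : {a : Fin (n + 1) // a ≤ j} => X (τ a))
        (prodMaps fun a : {a : Fin (n + 1) // a ≤ j} => S (τ a))) := by
  have hmeas := (continuous_codingMap_prod
    (fun a : {a : Fin (n + 1) // a ≤ j} => (h (τ a)).toIsContractive)).measurable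
  rw [projEntropy_eq_integral_projInfo hmeas]
  exact integral_congr_ae (projInfo_ae_eq_of_comap_eq (continuous_shift ℓ).measurable
    (measurable_maskedCoding h _) hmeas (measurable_pi_apply 0)
    (comap_maskedCoding_initialIndices (fun b => (h b).toIsContractive) τ j))

theorem Ergodic.dimensionSum_ae_eq [∀ b, NeZero (q b)] (he : Ergodic (shift ℓ) m)
    (h : ∀ b, IsSmoothIFS (X b) (U b) (S b) (c b))
    (hconf : ∀ b, IsConformalFor m (X b) (S b)) (τ : Equiv.Perm (Fin (n + 1)))
    {lam H : Fin (n + 1) → ℝ} (hlam : ∀ j, lam j = lyapunovIntegral m (X j) (S j))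
    (hH : ∀ j, H j = projEntropy m
      (codingMap (prodSet fun a : {a : Fin (n + 1) // a ≤ j} => X (τ a))
        (prodMaps fun a : {a : Fin (n + 1) // a ≤ j} => S (τ a)))) :
    ∀ᵐ x ∂m, dimensionSum m X S τ x =
      H 0 / lam (τ 0) + ∑ j : Fin n, (H j.succ - H j.castSucc) / lam (τ j.succ) := by
  filter_upwards [ae_all_iff.2 fun j : Fin (n + 1) =>
      Ergodic.infoRate_ae_eq he (initialIndices τ (j + 1)),
    ae_all_iff.2 fun b => Ergodic.upperLyapunov_ae_eq he (h b) (hconf b)] with x h1 h2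
  have h1' : ∀ j : Fin (n + 1), infoRate m X S (initialIndices τ (j + 1)) x = H j := fun j => by
    rw [h1 j, integral_projInfo_initialIndices h τ j, hH]
  have h3 : ∀ j : Fin (n + 1), Fin.ofNat (n + 1) (j : ℕ) = j := fun j => by
    ext
    simp [Fin.ofNat, Nat.mod_eq_of_lt j.2]
  rw [dimensionSum, Finset.sum_range, Fin.sum_univ_succ]
  simp only [h3, h2, ← hlam, h1']
  congr 1
  · rw [Fin.val_zero, initialIndices_zero, infoRate_empty]
    simp
  · refine Finset.sum_congr rfl fun j _ => ?_
    rw [show ((j.succ : Fin (n + 1)) : ℕ) = (j.castSucc : ℕ) + 1 by simp, h1']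

end Chain

end

/-! ### Exact dimensionality and the dimension formula. -/

theorem mainTheorem2 {ℓ n : ℕ} (q : Fin (n + 1) → ℕ) (hq : ∀ j, 0 < q j)
    (X : ∀ j, Set (EuclideanSpace ℝ (Fin (q j))))
    (S : ∀ j, Fin ℓ → EuclideanSpace ℝ (Fin (q j)) → EuclideanSpace ℝ (Fin (q j)))
    (hS : ∀ j, IsC1IFS (X j) (S j))
    (m : Measure (ShiftSpace ℓ)) [IsProbabilityMeasure m]
    (hm : MeasurePreserving (shift ℓ) m m)
    (hconf : ∀ j, IsConformalFor m (X j) (S j))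
    (μ : Measure (PiLp 2 fun j => EuclideanSpace ℝ (Fin (q j))))
    (hμ : μ = m.map (codingMap (prodSet X) (prodMaps S))) :
    (∀ᵐ z ∂μ, ∃ d : ℝ, HasLocalDim μ z d) ∧
    (Ergodic (shift ℓ) m →
      IsExactDimensional μ ∧
      ∀ (τ : Equiv.Perm (Fin (n + 1))) (lam : Fin (n + 1) → ℝ) (h : Fin (n + 1) → ℝ),
        (∀ j, lam j = lyapunovIntegral m (X j) (S j)) →
        Monotone (fun j => lam (τ j)) →
        (∀ j, h j = projEntropy m
          (codingMap (prodSet fun a : {a : Fin (n + 1) // a ≤ j} => X (τ a))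
            (prodMaps fun a : {a : Fin (n + 1) // a ≤ j} => S (τ a)))) →
        ∀ᵐ z ∂μ, HasLocalDim μ z
          (h 0 / lam (τ 0) +
            ∑ j : Fin n, (h j.succ - h j.castSucc) / lam (τ j.succ))) := by
  have hN : ∀ b, NeZero (q b) := fun b => ⟨(hq b).ne'⟩
  choose U c h using fun b => (hS b).exists_isSmoothIFS
  have hc := fun b => (h b).toIsContractive
  have hcont := continuous_codingMap_prod hc
  have hall := ae_all_iff.2 fun τ => ae_hasLocalDim_dimensionSum h hm hconf τ
  subst hμ
  refine ⟨ae_map_of_ae_comp hcont hcont.measurable ?_, fun he => ?_⟩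
  -- Outside one null set the statement holds for all permutations, in particular for one that sorts
  -- the exponents at `x`.
  · filter_upwards [hall] with x hx
    exact ⟨_, hx _ (Tuple.monotone_sort fun j => upperLyapunov (X j) (S j) x)⟩
  · have key : ∀ (τ : Equiv.Perm (Fin (n + 1))) (lam : Fin (n + 1) → ℝ) (H : Fin (n + 1) → ℝ),
        (∀ j, lam j = lyapunovIntegral m (X j) (S j)) →
        Monotone (fun j => lam (τ j)) →
        (∀ j, H j = projEntropy m
          (codingMap (prodSet fun a : {a : Fin (n + 1) // a ≤ j} => X (τ a))
            (prodMaps fun a : {a : Fin (n + 1) // a ≤ j} => S (τ a)))) →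
        ∀ᵐ z ∂m.map (codingMap (prodSet X) (prodMaps S)),
          HasLocalDim (m.map (codingMap (prodSet X) (prodMaps S))) z
            (H 0 / lam (τ 0) + ∑ j : Fin n, (H j.succ - H j.castSucc) / lam (τ j.succ)) := by
      intro τ lam H hlam hmono hH
      refine ae_map_of_ae_comp hcont hcont.measurable ?_
      filter_upwards [hall, Ergodic.dimensionSum_ae_eq he h hconf τ hlam hH,
        ae_all_iff.2 fun b => Ergodic.upperLyapunov_ae_eq he (h b) (hconf b)] with x hx hsum hl
      rw [← hsum]
      refine hx τ ?_
      simp only [hl, ← hlam]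
      exact hmono
    exact ⟨⟨_, key _ _ _ (fun _ => rfl)
      (Tuple.monotone_sort fun j => lyapunovIntegral m (X j) (S j)) fun _ => rfl⟩, key⟩
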